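/- Let $m\ge 1$ agents have differentiable local objectives $f_i:\mathbb R^d\to\mathbb R$, and let $F(\theta)=\frac1m\sum_{i=1}^m f_i(\theta)$. Assume that $F$ is convex and has a minimizer, with $F^*=\min_\theta F(\theta)$; that for some $L>0$ every $\nabla f_i$ is $L$-Lipschitz; and that for some constant $B$, $\|\nabla f_i(\theta)\|_1\le B$ for all $i$ and $\theta$. Let $R,C\in\mathbb R^{m\times m}$ have nonnegative off-diagonal entries. A matrix $W$ induces the directed graph $\mathcal G_W$ on $\{1,\dots,m\}$ with an edge from $j$ to $i\neq j$ if and only if $W_{ij}>0$; let $\mathbb N^{\rm in}_{W,i}=\{j\ne i:W_{ij}>0\}$ and $\mathbb N^{\rm out}_{W,i}=\{j\ne i:W_{ji}>0\}$. Let $R_{ii}=-\sum_{j\in\mathbb N^{\rm in}_{R,i}}R_{ij}$ and $C_{ii}=-\sum_{j\in\mathbb N^{\rm out}_{C,i}}C_{ji}$. Assume that $\mathcal G_R$ and $\mathcal G_{C^T}$ each contain a directed spanning tree and that some node is the root of a spanning tree in both graphs. Let $\{\gamma_1^k\},\{\gamma_2^k\}$ be positive and $\{\alpha^k\},\{\lambda^k\}$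 nonnegative deterministic sequences ($k\ge 0$), with $\alpha^k>0$ for all large $k$, and with $1+\gamma_1^kR_{ii}>0$ and $1+\gamma_2^kC_{ii}>0$ for all $i,k$. Consider the iterates with random initial points $x_i^0\in\mathbb R^d$, $y_i^0=\nabla f_i(x_i^0)$ and, for $k\ge0$, $$x_i^{k+1}=(1+\gamma_1^kR_{ii})x_i^k+\gamma_1^k\sum_{j\in\mathbb N^{\rm in}_{R,i}}R_{ij}(x_j^k+\zeta_j^k)-\lambda^ky_i^k,$$ $$y_i^{k+1}=(1-\alpha^k+\gamma_2^kC_{ii})y_i^k+\gamma_2^k\sum_{j\in\mathbb N^{\rm in}_{C,i}}C_{ij}(y_j^k+\xi_j^k)+\nabla f_i(x_i^{k+1})-(1-\alpha^k)\nabla f_i(x_i^k).$$ The noise vectors $\zeta_i^k,\xi_i^k\in\mathbb R^d$ ($1\le i\le m$, $k\ge0$) have zero mean and finite second moments, are mutually independent, and are independent of $(x_1^0,\dots,x_m^0)$; moreover $\mathbb E\|x_i^0\|^2<\infty$ for all $i$, and $$\sum_{k}(\gamma_1^k)^2\max_i\mathbb E\|\zeta_i^k\|^2<\infty,\qquad \sum_{k}(\gamma_2^k)^2\max_i\mathbb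 E\|\xi_i^k\|^2<\infty .$$ Assume, for $\imath\in\{1,2\}$, $$\sum_k\gamma_\imath^k=\infty,\quad\sum_k(\gamma_\imath^k)^2<\infty,\quad\sum_k\alpha^k=\infty,\quad\sum_k\lambda^k=\infty,\quad\sum_k\frac{(\lambda^k)^2}{\gamma_\imath^k}<\infty,\quad\lim_{k\to\infty}\frac{\lambda^k}{\gamma_\imath^k}=0,$$ that the limit $\lim_{k\to\infty}\lambda^k/\alpha^k$ exists and is finite, and that $\sum_k\frac{(\alpha^k)^2}{\gamma_2^k}<\infty$ and $\sum_k\frac{(\gamma_1^k)^2}{\gamma_2^k}<\infty$. Then there are vectors $u,v\in\mathbb R^m$ such that for every $k$, $u$ is the unique nonnegative vector with $u^T(I+\gamma_1^kR)=u^T$ and $u^T\mathbf 1=m$, and $v$ is the unique nonnegative vector with $((1-\alpha^k)I+\gamma_2^kC)v=(1-\alpha^k)v$ and $\mathbf 1^Tv=m$. With $\bar x^k=\frac1m\sum_iu_ix_i^k$ and $\bar y^k=\frac1m\sum_iy_i^k$, the following hold. (a) Almost surely, $\lim_{k\to\infty}F(\bar x^k)$ exists (as a finite number), and $\lim_{k\to\infty}\|x_i^k-\bar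 x^k\|=\lim_{k\to\infty}\|y_i^k-v_i\bar y^k\|=0$ for all $i$. (b) Almost surely, $\liminf_{k\to\infty}\|\nabla F(\bar x^k)\|=0$. Moreover, if all sublevel sets $\{\theta: F(\theta)\le c\}$ of $F$ are bounded, then almost surely $\{\bar x^k\}$ is bounded, every accumulation point of $\{\bar x^k\}$ is a minimizer of $F$, and $\lim_{k\to\infty}F(x_i^k)=F^*$ for all $i$. -/

import Mathlib

open MeasureTheory ProbabilityTheory Filter Topology
open scoped Matrix

namespace DPTracking

/-- The decision space `ℝ^d` with its Euclidean norm. -/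
abbrev Vec (d : ℕ) : Type := EuclideanSpace ℝ (Fin d)

/-- The global objective `F(θ) = (1/m) ∑ i, f_i(θ)`. -/
noncomputable def objective {m d : ℕ} (f : Fin m → Vec d → ℝ) (θ : Vec d) : ℝ :=
  (1 / (m : ℝ)) * ∑ i, f i θ

/-- The problem has an optimal solution, `F` is convex, and the gradients of the (differentiable)
local objectives are Lipschitz continuous with a common constant. -/
structure ObjectiveAssumption {m d : ℕ} (f : Fin m → Vec d → ℝ) : Prop where
  exists_optimal : ∃ θ : Vec d, IsMinOn (objective f) Set.univ θ
  convex : ConvexOn ℝ Set.univ (objective f)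
  differentiable : ∀ i, Differentiable ℝ (f i)
  lipschitz : ∃ L : ℝ, 0 < L ∧ ∀ i (a b : Vec d),
    ‖gradient (f i) a - gradient (f i) b‖ ≤ L * ‖a - b‖

/-- The gradients of the local objectives are bounded in the `ℓ¹` norm. -/
def BoundedGradients {m d : ℕ} (f : Fin m → Vec d → ℝ) : Prop :=
  ∃ B : ℝ, ∀ i (a : Vec d), ∑ l, |gradient (f i) a l| ≤ B

/-- In-neighbours of `i` in the graph induced by `W`: there is an edge from `j` to `i` when
`W i j > 0`. -/
noncomputable def inNbr {m : ℕ} (W : Matrix (Fin m) (Fin m) ℝ) (i : Fin m) : Finset (Fin m) :=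
  {j : Fin m | j ≠ i ∧ 0 < W i j}

/-- Out-neighbours of `i` in the graph induced by `W`. -/
noncomputable def outNbr {m : ℕ} (W : Matrix (Fin m) (Fin m) ℝ) (i : Fin m) : Finset (Fin m) :=
  {j : Fin m | j ≠ i ∧ 0 < W j i}

/-- `r` is the root of a directed spanning tree of the graph induced by `W`. The tree is given by
its parent map: every node other than `r` has an edge coming from its parent, and following
parents leads from any node to `r`. -/
def IsSpanningTreeRoot {m : ℕ} (W : Matrix (Fin m) (Fin m) ℝ) (r : Fin m) : Prop :=
  ∃ parent : Fin m → Fin m,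
    (∀ i, i ≠ r → parent i ∈ inNbr W i) ∧ ∀ i, ∃ n : ℕ, parent^[n] i = r

/-- The coupling matrices: nonnegative off-diagonal entries, diagonal entries chosen such that `R`
has zero row sums and `C` has zero column sums, and a common root of spanning trees of the graphs
induced by `R` and by `Cᵀ`. -/
structure TopologyAssumption {m : ℕ} (R C : Matrix (Fin m) (Fin m) ℝ) : Prop where
  R_nonneg : ∀ i j, i ≠ j → 0 ≤ R i j
  C_nonneg : ∀ i j, i ≠ j → 0 ≤ C i j
  R_diag : ∀ i, R i i = -∑ j ∈ inNbr R i, R i j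
  C_diag : ∀ i, C i i = -∑ j ∈ outNbr C i, C j i
  spanning_R : ∃ r, IsSpanningTreeRoot R r
  spanning_C : ∃ r, IsSpanningTreeRoot Cᵀ r
  common_root : ∃ r, IsSpanningTreeRoot R r ∧ IsSpanningTreeRoot Cᵀ r

/-- The `x`-update, for given current states and a given noise value. -/
noncomputable def xUpdate {m d : ℕ} (R : Matrix (Fin m) (Fin m) ℝ) (g₁ lam : ℝ)
    (x y ζ : Fin m → Vec d) (i : Fin m) : Vec d :=
  (1 + g₁ * R i i) • x i + g₁ • (∑ j ∈ inNbr R i, R i j • (x j + ζ j)) - lam • y i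

/-- The `y`-update, for given current states, next state `x'`, and a given noise value. -/
noncomputable def yUpdate {m d : ℕ} (f : Fin m → Vec d → ℝ) (C : Matrix (Fin m) (Fin m) ℝ)
    (g₂ a : ℝ) (x x' y ξ : Fin m → Vec d) (i : Fin m) : Vec d :=
  (1 - a + g₂ * C i i) • y i + g₂ • (∑ j ∈ inNbr C i, C i j • (y j + ξ j))
    + gradient (f i) (x' i) - (1 - a) • gradient (f i) (x i)

/-- The states `(x^k, y^k)` of the noisy gradient-tracking algorithm, for a given initial point
`x₀` and given noise realizations `ζ k j`, `ξ k j`. -/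
noncomputable def states {m d : ℕ} (f : Fin m → Vec d → ℝ) (R C : Matrix (Fin m) (Fin m) ℝ)
    (γ₁ γ₂ α lam : ℕ → ℝ) (x₀ : Fin m → Vec d) (ζ ξ : ℕ → Fin m → Vec d) :
    ℕ → (Fin m → Vec d) × (Fin m → Vec d)
  | 0 => (x₀, fun i => gradient (f i) (x₀ i))
  | k + 1 =>
    let s := states f R C γ₁ γ₂ α lam x₀ ζ ξ k
    let x' := xUpdate R (γ₁ k) (lam k) s.1 s.2 (ζ k)
    (x', yUpdate f C (γ₂ k) (α k) s.1 x' s.2 (ξ k))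

/-- The noise and the initial points: zero mean, finite second moments, all noise vectors mutually
independent and independent of the initial points, weighted variances summable. -/
structure NoiseAssumption {m d : ℕ} {Ω : Type*} [MeasurableSpace Ω] (μ : Measure Ω)
    (γ₁ γ₂ : ℕ → ℝ) (x₀ : Fin m → Ω → Vec d) (ζ ξ : ℕ → Fin m → Ω → Vec d) : Prop where
  measurable_x₀ : ∀ i, Measurable (x₀ i)
  measurable_ζ : ∀ k i, Measurable (ζ k i)
  measurable_ξ : ∀ k i, Measurable (ξ k i)
  memLp_x₀ : ∀ i, MemLp (x₀ i) 2 μ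
  memLp_ζ : ∀ k i, MemLp (ζ k i) 2 μ
  memLp_ξ : ∀ k i, MemLp (ξ k i) 2 μ
  mean_ζ : ∀ k i, ∫ ω, ζ k i ω ∂μ = 0
  mean_ξ : ∀ k i, ∫ ω, ξ k i ω ∂μ = 0
  indep_noise : iIndepFun
    (Sum.elim (fun p : ℕ × Fin m => ζ p.1 p.2) (fun p : ℕ × Fin m => ξ p.1 p.2)) μ
  indep_initial : IndepFun (fun ω (i : Fin m) => x₀ i ω)
    (fun ω (p : (ℕ × Fin m) ⊕ (ℕ × Fin m)) =>
      Sum.elim (fun q : ℕ × Fin m => ζ q.1 q.2 ω) (fun q : ℕ × Fin m => ξ q.1 q.2 ω) p) μ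
  summable_ζ : Summable fun k => γ₁ k ^ 2 * ⨆ i : Fin m, ∫ ω, ‖ζ k i ω‖ ^ 2 ∂μ
  summable_ξ : Summable fun k => γ₂ k ^ 2 * ⨆ i : Fin m, ∫ ω, ‖ξ k i ω‖ ^ 2 ∂μ

/-- The series of the terms `a k` diverges to `+∞`. -/
def DivergentSeries (a : ℕ → ℝ) : Prop :=
  Tendsto (fun n => ∑ k ∈ Finset.range n, a k) atTop atTop

/-- A weakening factor `γ` for a coupling matrix `W`, relative to the stepsize `lam`. -/
structure WeakeningCondition {m : ℕ} (W : Matrix (Fin m) (Fin m) ℝ) (γ lam : ℕ → ℝ) : Prop where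
  pos : ∀ k, 0 < γ k
  diag : ∀ k i, 0 < 1 + γ k * W i i
  sum : DivergentSeries γ
  sum_sq : Summable fun k => γ k ^ 2
  sum_ratio : Summable fun k => lam k ^ 2 / γ k
  ratio : Tendsto (fun k => lam k / γ k) atTop (𝓝 0)

/-- All conditions on the stepsizes and weakening factors. -/
structure StepsizeAssumption {m : ℕ} (R C : Matrix (Fin m) (Fin m) ℝ)
    (γ₁ γ₂ α lam : ℕ → ℝ) : Prop where
  lam_nonneg : ∀ k, 0 ≤ lam k
  α_nonneg : ∀ k, 0 ≤ α k
  weak₁ : WeakeningCondition R γ₁ lam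
  weak₂ : WeakeningCondition C γ₂ lam
  sum_α : DivergentSeries α
  sum_lam : DivergentSeries lam
  /-- The quotients `lam k / α k` are meaningful for large `k`. -/
  α_eventually_pos : ∀ᶠ k in atTop, 0 < α k
  ratio_α : ∃ l : ℝ, Tendsto (fun k => lam k / α k) atTop (𝓝 l)
  sum_α_sq : Summable fun k => α k ^ 2 / γ₂ k
  sum_γ₁_sq : Summable fun k => γ₁ k ^ 2 / γ₂ k

/-- `w` is a nonnegative left eigenvector of `A` for the eigenvalue `c`, with entries of sum `m`. -/
def IsNormalizedLeftEigenvector {m : ℕ} (A : Matrix (Fin m) (Fin m) ℝ) (c : ℝ)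
    (w : Fin m → ℝ) : Prop :=
  (∀ i, 0 ≤ w i) ∧ ∑ i, w i = m ∧ w ᵥ* A = c • w

/-- `w` is a nonnegative right eigenvector of `A` for the eigenvalue `c`, with entries of
sum `m`. -/
def IsNormalizedRightEigenvector {m : ℕ} (A : Matrix (Fin m) (Fin m) ℝ) (c : ℝ)
    (w : Fin m → ℝ) : Prop :=
  (∀ i, 0 ≤ w i) ∧ ∑ i, w i = m ∧ A *ᵥ w = c • w

/-- The weighted average `(1/m) ∑ i, w_i z_i`. -/
noncomputable def weightedAvg {m d : ℕ} (w : Fin m → ℝ) (z : Fin m → Vec d) : Vec d :=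
  (1 / (m : ℝ)) • ∑ i, w i • z i

/-- All sublevel sets of `F` are bounded. -/
def BoundedLevelSets {d : ℕ} (F : Vec d → ℝ) : Prop :=
  ∀ c : ℝ, Bornology.IsBounded {θ : Vec d | F θ ≤ c}

end DPTracking

/-! Stack the agents: with `G` the stacked gradient, `X' = X + γ₁ R X - λ Y + γ₁ N₁` and `Y' = (1 -
α) Y + γ₂ C Y + γ₂ N₂ + G(X') - (1 - α) G(X)`. Let `P₁` and `P₂` be the projections onto the
disagreement parts of `X` and `Y`.

Linear part: the spanning trees make powers of `1 + ε R` and `1 + ε Cᵀ` converge to rank one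
(`exists_pow_close`). Summing squared norms along an orbit then gives a quadratic form that
contracts by `1 - 2cγ` for every small step `γ` (`isLyapunov_orbitMap`).

The main obstacle is that `N₁` reaches `Y` through `G(X') - G(X)`, nonlinearly and hence not
centered; as a plain perturbation it would cost `γ₁² E‖N₁‖² / γ₂`, which need not be summable. The
remedy is the filtered noise `q' = (1 - γ₂) q + γ₁ N₁`. The difference `X - q` receives no fresh
noise, so `w = Y - G(X) + G(X - q)` obeys a linear recursion with predictable drift and fresh noise
`γ₂ N₂` only (`shiftedTracker_succ`), while `∑ γ₂ E‖q‖² < ∞`.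

A deterministic Robbins–Siegmund argument bounds the second moments of the consensus error and of
`w` (`moment_bounds`); convergence of `L²`-bounded martingales upgrades this to almost sure decay
(`ae_decay`). The mean tracking error `(1 - P₂)(Y - G(X))` contracts by the scalar `1 - α`, so its
squares are summable with weights `α`, hence with weights `λ = O(α)`.

Finally `x̄` performs gradient descent with step `κλ`, where `κ = (1/m) ∑ u_i v_i` is positive
thanks to the common root, up to errors whose squares are summable with weights `λ` and a convergent
martingale. Hence `F(x̄)` converges and `∑ λ‖∇F(x̄)‖² < ∞`. As `∑ λ = ∞`, gradients are small
infinitely often, and on a bounded set convexity identifies the limit as the minimum. -/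

set_option linter.unusedSectionVars false

namespace DPTracking

/-! ### Stochastic matrices of rooted graphs and their invariant vectors. -/

section Graph

variable {m : ℕ}

/-- Doeblin's contraction: every row puts weight at least `δ` on the common value `x r`, so only the
fraction `1 - δ` of the spread survives. -/
lemma mulVec_mem_Icc_of_le_column {Q : Matrix (Fin m) (Fin m) ℝ}
    (hQ0 : ∀ i j, 0 ≤ Q i j) (hQ1 : ∀ i, ∑ j, Q i j = 1) {r : Fin m} {δ : ℝ}
    (hδ : ∀ i, δ ≤ Q i r) {x : Fin m → ℝ} {a b : ℝ}
    (hx : ∀ i, x i ∈ Set.Icc a b) (i : Fin m) :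
    (Q *ᵥ x) i ∈ Set.Icc ((1 - δ) * a + δ * x r) ((1 - δ) * b + δ * x r) := by
  have key : ∀ z : Fin m → ℝ, (∀ j, 0 ≤ z j) → δ * z r ≤ ∑ j, Q i j * z j := fun z hz =>
    (mul_le_mul_of_nonneg_right (hδ i) (hz r)).trans
      (Finset.single_le_sum (f := fun j => Q i j * z j)
        (fun j _ => mul_nonneg (hQ0 i j) (hz j)) (Finset.mem_univ r))
  have h1 := key (fun j => x j - a) fun j => sub_nonneg.2 (hx j).1
  have h2 := key (fun j => b - x j) fun j => sub_nonneg.2 (hx j).2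
  simp only [mul_sub, Finset.sum_sub_distrib, ← Finset.sum_mul, hQ1] at h1 h2
  simp only [Matrix.mulVec, dotProduct]
  constructor <;> linarith

lemma exists_Icc_pow_mulVec {Q : Matrix (Fin m) (Fin m) ℝ}
    (hQ0 : ∀ i j, 0 ≤ Q i j) (hQ1 : ∀ i, ∑ j, Q i j = 1) {r : Fin m} {δ : ℝ}
    (hδ : ∀ i, δ ≤ Q i r) {x : Fin m → ℝ}
    (hx : ∀ i, x i ∈ Set.Icc (0 : ℝ) 1) (k : ℕ) :
    ∃ a b : ℝ, b - a = (1 - δ) ^ k ∧ ∀ i, ((Q ^ k) *ᵥ x) i ∈ Set.Icc a b := by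
  induction k with
  | zero => exact ⟨0, 1, by simp, by simpa using hx⟩
  | succ k ih =>
    obtain ⟨a, b, hab, h⟩ := ih
    refine ⟨(1 - δ) * a + δ * ((Q ^ k) *ᵥ x) r, (1 - δ) * b + δ * ((Q ^ k) *ᵥ x) r, ?_,
      fun i => ?_⟩
    · rw [pow_succ, ← hab]; ring
    · rw [pow_succ', ← Matrix.mulVec_mulVec]
      exact mulVec_mem_Icc_of_le_column hQ0 hQ1 hδ h i

/-- The matrix `1 + ε • W` is row stochastic if `W` has zero row sums, nonnegative off-diagonal
entries and not too negative diagonal entries. -/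
lemma one_add_smul_mem_rowStochastic {W : Matrix (Fin m) (Fin m) ℝ}
    (hoff : ∀ i j, i ≠ j → 0 ≤ W i j) (hrow : ∀ i, ∑ j, W i j = 0) {ε : ℝ} (hε : 0 < ε)
    (hdiag : ∀ i, 0 < 1 + ε * W i i) : 1 + ε • W ∈ Matrix.rowStochastic ℝ (Fin m) := by
  rw [Matrix.mem_rowStochastic_iff_sum]
  refine ⟨fun i j => ?_, fun i => ?_⟩
  · by_cases h : i = j
    · subst h; simpa using (hdiag i).le
    · simpa [Matrix.one_apply, h] using mul_nonneg hε.le (hoff i j h)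
  · simp [Finset.sum_add_distrib, ← Finset.mul_sum, hrow, Matrix.one_apply]

/-- Parents trace a walk of positive weight from each node to the root. The positive diagonal lets
short walks be padded, so one exponent serves all nodes. -/
lemma exists_pow_column_pos {W : Matrix (Fin m) (Fin m) ℝ}
    (hoff : ∀ i j, i ≠ j → 0 ≤ W i j) (hrow : ∀ i, ∑ j, W i j = 0) {ε : ℝ} (hε : 0 < ε)
    (hdiag : ∀ i, 0 < 1 + ε * W i i) {r : Fin m} (hr : IsSpanningTreeRoot W r) :
    ∃ n, ∀ i, 0 < ((1 + ε • W : Matrix (Fin m) (Fin m) ℝ) ^ n) i r := by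
  have hA := one_add_smul_mem_rowStochastic hoff hrow hε hdiag
  set A := 1 + ε • W with hAdef
  have hpow : ∀ n i j, 0 ≤ (A ^ n) i j := fun n =>
    (Matrix.mem_rowStochastic_iff_sum.1 (pow_mem hA n)).1
  have step : ∀ n i j l, 0 < A i j → 0 < (A ^ n) j l → 0 < (A ^ (n + 1)) i l := by
    intro n i j l h1 h2
    rw [pow_succ', Matrix.mul_apply]
    exact (mul_pos h1 h2).trans_le (Finset.single_le_sum (f := fun j => A i j * (A ^ n) j l)
      (fun j _ => mul_nonneg ((Matrix.mem_rowStochastic_iff_sum.1 hA).1 i j) (hpow n j l))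
      (Finset.mem_univ j))
  have hdiagA : ∀ i, 0 < A i i := fun i => by simpa [hAdef] using hdiag i
  have mono : ∀ i n k, n ≤ k → 0 < (A ^ n) i r → 0 < (A ^ k) i r := by
    intro i n k hnk h
    induction k, hnk using Nat.le_induction with
    | base => exact h
    | succ k _ ih => exact step k i i r (hdiagA i) ih
  obtain ⟨parent, hp, hroot⟩ := hr
  have path : ∀ n i, parent^[n] i = r → 0 < (A ^ n) i r := by
    intro n
    induction n with
    | zero => rintro i rfl; simp
    | succ n ih =>
      intro i hi
      by_cases h : i = r
      · subst h
        exact mono _ 0 _ (Nat.zero_le _) (by simp)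
      · have h1 := hp i h
        simp only [inNbr, Finset.mem_filter, Finset.mem_univ, true_and] at h1
        refine step n i (parent i) r ?_ (ih _ hi)
        simpa [hAdef, Matrix.one_apply, h1.1.symm] using mul_pos hε h1.2
  choose n hn using hroot
  exact ⟨Finset.univ.sup n, fun i =>
    mono i _ _ (Finset.le_sup (Finset.mem_univ i)) (path _ i (hn i))⟩

lemma vecMul_one_add_smul_pow {W : Matrix (Fin m) (Fin m) ℝ} {w : Fin m → ℝ}
    (hw : w ᵥ* W = 0) (ε : ℝ) (n : ℕ) : w ᵥ* (1 + ε • W) ^ n = w := by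
  induction n with
  | zero => simp
  | succ n ih =>
    rw [pow_succ, ← Matrix.vecMul_vecMul, ih, Matrix.vecMul_add, Matrix.vecMul_smul, hw]
    simp

/-- By Doeblin's contraction the entries of column `j` of a high power share a short interval. It
also contains `u j / m`, which by invariance of `u` is the average of that column with weights `u i
/ m`. -/
lemma exists_pow_close {W : Matrix (Fin m) (Fin m) ℝ}
    (hoff : ∀ i j, i ≠ j → 0 ≤ W i j) (hrow : ∀ i, ∑ j, W i j = 0) {ε : ℝ} (hε : 0 < ε)
    (hdiag : ∀ i, 0 < 1 + ε * W i i) {r : Fin m} (hr : IsSpanningTreeRoot W r)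
    {u : Fin m → ℝ} (hu : ∀ i, 0 ≤ u i) (hum : ∑ i, u i = m) (huW : u ᵥ* W = 0)
    {η : ℝ} (hη : 0 < η) :
    ∃ N, 0 < N ∧ ∀ i j, |((1 + ε • W : Matrix (Fin m) (Fin m) ℝ) ^ N) i j - u j / m| ≤ η := by
  obtain ⟨n, hn⟩ := exists_pow_column_pos hoff hrow hε hdiag hr
  have hA := one_add_smul_mem_rowStochastic hoff hrow hε hdiag
  set A := 1 + ε • W with hAdef
  have hQ := Matrix.mem_rowStochastic_iff_sum.1 (pow_mem hA n)
  have : Nonempty (Fin m) := ⟨r⟩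
  obtain ⟨i₀, hδ⟩ := Finite.exists_min fun i => (A ^ n) i r
  set δ := (A ^ n) i₀ r with hδdef
  have hδ0 : 0 < δ := hn i₀
  have hδ1 : δ ≤ 1 := by
    rw [← hQ.2 i₀]
    exact Finset.single_le_sum (f := fun j => (A ^ n) i₀ j) (fun j _ => hQ.1 i₀ j)
      (Finset.mem_univ r)
  obtain ⟨k, hk⟩ := exists_pow_lt_of_lt_one hη (by linarith : 1 - δ < 1)
  have hm : (0 : ℝ) < m := by exact_mod_cast r.pos
  -- a positive exponent, also when `n = 0`
  have hN : ∃ N, 0 < N ∧ ∃ l, k ≤ l ∧ A ^ N = (A ^ n) ^ l := by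
    by_cases h0 : n = 0
    · refine ⟨1, one_pos, k, le_rfl, ?_⟩
      -- When `n = 0`, positivity of column `r` of the identity matrix leaves only the index `r`,
      -- and then `A = 1`.
      have hsub : ∀ i : Fin m, i = r := fun i => by
        by_contra hir
        have := hn i
        rw [h0, pow_zero, Matrix.one_apply_ne hir] at this
        exact lt_irrefl _ this
      have h1 : A ^ 1 = 1 := by
        ext i j
        have := (Matrix.mem_rowStochastic_iff_sum.1 hA).2 r
        rw [Finset.sum_eq_single r (fun b _ hb => absurd (hsub b) hb) (by simp)] at this
        rw [hsub i, hsub j, pow_one, this, Matrix.one_apply_eq]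
      rw [h1, h0]; simp
    · exact ⟨n * (k + 1), by positivity, k + 1, by omega, pow_mul _ _ _⟩
  obtain ⟨N, hNpos, l, hkl, hAN⟩ := hN
  refine ⟨N, hNpos, fun i j => ?_⟩
  obtain ⟨a, b, hab, h⟩ := exists_Icc_pow_mulVec hQ.1 hQ.2 hδ (x := Pi.single j 1)
    (fun i => by by_cases h : i = j <;> simp [h]) l
  simp only [← hAN, Matrix.mulVec_single_one, Matrix.col_apply] at h
  have hw : u j = ∑ i, u i * (A ^ N) i j := by
    have := congrFun (vecMul_one_add_smul_pow huW ε N) j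
    simpa [Matrix.vecMul, dotProduct, ← hAdef] using this.symm
  have hlow : a ≤ u j / m := by
    rw [le_div_iff₀ hm, hw, ← hum, Finset.mul_sum]
    exact Finset.sum_le_sum fun i _ => by nlinarith [hu i, (h i).1]
  have hupp : u j / m ≤ b := by
    rw [div_le_iff₀ hm, hw, ← hum, Finset.mul_sum]
    exact Finset.sum_le_sum fun i _ => by nlinarith [hu i, (h i).2]
  have hle : b - a ≤ η := by
    rw [hab]
    exact (pow_le_pow_of_le_one (by linarith) (by linarith) hkl).trans hk.le
  rw [abs_le]
  constructor <;> linarith [(h i).1, (h i).2]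

/-- Zero row sums make `W` singular. For a left null vector `w` one has `|w| ≤ |w| A` entrywise;
both sides have the same total because `A` is stochastic, so equality holds and `|w|` is a null
vector too. -/
lemma exists_nonneg_vecMul_eq_zero {W : Matrix (Fin m) (Fin m) ℝ} (hm : 0 < m)
    (hoff : ∀ i j, i ≠ j → 0 ≤ W i j) (hrow : ∀ i, ∑ j, W i j = 0) {ε : ℝ} (hε : 0 < ε)
    (hdiag : ∀ i, 0 < 1 + ε * W i i) :
    ∃ u : Fin m → ℝ, (∀ i, 0 ≤ u i) ∧ ∑ i, u i = m ∧ u ᵥ* W = 0 := by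
  have hA := one_add_smul_mem_rowStochastic hoff hrow hε hdiag
  have hdet : W.det = 0 := by
    rw [← Matrix.exists_mulVec_eq_zero_iff]
    refine ⟨1, fun h => one_ne_zero (congrFun h ⟨0, hm⟩), ?_⟩
    ext i
    simp [Matrix.mulVec, dotProduct, hrow]
  obtain ⟨w, hw0, hw⟩ := Matrix.exists_vecMul_eq_zero_iff.2 hdet
  have hwA : ∀ j, w j = ∑ i, w i * (1 + ε • W : Matrix (Fin m) (Fin m) ℝ) i j := fun j => by
    have := congrFun (vecMul_one_add_smul_pow hw ε 1) j
    simpa only [pow_one, Matrix.vecMul, dotProduct] using this.symm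
  set A := 1 + ε • W with hAdef
  have hA' := Matrix.mem_rowStochastic_iff_sum.1 hA
  have hle : ∀ j ∈ Finset.univ, |w j| ≤ ∑ i, |w i| * A i j := fun j _ => by
    conv_lhs => rw [hwA j]
    refine (Finset.abs_sum_le_sum_abs _ _).trans_eq ?_
    simp [abs_mul, abs_of_nonneg (hA'.1 _ _)]
  have hsum : ∑ j, |w j| = ∑ j, ∑ i, |w i| * A i j := by
    rw [Finset.sum_comm]
    simp [← Finset.mul_sum, hA'.2]
  have heq := (Finset.sum_eq_sum_iff_of_le hle).1 hsum
  have habs : (fun i => |w i|) ᵥ* W = 0 := by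
    ext j
    have := heq j (Finset.mem_univ j)
    simp only [hAdef, Matrix.add_apply, Matrix.smul_apply, smul_eq_mul, mul_add,
      Finset.sum_add_distrib, Matrix.one_apply, mul_ite, mul_one, mul_zero,
      Finset.sum_ite_eq', Finset.mem_univ, if_true] at this
    have h2 : ∑ i, |w i| * (ε * W i j) = ε * ∑ i, |w i| * W i j := by
      rw [Finset.mul_sum]; exact Finset.sum_congr rfl fun i _ => by ring
    rw [h2] at this
    have h3 : ε * ∑ i, |w i| * W i j = 0 := by linarith
    simpa [Matrix.vecMul, dotProduct, hε.ne'] using h3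
  have hpos : 0 < ∑ i, |w i| := by
    obtain ⟨i, hi⟩ := Function.ne_iff.1 hw0
    exact Finset.sum_pos' (fun _ _ => abs_nonneg _) ⟨i, Finset.mem_univ i, abs_pos.2 hi⟩
  refine ⟨(m / ∑ i, |w i|) • fun i => |w i|, fun i => ?_, ?_, ?_⟩
  · simp only [Pi.smul_apply, smul_eq_mul]; positivity
  · simp only [Pi.smul_apply, smul_eq_mul, ← Finset.mul_sum]
    field_simp
  · rw [Matrix.smul_vecMul, habs, smul_zero]

/-- The difference `z` is invariant with sum zero, so `z j = ∑ i, z i * ((A ^ N) i j - u j / m)` for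
every `N`, and the right side can be made arbitrarily small. -/
lemma eq_of_vecMul_eq_zero {W : Matrix (Fin m) (Fin m) ℝ}
    (hoff : ∀ i j, i ≠ j → 0 ≤ W i j) (hrow : ∀ i, ∑ j, W i j = 0) {ε : ℝ} (hε : 0 < ε)
    (hdiag : ∀ i, 0 < 1 + ε * W i i) {r : Fin m} (hr : IsSpanningTreeRoot W r)
    {u : Fin m → ℝ} (hu : ∀ i, 0 ≤ u i) (hum : ∑ i, u i = m) (huW : u ᵥ* W = 0)
    {w : Fin m → ℝ} (hwm : ∑ i, w i = m) (hwW : w ᵥ* W = 0) : w = u := by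
  have hz : (w - u) ᵥ* W = 0 := by rw [Matrix.sub_vecMul, hwW, huW, sub_zero]
  have hs : ∑ i, (w - u) i = 0 := by simp [Finset.sum_sub_distrib, hwm, hum]
  rw [← sub_eq_zero]
  set z := w - u with hzdef
  ext j
  by_contra hj
  have hS : 0 < ∑ i, |z i| :=
    Finset.sum_pos' (fun _ _ => abs_nonneg _) ⟨j, Finset.mem_univ j, abs_pos.2 hj⟩
  -- This choice turns the estimate into `|z j| ≤ |z j| / 2`.
  have hη : 0 < |z j| / (2 * ∑ i, |z i|) := div_pos (abs_pos.2 hj) (by positivity)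
  obtain ⟨N, -, hN⟩ := exists_pow_close hoff hrow hε hdiag hr hu hum huW hη
  have h1 : z j = ∑ i, z i * (((1 + ε • W : Matrix (Fin m) (Fin m) ℝ) ^ N) i j - u j / m) := by
    have := congrFun (vecMul_one_add_smul_pow hz ε N) j
    simp only [Matrix.vecMul, dotProduct] at this
    simp only [mul_sub, Finset.sum_sub_distrib, ← Finset.sum_mul, this, hs]
    simp
  have h2 : |z j| ≤ ∑ i, |z i| * (|z j| / (2 * ∑ i, |z i|)) := by
    conv_lhs => rw [h1]
    refine (Finset.abs_sum_le_sum_abs _ _).trans (Finset.sum_le_sum fun i _ => ?_)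
    rw [abs_mul]
    exact mul_le_mul_of_nonneg_left (hN i j) (abs_nonneg _)
  rw [← Finset.sum_mul] at h2
  have h3 : (∑ i, |z i|) * (|z j| / (2 * ∑ i, |z i|)) = |z j| / 2 := by field_simp
  have := abs_pos.2 hj
  linarith

/-- Invariance under a power with positive column `r` carries mass from any node to the root. This
is what makes `∑ u_i v_i` positive when the two graphs share a root. -/
lemma root_pos_of_vecMul_eq_zero {W : Matrix (Fin m) (Fin m) ℝ}
    (hoff : ∀ i j, i ≠ j → 0 ≤ W i j) (hrow : ∀ i, ∑ j, W i j = 0) {ε : ℝ} (hε : 0 < ε)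
    (hdiag : ∀ i, 0 < 1 + ε * W i i) {r : Fin m} (hr : IsSpanningTreeRoot W r)
    {u : Fin m → ℝ} (hu : ∀ i, 0 ≤ u i) (hum : ∑ i, u i = m) (huW : u ᵥ* W = 0) : 0 < u r := by
  obtain ⟨n, hn⟩ := exists_pow_column_pos hoff hrow hε hdiag hr
  have h1 : ∑ i, u i * ((1 + ε • W : Matrix (Fin m) (Fin m) ℝ) ^ n) i r = u r := by
    have := congrFun (vecMul_one_add_smul_pow huW ε n) r
    simpa only [Matrix.vecMul, dotProduct] using this
  rw [← h1]
  have hm : (0 : ℝ) < m := by exact_mod_cast r.pos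
  obtain ⟨i, hi⟩ : ∃ i, 0 < u i := by
    by_contra! h
    exact absurd (hum ▸ Finset.sum_nonpos fun i _ => h i) hm.not_ge
  refine Finset.sum_pos' (fun i _ => mul_nonneg (hu i) (hn i).le) ⟨i, Finset.mem_univ i, ?_⟩
  exact mul_pos hi (hn i)

end Graph

/-! ### A quadratic Lyapunov form for small linear steps. -/

section Lyapunov

variable {E H : Type*} [NormedAddCommGroup E] [InnerProductSpace ℝ E]
  [NormedAddCommGroup H] [InnerProductSpace ℝ H]

/-- The quadratic form `‖S x‖²` dominates `‖P x‖²` and is contracted by `(1 - a) + γ W`, for all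
small `γ`. -/
structure IsLyapunov (W P : E →L[ℝ] E) (S : E →L[ℝ] H) (c γ₀ : ℝ) : Prop where
  c_pos : 0 < c
  γ₀_pos : 0 < γ₀
  lower : ∀ x, ‖P x‖ ≤ ‖S x‖
  contract : ∀ (γ a : ℝ) (x : E), 0 ≤ γ → γ ≤ γ₀ → 0 ≤ a → a ≤ 1 / 2 →
    ‖S ((1 - a) • x + γ • W x)‖ ^ 2 ≤ (1 - 2 * c * γ) * ‖S x‖ ^ 2

/-- The map `x ↦ (A ^ n (P x))_{n < N}`. -/
noncomputable def orbitMap (A P : E →L[ℝ] E) (N : ℕ) : E →L[ℝ] PiLp 2 (fun _ : Fin N => E) :=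
  ((PiLp.continuousLinearEquiv 2 ℝ (fun _ : Fin N => E)).symm : _ →L[ℝ] _) ∘L
    ContinuousLinearMap.pi fun n : Fin N => (A ^ (n : ℕ)) ∘L P

lemma norm_orbitMap_sq (A P : E →L[ℝ] E) (N : ℕ) (x : E) :
    ‖orbitMap A P N x‖ ^ 2 = ∑ n ∈ Finset.range N, ‖(A ^ n) (P x)‖ ^ 2 := by
  rw [PiLp.norm_sq_eq_of_L2, Finset.sum_range]
  rfl

/-- Applying `A` shifts the orbit: the sum of squares loses `‖P x‖²` and gains `‖A ^ N (P x)‖² ≤ ‖P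
x‖² / 4`. This decrease at the single step `ε` bounds `⟪S x, S (W x)⟫` by a negative multiple of `‖P
x‖²`, and that inner product governs the first-order change for every small step `γ`. -/
lemma isLyapunov_orbitMap {W P : E →L[ℝ] E} (hWP : W ∘L P = W) (hPW : P ∘L W = W)
    (hPP : P ∘L P = P) {ε : ℝ} (hε : 0 < ε) {N : ℕ} (hN : 0 < N)
    (h : ‖((1 + ε • W) ^ N) ∘L P‖ ≤ 1 / 2) :
    ∃ c γ₀, IsLyapunov W P (orbitMap (1 + ε • W) P N) c γ₀ := by
  have hWP' : ∀ x, W (P x) = W x := fun x => DFunLike.congr_fun hWP x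
  have hPW' : ∀ x, P (W x) = W x := fun x => DFunLike.congr_fun hPW x
  have hPP' : ∀ x, P (P x) = P x := fun x => DFunLike.congr_fun hPP x
  set A := 1 + ε • W with hA
  set S := orbitMap A P N with hS
  have hlow : ∀ x, ‖P x‖ ^ 2 ≤ ‖S x‖ ^ 2 := fun x => by
    rw [norm_orbitMap_sq]
    exact Finset.single_le_sum (f := fun n => ‖(A ^ n) (P x)‖ ^ 2) (fun _ _ => sq_nonneg _)
      (Finset.mem_range.2 hN)
  have hSP : ∀ x, S (P x) = S x := fun x => by
    have : S ∘L P = S := by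
      simp only [hS, orbitMap, ContinuousLinearMap.comp_assoc]
      congr 1
      ext x n
      simp [hPP']
    exact DFunLike.congr_fun this x
  have hstep : ∀ x, ‖S (x + ε • W x)‖ ^ 2 ≤ ‖S x‖ ^ 2 - 3 / 4 * ‖P x‖ ^ 2 := fun x => by
    have h1 : P (x + ε • W x) = A (P x) := by simp [hA, hPW', hWP']
    have h2 : ‖(A ^ N) (P x)‖ ≤ 1 / 2 * ‖P x‖ := by
      have := (((A ^ N) ∘L P).le_opNorm (P x)).trans
        (mul_le_mul_of_nonneg_right h (norm_nonneg _))
      simpa [hPP'] using this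
    have h3 : ‖(A ^ N) (P x)‖ ^ 2 ≤ 1 / 4 * ‖P x‖ ^ 2 := by
      nlinarith [norm_nonneg ((A ^ N) (P x)), norm_nonneg (P x)]
    have h4 : ∀ n, (A ^ n) (A (P x)) = (A ^ (n + 1)) (P x) := fun n => by
      rw [pow_succ]; rfl
    have h5 := Finset.sum_range_succ (fun n => ‖(A ^ n) (P x)‖ ^ 2) N
    rw [Finset.sum_range_succ'] at h5
    rw [norm_orbitMap_sq, norm_orbitMap_sq, h1]
    simp only [h4]
    simp only [pow_zero, one_apply_eq_self] at h5
    linarith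
  -- One constant to bound both `‖S (W x)‖²` and `‖S x‖²` by `‖P x‖²`; the summand `1` keeps it
  -- positive.
  set K := (‖S ∘L W‖ + ‖S‖ + 1) ^ 2 with hK
  have hKpos : 0 < K := by positivity
  have hSW : ∀ x, ‖S (W x)‖ ^ 2 ≤ K * ‖P x‖ ^ 2 := fun x => by
    have := (S ∘L W).le_opNorm (P x)
    simp only [ContinuousLinearMap.comp_apply, hWP'] at this
    rw [hK, ← mul_pow]
    refine pow_le_pow_left₀ (norm_nonneg _) (this.trans ?_) 2
    gcongr
    linarith [norm_nonneg S]
  have hSK : ∀ x, ‖S x‖ ^ 2 ≤ K * ‖P x‖ ^ 2 := fun x => by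
    have := S.le_opNorm (P x)
    rw [hSP] at this
    rw [hK, ← mul_pow]
    refine pow_le_pow_left₀ (norm_nonneg _) (this.trans ?_) 2
    gcongr
    linarith [norm_nonneg (S ∘L W)]
  -- The inner product contributes at most `-3γ/(8ε) ‖P x‖²`, and for `γ ≤ 1/(8εK)` the quadratic
  -- term gives back at most `γ/(8ε) ‖P x‖²`. The remaining `-2γ/(8ε) ‖P x‖²` is at most `-2cγ ‖S
  -- x‖²` by `hSK`.
  refine ⟨1 / (8 * ε * K), 1 / (8 * ε * K), by positivity, by positivity,
    fun x => le_of_sq_le_sq (hlow x) (norm_nonneg _), fun γ a x hγ hγ₀ ha0 ha1 => ?_⟩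
  have e1 : ‖S (x + ε • W x)‖ ^ 2
      = ‖S x‖ ^ 2 + 2 * ε * inner ℝ (S x) (S (W x)) + ε ^ 2 * ‖S (W x)‖ ^ 2 := by
    rw [map_add, map_smul, norm_add_sq_real, inner_smul_right, norm_smul, mul_pow,
      Real.norm_eq_abs, sq_abs]
    ring
  have e2 : ‖S ((1 - a) • x + γ • W x)‖ ^ 2
      = (1 - a) ^ 2 * ‖S x‖ ^ 2 + 2 * ((1 - a) * γ) * inner ℝ (S x) (S (W x))
        + γ ^ 2 * ‖S (W x)‖ ^ 2 := by
    rw [map_add, map_smul, map_smul, norm_add_sq_real, inner_smul_right, inner_smul_left,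
      norm_smul, norm_smul, mul_pow, mul_pow, Real.norm_eq_abs, Real.norm_eq_abs, sq_abs, sq_abs]
    simp only [conj_trivial]
    ring
  have i1 : inner ℝ (S x) (S (W x)) ≤ -(3 / (8 * ε)) * ‖P x‖ ^ 2 := by
    have := hstep x
    rw [e1] at this
    have h2 : 2 * ε * inner ℝ (S x) (S (W x)) ≤ 2 * ε * (-(3 / (8 * ε)) * ‖P x‖ ^ 2) := by
      have : 2 * ε * (-(3 / (8 * ε)) * ‖P x‖ ^ 2) = -(3 / 4 * ‖P x‖ ^ 2) := by
        field_simp; ring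
      rw [this]
      nlinarith [sq_nonneg (ε * ‖S (W x)‖)]
    exact le_of_mul_le_mul_left h2 (by positivity)
  -- The damping keeps at least half of the negative term, as `a ≤ 1 / 2`.
  have i2 : (1 - a) * γ * inner ℝ (S x) (S (W x)) ≤ 1 / 2 * γ * (-(3 / (8 * ε)) * ‖P x‖ ^ 2) := by
    have hneg : -(3 / (8 * ε)) * ‖P x‖ ^ 2 ≤ 0 := by
      have : 0 ≤ 3 / (8 * ε) * ‖P x‖ ^ 2 := by positivity
      linarith
    calc (1 - a) * γ * inner ℝ (S x) (S (W x))
        ≤ (1 - a) * γ * (-(3 / (8 * ε)) * ‖P x‖ ^ 2) :=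
          mul_le_mul_of_nonneg_left i1 (mul_nonneg (by linarith) hγ)
      _ ≤ 1 / 2 * γ * (-(3 / (8 * ε)) * ‖P x‖ ^ 2) :=
          mul_le_mul_of_nonpos_right (mul_le_mul_of_nonneg_right (by linarith) hγ) hneg
  have i3 : γ ^ 2 * ‖S (W x)‖ ^ 2 ≤ γ * (1 / (8 * ε)) * ‖P x‖ ^ 2 := by
    have : γ * K ≤ 1 / (8 * ε) := by
      calc γ * K ≤ 1 / (8 * ε * K) * K := mul_le_mul_of_nonneg_right hγ₀ hKpos.le
        _ = 1 / (8 * ε) := by field_simp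
    calc γ ^ 2 * ‖S (W x)‖ ^ 2 ≤ γ ^ 2 * (K * ‖P x‖ ^ 2) :=
          mul_le_mul_of_nonneg_left (hSW x) (sq_nonneg _)
      _ = γ * (γ * K) * ‖P x‖ ^ 2 := by ring
      _ ≤ _ := by gcongr
  have i4 : (1 - a) ^ 2 * ‖S x‖ ^ 2 ≤ ‖S x‖ ^ 2 := by
    have : (1 - a) ^ 2 ≤ 1 := by nlinarith
    nlinarith [sq_nonneg ‖S x‖]
  have i5 : 2 * (1 / (8 * ε * K)) * γ * ‖S x‖ ^ 2 ≤ γ * (2 / (8 * ε)) * ‖P x‖ ^ 2 := by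
    calc 2 * (1 / (8 * ε * K)) * γ * ‖S x‖ ^ 2 ≤ 2 * (1 / (8 * ε * K)) * γ * (K * ‖P x‖ ^ 2) :=
          mul_le_mul_of_nonneg_left (hSK x) (by positivity)
      _ = _ := by field_simp
  have i6 : 2 * (1 / 2 * γ * (-(3 / (8 * ε)) * ‖P x‖ ^ 2)) + γ * (1 / (8 * ε)) * ‖P x‖ ^ 2
      = -(γ * (2 / (8 * ε)) * ‖P x‖ ^ 2) := by ring
  rw [e2]
  linarith

end Lyapunov

/-! ### Deterministic recursive inequalities. -/

section Sequences

/-- A sequence that decreases up to convergent perturbations converges, and the decrements are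
summable. -/
lemma exists_tendsto_of_le_sub_add {t D e : ℕ → ℝ} {b s : ℝ} (hb : ∀ k, b ≤ t k)
    (hD : ∀ k, 0 ≤ D k) (he : Tendsto (fun n => ∑ k ∈ Finset.range n, e k) atTop (𝓝 s))
    (h : ∀ᶠ k in atTop, t (k + 1) ≤ t k - D k + e k) :
    (∃ l, Tendsto t atTop (𝓝 l)) ∧ Summable D := by
  obtain ⟨K, hK⟩ := eventually_atTop.1 h
  -- Removing the partial sums of `e` leaves an antitone sequence. Only convergence of these partial
  -- sums is needed, so conditionally convergent martingale terms are admissible.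
  set z : ℕ → ℝ := fun n => t (n + K) - ∑ k ∈ Finset.range (n + K), e k with hz
  have hstep : ∀ n, z (n + 1) ≤ z n - D (n + K) := fun n => by
    have := hK (n + K) (by omega)
    simp only [hz, show n + 1 + K = n + K + 1 by omega, Finset.sum_range_succ]
    linarith
  have he' : Tendsto (fun n => ∑ k ∈ Finset.range (n + K), e k) atTop (𝓝 s) :=
    he.comp (tendsto_add_atTop_nat K)
  obtain ⟨c, hc⟩ := he'.bddAbove_range
  have hzb : ∀ n, b - c ≤ z n := fun n =>
    sub_le_sub (hb _) (hc ⟨n, rfl⟩)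
  have hanti : Antitone z := antitone_nat_of_succ_le fun n =>
    (hstep n).trans (sub_le_self _ (hD _))
  constructor
  · have h1 := tendsto_atTop_ciInf hanti ⟨b - c, by rintro _ ⟨n, rfl⟩; exact hzb n⟩
    refine ⟨(⨅ n, z n) + s, (tendsto_add_atTop_iff_nat K).1 ((h1.add he').congr fun n => ?_)⟩
    simp [hz]
  · rw [← summable_nat_add_iff K]
    refine summable_of_sum_range_le (c := z 0 - (b - c)) (fun n => hD _) fun n => ?_
    have : ∑ i ∈ Finset.range n, D (i + K) ≤ z 0 - z n := by
      induction n with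
      | zero => simp
      | succ n ih => rw [Finset.sum_range_succ]; linarith [hstep n]
    linarith [hzb n]

lemma not_summable_of_divergentSeries {β : ℕ → ℝ} (h : DivergentSeries β) : ¬ Summable β :=
  fun hs => not_tendsto_nhds_of_tendsto_atTop h _ hs.hasSum.tendsto_sum_nat

/-- If `t ≥ ε` held eventually, then `β ≤ ε⁻¹ β t` would make `β` summable. -/
lemma frequently_lt_of_summable_mul {β t : ℕ → ℝ} (hβ : ∀ k, 0 ≤ β k) (hdiv : DivergentSeries β)
    (h : Summable fun k => β k * t k) {ε : ℝ} (hε : 0 < ε) :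
    ∃ᶠ k in atTop, t k < ε := by
  intro hcon
  refine not_summable_of_divergentSeries hdiv ?_
  have h2 : Summable fun k => ε⁻¹ * (β k * t k) := h.mul_left _
  refine Summable.of_norm_bounded_eventually_nat h2 ?_
  filter_upwards [hcon] with k hk
  rw [not_lt] at hk
  rw [Real.norm_of_nonneg (hβ k), inv_mul_eq_div, le_div_iff₀ hε]
  exact mul_le_mul_of_nonneg_left hk (hβ k)

/-- A deterministic Robbins–Siegmund lemma. -/
lemma bounded_and_summable_of_le {U D a b : ℕ → ℝ} (hU : ∀ k, 0 ≤ U k) (hD : ∀ k, 0 ≤ D k)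
    (ha : ∀ k, 0 ≤ a k) (hb : ∀ k, 0 ≤ b k) (has : Summable a) (hbs : Summable b)
    (h : ∀ᶠ k in atTop, U (k + 1) ≤ (1 + a k) * U k - D k + b k) :
    (∃ M, ∀ k, U k ≤ M) ∧ Summable D := by
  obtain ⟨K, hK⟩ := eventually_atTop.1 h
  -- Discrete Grönwall estimate, from `1 + a ≤ exp a`.
  have hind : ∀ n, U (n + K) ≤ Real.exp (∑ k ∈ Finset.range n, a (k + K)) *
      (U K + ∑ k ∈ Finset.range n, b (k + K)) := by
    intro n
    induction n with
    | zero => simp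
    | succ n ih =>
      have h1 := hK (n + K) (by omega)
      rw [show n + 1 + K = n + K + 1 by omega, Finset.sum_range_succ, Finset.sum_range_succ,
        Real.exp_add]
      set P := Real.exp (∑ k ∈ Finset.range n, a (k + K))
      set Q := U K + ∑ k ∈ Finset.range n, b (k + K)
      have hP : 1 ≤ P := Real.one_le_exp (Finset.sum_nonneg fun k _ => ha _)
      have hQ : 0 ≤ Q := add_nonneg (hU K) (Finset.sum_nonneg fun k _ => hb _)
      have he : 1 + a (n + K) ≤ Real.exp (a (n + K)) := by
        linarith [Real.add_one_le_exp (a (n + K))]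
      have he1 : 1 ≤ Real.exp (a (n + K)) := Real.one_le_exp (ha _)
      have h2 : (1 + a (n + K)) * U (n + K) ≤ Real.exp (a (n + K)) * (P * Q) :=
        mul_le_mul he ih (hU _) (by positivity)
      have h3 : b (n + K) ≤ P * Real.exp (a (n + K)) * b (n + K) :=
        le_mul_of_one_le_left (hb _) (one_le_mul_of_one_le_of_one_le hP he1)
      have h4 := hD (n + K)
      calc U (n + K + 1)
        _ ≤ Real.exp (a (n + K)) * (P * Q) + P * Real.exp (a (n + K)) * b (n + K) := by
            linarith
        _ = _ := by ring
  have has' := (summable_nat_add_iff K).2 has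
  have hbs' := (summable_nat_add_iff K).2 hbs
  have hbound : ∀ n, U (n + K) ≤ Real.exp (∑' k, a (k + K)) * (U K + ∑' k, b (k + K)) := fun n =>
    (hind n).trans <| mul_le_mul
      (Real.exp_le_exp.2 (has'.sum_le_tsum _ fun k _ => ha _))
      (by gcongr; exact hbs'.sum_le_tsum _ fun k _ => hb _)
      (add_nonneg (hU K) (Finset.sum_nonneg fun k _ => hb _)) (Real.exp_pos _).le
  obtain ⟨M, hM⟩ : ∃ M, ∀ k, U k ≤ M := by
    have : IsBoundedUnder (· ≤ ·) atTop U := by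
      refine ⟨Real.exp (∑' k, a (k + K)) * (U K + ∑' k, b (k + K)),
        eventually_map.2 (eventually_atTop.2 ⟨K, fun k hk => ?_⟩)⟩
      obtain ⟨n, rfl⟩ := Nat.exists_eq_add_of_le' hk
      exact hbound n
    obtain ⟨M, hM⟩ := this.bddAbove_range
    exact ⟨M, fun k => hM ⟨k, rfl⟩⟩
  refine ⟨⟨M, hM⟩, ?_⟩
  -- Once `U ≤ M`, the growth term `a k * U k` is itself a summable error.
  have he : Summable fun k => a k * M + b k := (has.mul_right M).add hbs
  refine (exists_tendsto_of_le_sub_add (b := 0) hU hD he.hasSum.tendsto_sum_nat ?_).2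
  filter_upwards [h] with k hk
  nlinarith [mul_le_mul_of_nonneg_left (hM k) (ha k)]

end Sequences

/-! ### Centered noise independent of the past, and martingale convergence. -/

section Noise

variable {Ω : Type*} {mΩ : MeasurableSpace Ω} {μ : Measure Ω}
  {E H : Type*} [NormedAddCommGroup E] [InnerProductSpace ℝ E] [FiniteDimensional ℝ E]
  [MeasurableSpace E] [BorelSpace E]
  [NormedAddCommGroup H] [InnerProductSpace ℝ H] [FiniteDimensional ℝ H]
  [MeasurableSpace H] [BorelSpace H]

/-- Centered square integrable noise, such that `N k` is independent of the past `ℱ k`. -/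
structure IsCenteredNoise (ℱ : Filtration ℕ mΩ) (μ : Measure Ω) (N : ℕ → Ω → E) : Prop where
  measurable : ∀ k, Measurable[ℱ (k + 1)] (N k)
  memLp : ∀ k, MemLp (N k) 2 μ
  mean : ∀ k, ∫ ω, N k ω ∂μ = 0
  indep : ∀ k, Indep (ℱ k) (MeasurableSpace.comap (N k) inferInstance) μ

/-- By Tonelli the sum has finite expectation, hence is finite almost surely. -/
lemma ae_summable_of_summable_integral {f : ℕ → Ω → ℝ} (hf : ∀ k, Integrable (f k) μ)
    (h0 : ∀ k ω, 0 ≤ f k ω) (hs : Summable fun k => ∫ ω, f k ω ∂μ) :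
    ∀ᵐ ω ∂μ, Summable fun k => f k ω := by
  have h1 : ∫⁻ ω, ∑' k, ENNReal.ofReal (f k ω) ∂μ ≠ ⊤ := by
    rw [lintegral_tsum fun k => (hf k).aemeasurable.ennreal_ofReal]
    simp_rw [← fun k => ofReal_integral_eq_lintegral_ofReal (hf k) (ae_of_all _ (h0 k))]
    exact hs.tsum_ofReal_ne_top
  have h2 : AEMeasurable (fun ω => ∑' k, ENNReal.ofReal (f k ω)) μ :=
    AEMeasurable.tsum fun k => (hf k).aemeasurable.ennreal_ofReal
  filter_upwards [ae_lt_top' h2 h1] with ω hω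
  have := ENNReal.summable_toReal hω.ne
  simpa [ENNReal.toReal_ofReal (h0 _ ω)] using this

lemma integrable_norm_sq {F : Type*} [NormedAddCommGroup F] {a : Ω → F} (ha : MemLp a 2 μ) :
    Integrable (fun ω => ‖a ω‖ ^ 2) μ := by
  exact_mod_cast MemLp.integrable_norm_pow (p := 2) (by exact_mod_cast ha) two_ne_zero

lemma integral_add_add {f g h : Ω → ℝ} (hf : Integrable f μ) (hg : Integrable g μ)
    (hh : Integrable h μ) :
    ∫ ω, (f ω + g ω + h ω) ∂μ = ∫ ω, f ω ∂μ + ∫ ω, g ω ∂μ + ∫ ω, h ω ∂μ := by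
  rw [← integral_add hf hg]
  exact integral_add (hf.add hg) hh

namespace IsCenteredNoise

variable {ℱ : Filtration ℕ mΩ} {N : ℕ → Ω → E}

lemma map (hN : IsCenteredNoise ℱ μ N) [IsProbabilityMeasure μ] (T : E →L[ℝ] H) :
    IsCenteredNoise ℱ μ fun k ω => T (N k ω) where
  measurable k := T.continuous.measurable.comp (hN.measurable k)
  memLp k := T.comp_memLp' (hN.memLp k)
  mean k := by
    rw [T.integral_comp_comm ((hN.memLp k).integrable one_le_two), hN.mean, map_zero]
  indep k := indep_of_indep_of_le_right (hN.indep k) <| by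
    rw [show (fun ω => T (N k ω)) = T ∘ N k from rfl, ← MeasurableSpace.comap_comp]
    exact MeasurableSpace.comap_mono T.continuous.measurable.comap_le

lemma indepFun (hN : IsCenteredNoise ℱ μ N) {k : ℕ} {a : Ω → H} (ha : Measurable[ℱ k] a) :
    IndepFun a (N k) μ := by
  rw [IndepFun_iff_Indep]
  exact indep_of_indep_of_le_left (hN.indep k) ha.comap_le

variable [IsProbabilityMeasure μ]

lemma integrable_inner (hN : IsCenteredNoise ℱ μ N) {k : ℕ} {a : Ω → E} (ha : Measurable[ℱ k] a)
    (hai : Integrable a μ) : Integrable (fun ω => inner ℝ (a ω) (N k ω)) μ :=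
  (hN.indepFun ha).integrable_bilin hai ((hN.memLp k).integrable one_le_two) (innerSL ℝ)

lemma integral_inner (hN : IsCenteredNoise ℱ μ N) {k : ℕ} {a : Ω → E} (ha : Measurable[ℱ k] a)
    (hai : Integrable a μ) : ∫ ω, inner ℝ (a ω) (N k ω) ∂μ = 0 := by
  have := (hN.indepFun ha).integral_bilin hai ((hN.memLp k).integrable one_le_two) (innerSL ℝ)
  rw [hN.mean k, map_zero] at this
  exact this

lemma integral_norm_add_smul_sq (hN : IsCenteredNoise ℱ μ N) {k : ℕ} {a : Ω → E}
    (ha : Measurable[ℱ k] a) (hai : MemLp a 2 μ) (γ : ℝ) :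
    ∫ ω, ‖a ω + γ • N k ω‖ ^ 2 ∂μ = ∫ ω, ‖a ω‖ ^ 2 ∂μ + γ ^ 2 * ∫ ω, ‖N k ω‖ ^ 2 ∂μ := by
  have h1 : ∀ ω, ‖a ω + γ • N k ω‖ ^ 2
      = ‖a ω‖ ^ 2 + 2 * γ * inner ℝ (a ω) (N k ω) + γ ^ 2 * ‖N k ω‖ ^ 2 := fun ω => by
    rw [norm_add_sq_real, inner_smul_right, norm_smul, mul_pow, Real.norm_eq_abs, sq_abs]
    ring
  have hi := hN.integrable_inner ha (hai.integrable one_le_two)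
  simp_rw [h1]
  rw [integral_add_add (integrable_norm_sq hai) (hi.const_mul _)
      ((integrable_norm_sq (hN.memLp k)).const_mul _), integral_const_mul, integral_const_mul,
    hN.integral_inner ha (hai.integrable one_le_two)]
  ring

/-- Independence factorises the expectation of `‖a‖² ‖N‖²`, so second moments suffice and no fourth
moments are required. -/
lemma integrable_inner_sq (hN : IsCenteredNoise ℱ μ N) {k : ℕ} {a : Ω → E}
    (ha : Measurable[ℱ k] a) (hai : MemLp a 2 μ) :
    Integrable (fun ω => inner ℝ (a ω) (N k ω) ^ 2) μ ∧
    ∫ ω, inner ℝ (a ω) (N k ω) ^ 2 ∂μ ≤ (∫ ω, ‖a ω‖ ^ 2 ∂μ) * ∫ ω, ‖N k ω‖ ^ 2 ∂μ := by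
  have hind : IndepFun (fun ω => ‖a ω‖ ^ 2) (fun ω => ‖N k ω‖ ^ 2) μ :=
    (hN.indepFun ha).comp (φ := fun x => ‖x‖ ^ 2) (ψ := fun x => ‖x‖ ^ 2)
      (by fun_prop) (by fun_prop)
  have h1 : Integrable (fun ω => ‖a ω‖ ^ 2 * ‖N k ω‖ ^ 2) μ :=
    hind.integrable_mul (integrable_norm_sq hai) (integrable_norm_sq (hN.memLp k))
  have h2 : ∀ ω, inner ℝ (a ω) (N k ω) ^ 2 ≤ ‖a ω‖ ^ 2 * ‖N k ω‖ ^ 2 := fun ω => by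
    rw [← mul_pow, ← sq_abs]
    exact pow_le_pow_left₀ (abs_nonneg _) (abs_real_inner_le_norm _ _) 2
  have h3 : Integrable (fun ω => inner ℝ (a ω) (N k ω) ^ 2) μ := by
    refine h1.mono' ?_ (ae_of_all _ fun ω => ?_)
    · exact ((hai.1.inner (hN.memLp k).1).pow 2)
    · rw [Real.norm_of_nonneg (sq_nonneg _)]; exact h2 ω
  refine ⟨h3, (integral_mono h3 h1 h2).trans_eq ?_⟩
  exact hind.integral_fun_mul_eq_mul_integral (integrable_norm_sq hai).1
    (integrable_norm_sq (hN.memLp k)).1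

/-- The martingale `∑ γ k ⟪a k, N k⟫` converges almost surely, for a predictable `L²`-bounded
sequence `a`, if the noise is square summable. -/
lemma ae_exists_tendsto_sum_inner (hN : IsCenteredNoise ℱ μ N) {γ : ℕ → ℝ}
    (hs : Summable fun k => γ k ^ 2 * ∫ ω, ‖N k ω‖ ^ 2 ∂μ) {a : ℕ → Ω → E}
    (ha : ∀ k, Measurable[ℱ k] (a k)) (hai : ∀ k, MemLp (a k) 2 μ) {M : ℝ}
    (hM : ∀ k, ∫ ω, ‖a k ω‖ ^ 2 ∂μ ≤ M) :
    ∀ᵐ ω ∂μ, ∃ l, Tendsto (fun n => ∑ k ∈ Finset.range n, γ k * inner ℝ (a k ω) (N k ω))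
      atTop (𝓝 l) := by
  set S : ℕ → Ω → ℝ := fun n ω => ∑ k ∈ Finset.range n, γ k * inner ℝ (a k ω) (N k ω) with hS
  have hSsucc : ∀ n ω, S (n + 1) ω = S n ω + γ n * inner ℝ (a n ω) (N n ω) := fun n ω =>
    Finset.sum_range_succ _ _
  have hSmeas : ∀ n, Measurable[ℱ n] (S n) := fun n => by
    refine Finset.measurable_sum _ fun k hk => ?_
    have hkn := Finset.mem_range.1 hk
    have h1 : Measurable[ℱ n] (a k) := (ha k).mono (ℱ.mono hkn.le) le_rfl
    have h2 : Measurable[ℱ n] (N k) := (hN.measurable k).mono (ℱ.mono hkn) le_rfl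
    exact (Measurable.inner h1 h2).const_mul _
  have hinc : ∀ k, MemLp (fun ω => γ k * inner ℝ (a k ω) (N k ω)) 2 μ := fun k => by
    refine MemLp.const_mul ?_ _
    rw [memLp_two_iff_integrable_sq ((hai k).1.inner (hN.memLp k).1)]
    exact (hN.integrable_inner_sq (ha k) (hai k)).1
  have hSL : ∀ n, MemLp (S n) 2 μ := fun n => memLp_finsetSum _ fun k _ => hinc k
  have hmart : Martingale S ℱ μ := by
    refine martingale_of_setIntegral_eq_succ (fun n => (hSmeas n).stronglyMeasurable)
      (fun n => (hSL n).integrable one_le_two) fun n s hs => ?_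
    have hs' : MeasurableSet s := ℱ.le n _ hs
    simp_rw [hSsucc]
    rw [integral_add ((hSL n).integrable one_le_two).integrableOn
      ((hinc n).integrable one_le_two).integrableOn, integral_const_mul]
    -- Since `s` belongs to the past, restricting to `s` amounts to replacing `a n` by another
    -- predictable vector.
    have h1 : ∫ ω in s, inner ℝ (a n ω) (N n ω) ∂μ
        = ∫ ω, inner ℝ (s.indicator (a n) ω) (N n ω) ∂μ := by
      rw [← integral_indicator hs']
      congr 1
      ext ω
      by_cases h : ω ∈ s <;> simp [h]
    rw [h1, hN.integral_inner ((ha n).indicator hs)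
      (((hai n).integrable one_le_two).indicator hs')]
    simp
  have hM0 : 0 ≤ M := (integral_nonneg fun ω => sq_nonneg _).trans (hM 0)
  have hsq : ∀ n, ∫ ω, S n ω ^ 2 ∂μ
      ≤ ∑ k ∈ Finset.range n, M * (γ k ^ 2 * ∫ ω, ‖N k ω‖ ^ 2 ∂μ) := by
    intro n
    induction n with
    | zero => simp [hS]
    | succ n ih =>
      -- The cross term has coefficient `S n • a n`, a product of two square integrable factors. It
      -- is integrable, which is all that `integral_inner` asks.
      have hmul : Integrable (fun ω => (γ n * S n ω) • a n ω) μ := by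
        have := (hai n).smul (p := 2) (q := 2) (r := 1) ((hSL n).const_mul (γ n))
        exact memLp_one_iff_integrable.1 this
      have hmeas : Measurable[ℱ n] (fun ω => (γ n * S n ω) • a n ω) :=
        ((hSmeas n).const_mul _).smul (ha n)
      have h1 : ∀ ω, S (n + 1) ω ^ 2 = S n ω ^ 2
          + 2 * inner ℝ ((γ n * S n ω) • a n ω) (N n ω)
          + γ n ^ 2 * inner ℝ (a n ω) (N n ω) ^ 2 := fun ω => by
        rw [hSsucc, inner_smul_left]; simp only [conj_trivial]; ring
      have hi := hN.integrable_inner hmeas hmul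
      have hj := hN.integrable_inner_sq (ha n) (hai n)
      simp_rw [h1]
      rw [integral_add_add (hSL n).integrable_sq (hi.const_mul _) (hj.1.const_mul _),
        integral_const_mul,
        integral_const_mul, hN.integral_inner hmeas hmul, Finset.sum_range_succ]
      have h2 : γ n ^ 2 * ∫ ω, inner ℝ (a n ω) (N n ω) ^ 2 ∂μ
          ≤ γ n ^ 2 * (M * ∫ ω, ‖N n ω‖ ^ 2 ∂μ) := by
        refine mul_le_mul_of_nonneg_left (hj.2.trans ?_) (sq_nonneg _)
        exact mul_le_mul_of_nonneg_right (hM n) (integral_nonneg fun ω => sq_nonneg _)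
      linarith
  set Q := ∑' k, M * (γ k ^ 2 * ∫ ω, ‖N k ω‖ ^ 2 ∂μ) with hQ
  -- `|s| ≤ 1 + s²` converts the `L²` bound into the `L¹` bound of the martingale convergence
  -- theorem.
  have hbound : ∀ n, ∫ ω, ‖S n ω‖ ∂μ ≤ 1 + Q := fun n => by
    have h1 : ∫ ω, ‖S n ω‖ ∂μ ≤ ∫ ω, (1 + S n ω ^ 2) ∂μ := by
      refine integral_mono ((hSL n).integrable one_le_two).norm
        ((integrable_const _).add (hSL n).integrable_sq) fun ω => ?_
      simp only [Real.norm_eq_abs]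
      nlinarith [sq_abs (S n ω), sq_nonneg (|S n ω| - 1), abs_nonneg (S n ω)]
    rw [integral_add (integrable_const _) (hSL n).integrable_sq] at h1
    have h2 := (hsq n).trans ((hs.mul_left M).sum_le_tsum _ fun k _ =>
      mul_nonneg hM0 (mul_nonneg (sq_nonneg _) (integral_nonneg fun ω => sq_nonneg _)))
    simp only [integral_const, probReal_univ, one_smul] at h1
    linarith
  refine hmart.submartingale.exists_ae_tendsto_of_bdd (R := (1 + Q).toNNReal) fun n => ?_
  rw [eLpNorm_one_eq_lintegral_enorm,
    ← ofReal_integral_norm_eq_lintegral_enorm ((hSL n).integrable one_le_two)]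
  exact ENNReal.ofReal_le_ofReal (hbound n)

/-- A noisy recursion `p (k + 1) = a k + γ k • N k` tends to zero if the deterministic part is
contracting up to summable errors, and if `‖p k‖²` is small along a subsequence in the sense that
its series with divergent weights converges. -/
lemma ae_tendsto_zero (hN : IsCenteredNoise ℱ μ N) {γ : ℕ → ℝ}
    (hs : Summable fun k => γ k ^ 2 * ∫ ω, ‖N k ω‖ ^ 2 ∂μ) {a p : ℕ → Ω → E}
    (ha : ∀ k, Measurable[ℱ k] (a k)) (hai : ∀ k, MemLp (a k) 2 μ) {M : ℝ}
    (hM : ∀ k, ∫ ω, ‖a k ω‖ ^ 2 ∂μ ≤ M)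
    (hp : ∀ k ω, p (k + 1) ω = a k ω + γ k • N k ω)
    (hc : ∀ᵐ ω ∂μ, ∃ e : ℕ → ℝ, Summable e ∧ ∀ᶠ k in atTop, ‖a k ω‖ ^ 2 ≤ ‖p k ω‖ ^ 2 + e k)
    {β : ℕ → ℝ} (hβ : ∀ k, 0 ≤ β k) (hdiv : DivergentSeries β)
    (hβs : ∀ᵐ ω ∂μ, Summable fun k => β k * ‖p k ω‖ ^ 2) :
    ∀ᵐ ω ∂μ, Tendsto (fun k => p k ω) atTop (𝓝 0) := by
  have hns : ∀ᵐ ω ∂μ, Summable fun k => γ k ^ 2 * ‖N k ω‖ ^ 2 :=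
    ae_summable_of_summable_integral (fun k => (integrable_norm_sq (hN.memLp k)).const_mul _)
      (fun k ω => by positivity) (by simpa only [integral_const_mul] using hs)
  filter_upwards [hc, hβs, hns, hN.ae_exists_tendsto_sum_inner hs ha hai hM] with
    ω ⟨e, he, hle⟩ hβω hnω ⟨l, hl⟩
  -- Expanding `‖a + γ N‖²` leaves a convergent martingale and summable errors, so `‖p k‖²`
  -- converges.
  obtain ⟨⟨c, hcl⟩, -⟩ := exists_tendsto_of_le_sub_add (t := fun k => ‖p k ω‖ ^ 2)
    (D := fun _ => 0) (b := 0) (e := fun k => 2 * (γ k * inner ℝ (a k ω) (N k ω))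
      + (γ k ^ 2 * ‖N k ω‖ ^ 2 + e k)) (fun k => sq_nonneg _) (fun _ => le_rfl)
    (by
      simp_rw [Finset.sum_add_distrib, ← Finset.mul_sum]
      rw [show (fun n => 2 * ∑ k ∈ Finset.range n, γ k * inner ℝ (a k ω) (N k ω)
        + (∑ k ∈ Finset.range n, γ k ^ 2 * ‖N k ω‖ ^ 2 + ∑ k ∈ Finset.range n, e k)) = _ from rfl]
      exact (hl.const_mul 2).add (hnω.hasSum.tendsto_sum_nat.add he.hasSum.tendsto_sum_nat))
    (by
      filter_upwards [hle] with k hk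
      rw [hp, norm_add_sq_real, inner_smul_right, norm_smul, mul_pow, Real.norm_eq_abs, sq_abs]
      linarith)
  -- A positive limit would contradict summability with the divergent weights `β`.
  have hc0 : c = 0 := by
    have hcn : 0 ≤ c := ge_of_tendsto' hcl fun k => sq_nonneg _
    by_contra hne
    have hpos : 0 < c := lt_of_le_of_ne hcn (Ne.symm hne)
    have h1 : ∀ᶠ k in atTop, c / 2 < ‖p k ω‖ ^ 2 := hcl.eventually_const_lt (by linarith)
    obtain ⟨k, hk1, hk2⟩ :=
      ((frequently_lt_of_summable_mul hβ hdiv hβω (half_pos hpos)).and_eventually h1).exists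
    exact lt_asymm hk1 hk2
  rw [hc0] at hcl
  rw [tendsto_zero_iff_norm_tendsto_zero]
  have := hcl.sqrt
  simpa [Real.sqrt_sq (norm_nonneg _)] using this

end IsCenteredNoise

end Noise

/-! ### Asymptotic comparisons between the stepsizes. -/

section Stepsizes

variable {m : ℕ} {R C : Matrix (Fin m) (Fin m) ℝ} {γ₁ γ₂ α lam : ℕ → ℝ}

lemma tendsto_zero_of_summable_sq {γ : ℕ → ℝ} (h : Summable fun k => γ k ^ 2) :
    Tendsto γ atTop (𝓝 0) := by
  have h1 := h.tendsto_atTop_zero.sqrt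
  simp only [Real.sqrt_zero, Real.sqrt_sq_eq_abs] at h1
  exact (tendsto_zero_iff_abs_tendsto_zero γ).2 h1

namespace StepsizeAssumption

lemma eventually_γ₁_le (h : StepsizeAssumption R C γ₁ γ₂ α lam) {ε : ℝ} (hε : 0 < ε) :
    ∀ᶠ k in atTop, γ₁ k ≤ ε :=
  (tendsto_zero_of_summable_sq h.weak₁.sum_sq).eventually_le_const hε

lemma eventually_γ₂_le (h : StepsizeAssumption R C γ₁ γ₂ α lam) {ε : ℝ} (hε : 0 < ε) :
    ∀ᶠ k in atTop, γ₂ k ≤ ε :=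
  (tendsto_zero_of_summable_sq h.weak₂.sum_sq).eventually_le_const hε

/-- `α²` is the product of the null sequences `α² / γ₂` and `γ₂`. -/
lemma eventually_α_le (h : StepsizeAssumption R C γ₁ γ₂ α lam) {ε : ℝ} (hε : 0 < ε) :
    ∀ᶠ k in atTop, α k ≤ ε := by
  have h1 : Tendsto (fun k => α k ^ 2 / γ₂ k * γ₂ k) atTop (𝓝 (0 * 0)) :=
    h.sum_α_sq.tendsto_atTop_zero.mul (tendsto_zero_of_summable_sq h.weak₂.sum_sq)
  have h2 : Tendsto (fun k => α k ^ 2) atTop (𝓝 0) := by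
    rw [zero_mul] at h1
    exact h1.congr fun k => div_mul_cancel₀ _ (h.weak₂.pos k).ne'
  have h3 := h2.sqrt
  simp only [Real.sqrt_zero, Real.sqrt_sq_eq_abs] at h3
  filter_upwards [h3.eventually_le_const hε] with k hk
  exact (le_abs_self _).trans hk

lemma eventually_lam_le_γ₁ (h : StepsizeAssumption R C γ₁ γ₂ α lam) :
    ∀ᶠ k in atTop, lam k ≤ γ₁ k := by
  filter_upwards [h.weak₁.ratio.eventually_le_const one_pos] with k hk
  rwa [div_le_one (h.weak₁.pos k)] at hk

lemma eventually_lam_le_γ₂ (h : StepsizeAssumption R C γ₁ γ₂ α lam) :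
    ∀ᶠ k in atTop, lam k ≤ γ₂ k := by
  filter_upwards [h.weak₂.ratio.eventually_le_const one_pos] with k hk
  rwa [div_le_one (h.weak₂.pos k)] at hk

lemma exists_eventually_lam_le_α (h : StepsizeAssumption R C γ₁ γ₂ α lam) :
    ∃ l, 0 ≤ l ∧ ∀ᶠ k in atTop, lam k ≤ l * α k := by
  obtain ⟨l, hl⟩ := h.ratio_α
  refine ⟨|l| + 1, by positivity, ?_⟩
  filter_upwards [hl.eventually_le_const (by linarith [le_abs_self l] : l < |l| + 1),
    h.α_eventually_pos] with k hk hα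
  rwa [div_le_iff₀ hα] at hk

end StepsizeAssumption

end Stepsizes

/-! ### Perturbed contraction of the Lyapunov form. -/

section Perturbation

variable {E H : Type*} [NormedAddCommGroup E] [InnerProductSpace ℝ E]
  [NormedAddCommGroup H] [InnerProductSpace ℝ H]

lemma norm_add_sq_le {F : Type*} [NormedAddCommGroup F] {η : ℝ} (hη : 0 < η) (p r : F) :
    ‖p + r‖ ^ 2 ≤ (1 + η) * ‖p‖ ^ 2 + (1 + 1 / η) * ‖r‖ ^ 2 := by
  have h1 : ‖p + r‖ ^ 2 ≤ (‖p‖ + ‖r‖) ^ 2 :=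
    pow_le_pow_left₀ (norm_nonneg _) (norm_add_le p r) 2
  have h2 : 0 ≤ (η * ‖p‖ - ‖r‖) ^ 2 / η := by positivity
  have h3 : (η * ‖p‖ - ‖r‖) ^ 2 / η = η * ‖p‖ ^ 2 - 2 * ‖p‖ * ‖r‖ + 1 / η * ‖r‖ ^ 2 := by
    field_simp; ring
  nlinarith

/-- Young's inequality with weight `cγ` gives up half of the contraction `2cγ` and charges the
perturbation a factor of order `1 / γ`. This is the source of the conditions on series of squares
divided by `γ`. -/
lemma IsLyapunov.norm_sq_add_le {W P : E →L[ℝ] E} {S : E →L[ℝ] H} {c γ₀ : ℝ}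
    (h : IsLyapunov W P S c γ₀) {γ a : ℝ} (hγ : 0 < γ) (hγ₀ : γ ≤ γ₀) (hγ1 : γ ≤ 1)
    (ha0 : 0 ≤ a) (ha1 : a ≤ 1 / 2) (x r : E) :
    ‖S ((1 - a) • x + γ • W x + r)‖ ^ 2
      ≤ (1 - c * γ) * ‖S x‖ ^ 2 + (1 + 1 / c) * ‖S‖ ^ 2 / γ * ‖r‖ ^ 2 := by
  have hc := h.c_pos
  have h1 := norm_add_sq_le (mul_pos hc hγ) (S ((1 - a) • x + γ • W x)) (S r)
  rw [← map_add] at h1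
  have h2 := mul_le_mul_of_nonneg_left (h.contract γ a x hγ.le hγ₀ ha0 ha1)
    (by positivity : 0 ≤ 1 + c * γ)
  have h3 : (1 + c * γ) * ((1 - 2 * c * γ) * ‖S x‖ ^ 2) ≤ (1 - c * γ) * ‖S x‖ ^ 2 := by
    have : 0 ≤ 2 * (c * γ) ^ 2 * ‖S x‖ ^ 2 := by positivity
    nlinarith
  have h4 : 1 + 1 / (c * γ) ≤ (1 + 1 / c) / γ := by
    rw [add_div, div_div]
    gcongr
    rw [le_div_iff₀ hγ]; linarith
  have h5 : ‖S r‖ ^ 2 ≤ ‖S‖ ^ 2 * ‖r‖ ^ 2 := by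
    rw [← mul_pow]
    exact pow_le_pow_left₀ (norm_nonneg _) (S.le_opNorm r) 2
  have h6 : (1 + 1 / (c * γ)) * ‖S r‖ ^ 2 ≤ (1 + 1 / c) / γ * (‖S‖ ^ 2 * ‖r‖ ^ 2) := by
    gcongr
  have h7 : (1 + 1 / c) / γ * (‖S‖ ^ 2 * ‖r‖ ^ 2) = (1 + 1 / c) * ‖S‖ ^ 2 / γ * ‖r‖ ^ 2 := by ring
  linarith

end Perturbation

/-! ### The abstract tracking recursion and its filtered noise. -/

section Tracking

variable {Ω : Type*} {mΩ : MeasurableSpace Ω} {μ : Measure Ω}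
  {E H₁ H₂ : Type*} [NormedAddCommGroup E] [InnerProductSpace ℝ E] [FiniteDimensional ℝ E]
  [MeasurableSpace E] [BorelSpace E]
  [NormedAddCommGroup H₁] [InnerProductSpace ℝ H₁] [FiniteDimensional ℝ H₁]
  [MeasurableSpace H₁] [BorelSpace H₁]
  [NormedAddCommGroup H₂] [InnerProductSpace ℝ H₂] [FiniteDimensional ℝ H₂]
  [MeasurableSpace H₂] [BorelSpace H₂]

/-- The noisy gradient-tracking recursion in a Euclidean space, with coupling operators `W₁`, `W₂`
and a bounded Lipschitz map `G`. -/
structure TrackingSystem (ℱ : Filtration ℕ mΩ) (μ : Measure Ω) (W₁ W₂ : E →L[ℝ] E) (G : E → E)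
    (L B : ℝ) (γ₁ γ₂ α lam : ℕ → ℝ) (N₁ N₂ X Y : ℕ → Ω → E) : Prop where
  L_nonneg : 0 ≤ L
  lipschitz : ∀ a b, ‖G a - G b‖ ≤ L * ‖a - b‖
  bounded : ∀ a, ‖G a‖ ≤ B
  noise₁ : IsCenteredNoise ℱ μ N₁
  noise₂ : IsCenteredNoise ℱ μ N₂
  sum₁ : Summable fun k => γ₁ k ^ 2 * ∫ ω, ‖N₁ k ω‖ ^ 2 ∂μ
  sum₂ : Summable fun k => γ₂ k ^ 2 * ∫ ω, ‖N₂ k ω‖ ^ 2 ∂μ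
  measurable_X_zero : Measurable[ℱ 0] (X 0)
  memLp_X_zero : MemLp (X 0) 2 μ
  Y_zero : ∀ ω, Y 0 ω = G (X 0 ω)
  X_succ : ∀ k ω, X (k + 1) ω
    = X k ω + γ₁ k • W₁ (X k ω) - lam k • Y k ω + γ₁ k • N₁ k ω
  Y_succ : ∀ k ω, Y (k + 1) ω = (1 - α k) • Y k ω + γ₂ k • W₂ (Y k ω) + γ₂ k • N₂ k ω
    + G (X (k + 1) ω) - (1 - α k) • G (X k ω)

/-- The noise filtered with the rates `γ₂`. -/
noncomputable def filteredNoise (γ₁ γ₂ : ℕ → ℝ) (N : ℕ → Ω → E) : ℕ → Ω → E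
  | 0 => 0
  | k + 1 => fun ω => (1 - γ₂ k) • filteredNoise γ₁ γ₂ N k ω + γ₁ k • N k ω

lemma IsCenteredNoise.summable_map [IsProbabilityMeasure μ] {ℱ : Filtration ℕ mΩ}
    {N : ℕ → Ω → E} (hN : IsCenteredNoise ℱ μ N)
    {γ : ℕ → ℝ} (hs : Summable fun k => γ k ^ 2 * ∫ ω, ‖N k ω‖ ^ 2 ∂μ) (T : E →L[ℝ] H₁) :
    Summable fun k => γ k ^ 2 * ∫ ω, ‖T (N k ω)‖ ^ 2 ∂μ := by
  refine Summable.of_nonneg_of_le (fun k => mul_nonneg (sq_nonneg _)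
    (integral_nonneg fun ω => sq_nonneg _)) (fun k => ?_) (hs.mul_left (‖T‖ ^ 2))
  have h : ∫ ω, ‖T (N k ω)‖ ^ 2 ∂μ ≤ ‖T‖ ^ 2 * ∫ ω, ‖N k ω‖ ^ 2 ∂μ := by
    rw [← integral_const_mul]
    refine integral_mono (integrable_norm_sq ((hN.map T).memLp k))
      ((integrable_norm_sq (hN.memLp k)).const_mul _) fun ω => ?_
    simp only
    rw [← mul_pow]
    exact pow_le_pow_left₀ (norm_nonneg _) (T.le_opNorm _) 2
  rw [mul_left_comm]
  exact mul_le_mul_of_nonneg_left h (sq_nonneg _)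

/-- Summability of the expectations of a weighted sequence, and of the sequence itself, for a
scalar contraction driven by noise. -/
lemma IsCenteredNoise.summable_of_scalar_contraction [IsProbabilityMeasure μ]
    {ℱ : Filtration ℕ mΩ} {N : ℕ → Ω → E} (hN : IsCenteredNoise ℱ μ N)
    {γ : ℕ → ℝ} (hs : Summable fun k => γ k ^ 2 * ∫ ω, ‖N k ω‖ ^ 2 ∂μ)
    {p : ℕ → Ω → E} {β : ℕ → ℝ} (hpm : ∀ k, Measurable[ℱ k] (p k)) (hp2 : ∀ k, MemLp (p k) 2 μ)
    (hp : ∀ k ω, p (k + 1) ω = (1 - β k) • p k ω + γ k • N k ω)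
    (hβ : ∀ k, 0 ≤ β k) (hβ1 : ∀ᶠ k in atTop, β k ≤ 1) :
    (∃ M, ∀ k, ∫ ω, ‖p k ω‖ ^ 2 ∂μ ≤ M) ∧ Summable fun k => β k * ∫ ω, ‖p k ω‖ ^ 2 ∂μ := by
  refine bounded_and_summable_of_le (a := fun _ => 0)
    (b := fun k => γ k ^ 2 * ∫ ω, ‖N k ω‖ ^ 2 ∂μ) (fun k => integral_nonneg fun ω => sq_nonneg _)
    (fun k => mul_nonneg (hβ k) (integral_nonneg fun ω => sq_nonneg _)) (fun _ => le_rfl)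
    (fun k => mul_nonneg (sq_nonneg _) (integral_nonneg fun ω => sq_nonneg _)) summable_zero hs ?_
  filter_upwards [hβ1] with k hk
  simp_rw [hp]
  rw [hN.integral_norm_add_smul_sq (a := fun ω => (1 - β k) • p k ω) ((hpm k).const_smul _)
    ((hp2 k).const_smul _)]
  simp_rw [norm_smul, mul_pow, Real.norm_eq_abs, sq_abs]
  rw [integral_const_mul]
  have h0 : 0 ≤ ∫ ω, ‖p k ω‖ ^ 2 ∂μ := integral_nonneg fun ω => sq_nonneg _
  have h1 : (1 - β k) ^ 2 ≤ 1 - β k := by nlinarith [hβ k]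
  nlinarith [mul_le_mul_of_nonneg_right h1 h0]

end Tracking

/-! ### Measurability, the shifted tracker and pointwise bounds. -/

namespace TrackingSystem

variable {Ω : Type*} {mΩ : MeasurableSpace Ω} {μ : Measure Ω}
  {E H₁ H₂ : Type*} [NormedAddCommGroup E] [InnerProductSpace ℝ E] [FiniteDimensional ℝ E]
  [MeasurableSpace E] [BorelSpace E]
  [NormedAddCommGroup H₁] [InnerProductSpace ℝ H₁] [FiniteDimensional ℝ H₁]
  [MeasurableSpace H₁] [BorelSpace H₁]
  [NormedAddCommGroup H₂] [InnerProductSpace ℝ H₂] [FiniteDimensional ℝ H₂]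
  [MeasurableSpace H₂] [BorelSpace H₂]
  {ℱ : Filtration ℕ mΩ} {W₁ W₂ : E →L[ℝ] E} {G : E → E} {L B : ℝ} {γ₁ γ₂ α lam : ℕ → ℝ}
  {N₁ N₂ X Y : ℕ → Ω → E}

lemma continuous_G (h : TrackingSystem ℱ μ W₁ W₂ G L B γ₁ γ₂ α lam N₁ N₂ X Y) : Continuous G := by
  refine (LipschitzWith.of_dist_le_mul (K := L.toNNReal) fun a b => ?_).continuous
  rw [dist_eq_norm, dist_eq_norm, Real.coe_toNNReal L h.L_nonneg]
  exact h.lipschitz a b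

variable [IsProbabilityMeasure μ]

lemma memLp_G (h : TrackingSystem ℱ μ W₁ W₂ G L B γ₁ γ₂ α lam N₁ N₂ X Y) {a : Ω → E}
    (ha : AEStronglyMeasurable a μ) : MemLp (fun ω => G (a ω)) 2 μ :=
  MemLp.of_bound (h.continuous_G.comp_aestronglyMeasurable ha) B
    (ae_of_all _ fun _ => h.bounded _)

lemma measurable_and_memLp (h : TrackingSystem ℱ μ W₁ W₂ G L B γ₁ γ₂ α lam N₁ N₂ X Y) (k : ℕ) :
    (Measurable[ℱ k] (X k) ∧ MemLp (X k) 2 μ) ∧ (Measurable[ℱ k] (Y k) ∧ MemLp (Y k) 2 μ) := by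
  have hG : Measurable G := h.continuous_G.measurable
  induction k with
  | zero =>
    rw [show Y 0 = fun ω => G (X 0 ω) from funext h.Y_zero]
    exact ⟨⟨h.measurable_X_zero, h.memLp_X_zero⟩, hG.comp h.measurable_X_zero,
      h.memLp_G h.memLp_X_zero.1⟩
  | succ k ih =>
    obtain ⟨⟨hXm, hX⟩, hYm, hY⟩ := ih
    have hXm' : Measurable[ℱ (k + 1)] (X k) := hXm.mono (ℱ.mono k.le_succ) le_rfl
    have hYm' : Measurable[ℱ (k + 1)] (Y k) := hYm.mono (ℱ.mono k.le_succ) le_rfl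
    have h1 : Measurable[ℱ (k + 1)] (X (k + 1)) := by
      rw [show X (k + 1) = _ from funext (h.X_succ k)]
      exact ((hXm'.add ((W₁.continuous.measurable.comp hXm').const_smul _)).sub
        (hYm'.const_smul _)).add ((h.noise₁.measurable k).const_smul _)
    have h2 : MemLp (X (k + 1)) 2 μ := by
      rw [show X (k + 1) = _ from funext (h.X_succ k)]
      exact ((hX.add ((W₁.comp_memLp' hX).const_smul _)).sub
        (hY.const_smul _)).add ((h.noise₁.memLp k).const_smul _)
    refine ⟨⟨h1, h2⟩, ?_, ?_⟩
    · rw [show Y (k + 1) = _ from funext (h.Y_succ k)]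
      exact ((((hYm'.const_smul _).add ((W₂.continuous.measurable.comp hYm').const_smul _)).add
        ((h.noise₂.measurable k).const_smul _)).add (hG.comp h1)).sub
        ((hG.comp hXm').const_smul _)
    · rw [show Y (k + 1) = _ from funext (h.Y_succ k)]
      exact ((((hY.const_smul _).add ((W₂.comp_memLp' hY).const_smul _)).add
        ((h.noise₂.memLp k).const_smul _)).add (h.memLp_G h2.1)).sub
        ((h.memLp_G hX.1).const_smul _)

lemma filteredNoise_measurable_and_memLp
    (h : TrackingSystem ℱ μ W₁ W₂ G L B γ₁ γ₂ α lam N₁ N₂ X Y) (k : ℕ) :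
    Measurable[ℱ k] (filteredNoise γ₁ γ₂ N₁ k) ∧ MemLp (filteredNoise γ₁ γ₂ N₁ k) 2 μ := by
  induction k with
  | zero => exact ⟨measurable_const, MemLp.zero⟩
  | succ k ih =>
    exact ⟨((ih.1.mono (ℱ.mono k.le_succ) le_rfl).const_smul _).add
      ((h.noise₁.measurable k).const_smul _),
      (ih.2.const_smul _).add ((h.noise₁.memLp k).const_smul _)⟩

/-- The tracking error, after removal of the effect of the filtered noise on the map `G`. -/
noncomputable def shiftedTracker (G : E → E) (γ₁ γ₂ : ℕ → ℝ) (N₁ X Y : ℕ → Ω → E) (k : ℕ) (ω : Ω) :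
    E :=
  Y k ω - G (X k ω) + G (X k ω - filteredNoise γ₁ γ₂ N₁ k ω)

/-- The perturbation of the linear recursion for `shiftedTracker`. -/
noncomputable def drift (W₁ W₂ : E →L[ℝ] E) (G : E → E) (γ₁ γ₂ α lam : ℕ → ℝ)
    (N₁ X Y : ℕ → Ω → E) (k : ℕ) (ω : Ω) : E :=
  G (X k ω - filteredNoise γ₁ γ₂ N₁ k ω + γ₁ k • W₁ (X k ω) - lam k • Y k ω
      + γ₂ k • filteredNoise γ₁ γ₂ N₁ k ω) - G (X k ω - filteredNoise γ₁ γ₂ N₁ k ω)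
    + α k • G (X k ω - filteredNoise γ₁ γ₂ N₁ k ω)
    + γ₂ k • W₂ (G (X k ω) - G (X k ω - filteredNoise γ₁ γ₂ N₁ k ω))

/-- The noise `N₁ k` cancels in the increment of `X - q`, so `G` is evaluated only at points known
at time `k`. What remains is a predictable drift plus the centered term `γ₂ k • N₂ k`. -/
lemma shiftedTracker_succ (h : TrackingSystem ℱ μ W₁ W₂ G L B γ₁ γ₂ α lam N₁ N₂ X Y) (k : ℕ)
    (ω : Ω) :
    shiftedTracker G γ₁ γ₂ N₁ X Y (k + 1) ω =
      ((1 - α k) • shiftedTracker G γ₁ γ₂ N₁ X Y k ω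
        + γ₂ k • W₂ (shiftedTracker G γ₁ γ₂ N₁ X Y k ω)
        + drift W₁ W₂ G γ₁ γ₂ α lam N₁ X Y k ω) + γ₂ k • N₂ k ω := by
  have h1 : X (k + 1) ω - filteredNoise γ₁ γ₂ N₁ (k + 1) ω
      = X k ω - filteredNoise γ₁ γ₂ N₁ k ω + γ₁ k • W₁ (X k ω) - lam k • Y k ω
      + γ₂ k • filteredNoise γ₁ γ₂ N₁ k ω := by
    rw [h.X_succ, filteredNoise]; module
  simp only [shiftedTracker, drift, h1]
  rw [h.Y_succ]
  simp only [map_sub, map_add]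
  module

lemma shiftedTracker_measurable_and_memLp
    (h : TrackingSystem ℱ μ W₁ W₂ G L B γ₁ γ₂ α lam N₁ N₂ X Y) (k : ℕ) :
    Measurable[ℱ k] (shiftedTracker G γ₁ γ₂ N₁ X Y k) ∧
      MemLp (shiftedTracker G γ₁ γ₂ N₁ X Y k) 2 μ := by
  have hG : Measurable G := h.continuous_G.measurable
  obtain ⟨⟨hXm, hX⟩, hYm, hY⟩ := h.measurable_and_memLp k
  obtain ⟨hqm, hq⟩ := h.filteredNoise_measurable_and_memLp k
  exact ⟨(hYm.sub (hG.comp hXm)).add (hG.comp (hXm.sub hqm)),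
    (hY.sub (h.memLp_G hX.1)).add (h.memLp_G (hX.sub hq).1)⟩

lemma drift_measurable_and_memLp
    (h : TrackingSystem ℱ μ W₁ W₂ G L B γ₁ γ₂ α lam N₁ N₂ X Y) (k : ℕ) :
    Measurable[ℱ k] (drift W₁ W₂ G γ₁ γ₂ α lam N₁ X Y k) ∧
      MemLp (drift W₁ W₂ G γ₁ γ₂ α lam N₁ X Y k) 2 μ := by
  have hG : Measurable G := h.continuous_G.measurable
  obtain ⟨⟨hXm, hX⟩, hYm, hY⟩ := h.measurable_and_memLp k
  obtain ⟨hqm, hq⟩ := h.filteredNoise_measurable_and_memLp k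
  have hZ := hX.sub hq
  have hZm := hXm.sub hqm
  have hZ' := ((hZ.add ((W₁.comp_memLp' hX).const_smul (γ₁ k))).sub
    (hY.const_smul (lam k))).add (hq.const_smul (γ₂ k))
  have hZm' := ((hZm.add ((W₁.continuous.measurable.comp hXm).const_smul (γ₁ k))).sub
    (hYm.const_smul (lam k))).add (hqm.const_smul (γ₂ k))
  exact ⟨(((hG.comp hZm').sub (hG.comp hZm)).add ((hG.comp hZm).const_smul _)).add
      ((W₂.continuous.measurable.comp ((hG.comp hXm).sub (hG.comp hZm))).const_smul _),
    (((h.memLp_G hZ'.1).sub (h.memLp_G hZ.1)).add ((h.memLp_G hZ.1).const_smul _)).add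
      ((W₂.comp_memLp' ((h.memLp_G hX.1).sub (h.memLp_G hZ.1))).const_smul _)⟩

/-- `W₁` sees only `P₁ x`, so the consensus error enters and not the possibly unbounded `X`. The
damping term is controlled by boundedness of `G`, the other terms by its Lipschitz constant. -/
lemma exists_norm_drift_sq_le (h : TrackingSystem ℱ μ W₁ W₂ G L B γ₁ γ₂ α lam N₁ N₂ X Y)
    {P₁ : E →L[ℝ] E} {S₁ : E →L[ℝ] H₁} (hW₁ : ∀ x, W₁ (P₁ x) = W₁ x)
    (hS₁ : ∀ x, ‖P₁ x‖ ≤ ‖S₁ x‖) (hγ₁ : ∀ k, 0 ≤ γ₁ k) (hγ₂ : ∀ k, 0 ≤ γ₂ k)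
    (hα : ∀ k, 0 ≤ α k) (hlam : ∀ k, 0 ≤ lam k) :
    ∃ K, 0 ≤ K ∧ ∀ k ω, ‖drift W₁ W₂ G γ₁ γ₂ α lam N₁ X Y k ω‖ ^ 2 ≤
      K * (γ₁ k ^ 2 * ‖S₁ (X k ω)‖ ^ 2 + lam k ^ 2 * ‖Y k ω‖ ^ 2
        + γ₂ k ^ 2 * ‖filteredNoise γ₁ γ₂ N₁ k ω‖ ^ 2 + α k ^ 2) := by
  have hL := h.L_nonneg
  have hB : 0 ≤ B := (norm_nonneg _).trans (h.bounded 0)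
  set K₀ := L * ‖W₁‖ + L + L * ‖W₂‖ + B with hK₀
  refine ⟨4 * K₀ ^ 2, by positivity, fun k ω => ?_⟩
  set q := filteredNoise γ₁ γ₂ N₁ k ω
  set x := X k ω
  set y := Y k ω
  have h1 : ‖W₁ x‖ ≤ ‖W₁‖ * ‖S₁ x‖ := by
    rw [← hW₁]
    exact (W₁.le_opNorm _).trans (mul_le_mul_of_nonneg_left (hS₁ x) (norm_nonneg _))
  have h2 : ‖G (x - q + γ₁ k • W₁ x - lam k • y + γ₂ k • q) - G (x - q)‖
      ≤ L * (γ₁ k * (‖W₁‖ * ‖S₁ x‖) + lam k * ‖y‖ + γ₂ k * ‖q‖) := by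
    refine (h.lipschitz _ _).trans (mul_le_mul_of_nonneg_left ?_ hL)
    rw [show x - q + γ₁ k • W₁ x - lam k • y + γ₂ k • q - (x - q)
      = γ₁ k • W₁ x - lam k • y + γ₂ k • q by abel]
    refine (norm_add_le _ _).trans (add_le_add ((norm_sub_le _ _).trans (add_le_add ?_ ?_)) ?_)
    · rw [norm_smul, Real.norm_of_nonneg (hγ₁ k)]
      exact mul_le_mul_of_nonneg_left h1 (hγ₁ k)
    · rw [norm_smul, Real.norm_of_nonneg (hlam k)]
    · rw [norm_smul, Real.norm_of_nonneg (hγ₂ k)]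
  have h3 : ‖α k • G (x - q)‖ ≤ α k * B := by
    rw [norm_smul, Real.norm_of_nonneg (hα k)]
    exact mul_le_mul_of_nonneg_left (h.bounded _) (hα k)
  have h4 : ‖γ₂ k • W₂ (G x - G (x - q))‖ ≤ γ₂ k * (‖W₂‖ * (L * ‖q‖)) := by
    rw [norm_smul, Real.norm_of_nonneg (hγ₂ k)]
    refine mul_le_mul_of_nonneg_left ((W₂.le_opNorm _).trans
      (mul_le_mul_of_nonneg_left ?_ (norm_nonneg _))) (hγ₂ k)
    simpa using h.lipschitz x (x - q)
  have h5 : ‖drift W₁ W₂ G γ₁ γ₂ α lam N₁ X Y k ω‖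
      ≤ K₀ * (γ₁ k * ‖S₁ x‖ + lam k * ‖y‖ + γ₂ k * ‖q‖ + α k) := by
    refine ((norm_add_le _ _).trans (add_le_add ((norm_add_le _ _).trans
      (add_le_add h2 h3)) h4)).trans ?_
    have p1 : 0 ≤ γ₁ k * ‖S₁ x‖ := mul_nonneg (hγ₁ k) (norm_nonneg _)
    have p2 : 0 ≤ lam k * ‖y‖ := mul_nonneg (hlam k) (norm_nonneg _)
    have p3 : 0 ≤ γ₂ k * ‖q‖ := mul_nonneg (hγ₂ k) (norm_nonneg _)
    have p4 := hα k
    have e : K₀ * (γ₁ k * ‖S₁ x‖ + lam k * ‖y‖ + γ₂ k * ‖q‖ + α k) -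
        (L * (γ₁ k * (‖W₁‖ * ‖S₁ x‖) + lam k * ‖y‖ + γ₂ k * ‖q‖) + α k * B
          + γ₂ k * (‖W₂‖ * (L * ‖q‖)))
        = (L + L * ‖W₂‖ + B) * (γ₁ k * ‖S₁ x‖) + (L * ‖W₁‖ + L * ‖W₂‖ + B) * (lam k * ‖y‖)
          + (L * ‖W₁‖ + B) * (γ₂ k * ‖q‖) + (L * ‖W₁‖ + L + L * ‖W₂‖) * α k := by
      rw [hK₀]; ring
    rw [← sub_nonneg, e]
    positivity
  have h6 : ∀ a b c d : ℝ, (a + b + c + d) ^ 2 ≤ 4 * (a ^ 2 + b ^ 2 + c ^ 2 + d ^ 2) := by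
    intro a b c d
    nlinarith [sq_nonneg (a - b), sq_nonneg (a - c), sq_nonneg (a - d), sq_nonneg (b - c),
      sq_nonneg (b - d), sq_nonneg (c - d)]
  calc ‖drift W₁ W₂ G γ₁ γ₂ α lam N₁ X Y k ω‖ ^ 2
      ≤ (K₀ * (γ₁ k * ‖S₁ x‖ + lam k * ‖y‖ + γ₂ k * ‖q‖ + α k)) ^ 2 :=
        pow_le_pow_left₀ (norm_nonneg _) h5 2
    _ = K₀ ^ 2 * (γ₁ k * ‖S₁ x‖ + lam k * ‖y‖ + γ₂ k * ‖q‖ + α k) ^ 2 := by ring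
    _ ≤ K₀ ^ 2 * (4 * ((γ₁ k * ‖S₁ x‖) ^ 2 + (lam k * ‖y‖) ^ 2 + (γ₂ k * ‖q‖) ^ 2
          + α k ^ 2)) := mul_le_mul_of_nonneg_left (h6 _ _ _ _) (sq_nonneg _)
    _ = _ := by ring

/-- The part of the tracker outside of the range of `W₂` follows the corresponding part of `G`
up to filtered noise. -/
lemma sub_proj_succ (h : TrackingSystem ℱ μ W₁ W₂ G L B γ₁ γ₂ α lam N₁ N₂ X Y)
    {J : E →L[ℝ] E} (hJ : ∀ x, J (W₂ x) = 0) (k : ℕ) (ω : Ω) :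
    J (Y (k + 1) ω - G (X (k + 1) ω))
      = (1 - α k) • J (Y k ω - G (X k ω)) + γ₂ k • J (N₂ k ω) := by
  rw [h.Y_succ]
  simp only [map_sub, map_add, map_smul, hJ]
  module

/-- `Y` is the sum of `P₂ w`, of the mean tracking error, and of a remainder made only of values of
`G`, which is bounded. -/
lemma exists_norm_Y_sq_le (h : TrackingSystem ℱ μ W₁ W₂ G L B γ₁ γ₂ α lam N₁ N₂ X Y)
    {P₂ : E →L[ℝ] E} {S₂ : E →L[ℝ] H₂} (hS₂ : ∀ x, ‖P₂ x‖ ≤ ‖S₂ x‖) :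
    ∃ K, 0 ≤ K ∧ ∀ k ω, ‖Y k ω‖ ^ 2 ≤ K * (‖S₂ (shiftedTracker G γ₁ γ₂ N₁ X Y k ω)‖ ^ 2
      + ‖(1 - P₂) (Y k ω - G (X k ω))‖ ^ 2 + 1) := by
  have hB : 0 ≤ B := (norm_nonneg _).trans (h.bounded 0)
  set K₀ := ‖P₂‖ * (2 * B) + ‖(1 - P₂ : E →L[ℝ] E)‖ * B with hK₀
  have hK₀0 : 0 ≤ K₀ := by positivity
  refine ⟨3 * (1 + K₀ ^ 2), by positivity, fun k ω => ?_⟩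
  set x := X k ω with hx
  set y := Y k ω with hy
  set w := shiftedTracker G γ₁ γ₂ N₁ X Y k ω with hw
  set s := (1 - P₂) (y - G x) with hs
  set z := x - filteredNoise γ₁ γ₂ N₁ k ω with hz
  have e : y = P₂ w + s + (P₂ (G x - G z) + (1 - P₂) (G x)) := by
    simp only [hw, hs, shiftedTracker, ← hx, ← hy, ← hz, map_sub, map_add,
      sub_apply, one_apply_eq_self]
    abel
  have h1 : ‖P₂ (G x - G z)‖ ≤ ‖P₂‖ * (2 * B) := by
    refine (P₂.le_opNorm _).trans (mul_le_mul_of_nonneg_left ?_ (norm_nonneg _))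
    linarith [norm_sub_le (G x) (G z), h.bounded x, h.bounded z]
  have h2 : ‖(1 - P₂) (G x)‖ ≤ ‖(1 - P₂ : E →L[ℝ] E)‖ * B :=
    ((1 - P₂ : E →L[ℝ] E).le_opNorm _).trans
      (mul_le_mul_of_nonneg_left (h.bounded x) (norm_nonneg _))
  have h3 : ‖y‖ ≤ ‖S₂ w‖ + ‖s‖ + K₀ := by
    conv_lhs => rw [e]
    exact (norm_add_le _ _).trans (add_le_add ((norm_add_le _ _).trans
      (add_le_add (hS₂ w) le_rfl)) ((norm_add_le _ _).trans (add_le_add h1 h2)))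
  have h4 : ‖y‖ ^ 2 ≤ (‖S₂ w‖ + ‖s‖ + K₀) ^ 2 := pow_le_pow_left₀ (norm_nonneg _) h3 2
  have h5 : ∀ a b c : ℝ, (a + b + c) ^ 2 ≤ 3 * (a ^ 2 + b ^ 2 + c ^ 2) := fun a b c => by
    nlinarith [sq_nonneg (a - b), sq_nonneg (a - c), sq_nonneg (b - c)]
  refine (h4.trans (h5 _ _ _)).trans ?_
  nlinarith [mul_nonneg (sq_nonneg K₀) (sq_nonneg ‖S₂ w‖),
    mul_nonneg (sq_nonneg K₀) (sq_nonneg ‖s‖)]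

end TrackingSystem

/-! ### Second-moment bounds. -/

namespace TrackingSystem

variable {Ω : Type*} {mΩ : MeasurableSpace Ω} {μ : Measure Ω}
  {E H₁ H₂ : Type*} [NormedAddCommGroup E] [InnerProductSpace ℝ E] [FiniteDimensional ℝ E]
  [MeasurableSpace E] [BorelSpace E]
  [NormedAddCommGroup H₁] [InnerProductSpace ℝ H₁] [FiniteDimensional ℝ H₁]
  [MeasurableSpace H₁] [BorelSpace H₁]
  [NormedAddCommGroup H₂] [InnerProductSpace ℝ H₂] [FiniteDimensional ℝ H₂]
  [MeasurableSpace H₂] [BorelSpace H₂]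
  {ℱ : Filtration ℕ mΩ} {W₁ W₂ : E →L[ℝ] E} {G : E → E} {L B : ℝ} {γ₁ γ₂ α lam : ℕ → ℝ}
  {N₁ N₂ X Y : ℕ → Ω → E} {P₁ P₂ : E →L[ℝ] E} {S₁ : E →L[ℝ] H₁} {S₂ : E →L[ℝ] H₂}
  {c₁ c₂ g₁ g₂ : ℝ} {m : ℕ} {R C : Matrix (Fin m) (Fin m) ℝ}
  [IsProbabilityMeasure μ]

/-- The descent term `-lam k • y` is the perturbation; there is no damping here, so the contraction
is used with `a = 0`. -/
lemma exists_eventually_consensus_le (hstep : StepsizeAssumption R C γ₁ γ₂ α lam)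
    (h₁ : IsLyapunov W₁ P₁ S₁ c₁ g₁) :
    ∃ K, 0 ≤ K ∧ ∀ᶠ k in atTop, ∀ x y : E,
      ‖S₁ (x + γ₁ k • W₁ x - lam k • y)‖ ^ 2
        ≤ (1 - c₁ * γ₁ k) * ‖S₁ x‖ ^ 2 + K * (lam k ^ 2 / γ₁ k * ‖y‖ ^ 2) := by
  have hc := h₁.c_pos
  refine ⟨(1 + 1 / c₁) * ‖S₁‖ ^ 2, by positivity, ?_⟩
  filter_upwards [hstep.eventually_γ₁_le h₁.γ₀_pos, hstep.eventually_γ₁_le one_pos]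
    with k hk hk1 x y
  have := h₁.norm_sq_add_le (hstep.weak₁.pos k) hk hk1 le_rfl (by norm_num) x (-(lam k • y))
  rw [sub_zero, one_smul, ← sub_eq_add_neg, norm_neg, norm_smul, mul_pow, Real.norm_eq_abs,
    sq_abs] at this
  refine this.trans_eq ?_
  ring

/-- Dividing the squared drift by `γ₂` yields the weights `γ₁² / γ₂`, `λ² / γ₂` and `α² / γ₂`, all
summable by assumption, and the term `γ₂ ‖q‖²`, summable in expectation by the contraction of `q`.
-/
lemma exists_eventually_tracker_le
    (h : TrackingSystem ℱ μ W₁ W₂ G L B γ₁ γ₂ α lam N₁ N₂ X Y)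
    (hstep : StepsizeAssumption R C γ₁ γ₂ α lam) (hW₁ : ∀ x, W₁ (P₁ x) = W₁ x)
    (h₁ : IsLyapunov W₁ P₁ S₁ c₁ g₁) (h₂ : IsLyapunov W₂ P₂ S₂ c₂ g₂) :
    ∃ K, 0 ≤ K ∧ ∀ᶠ k in atTop, ∀ ω,
      ‖S₂ ((1 - α k) • shiftedTracker G γ₁ γ₂ N₁ X Y k ω
        + γ₂ k • W₂ (shiftedTracker G γ₁ γ₂ N₁ X Y k ω)
        + drift W₁ W₂ G γ₁ γ₂ α lam N₁ X Y k ω)‖ ^ 2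
        ≤ (1 - c₂ * γ₂ k) * ‖S₂ (shiftedTracker G γ₁ γ₂ N₁ X Y k ω)‖ ^ 2
          + K * (γ₁ k ^ 2 / γ₂ k * ‖S₁ (X k ω)‖ ^ 2 + lam k ^ 2 / γ₂ k * ‖Y k ω‖ ^ 2
            + γ₂ k * ‖filteredNoise γ₁ γ₂ N₁ k ω‖ ^ 2 + α k ^ 2 / γ₂ k) := by
  have hc := h₂.c_pos
  obtain ⟨K, hK, hd⟩ := h.exists_norm_drift_sq_le (H₁ := H₁) hW₁ h₁.lower
    (fun k => (hstep.weak₁.pos k).le) (fun k => (hstep.weak₂.pos k).le) hstep.α_nonneg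
    hstep.lam_nonneg
  refine ⟨(1 + 1 / c₂) * ‖S₂‖ ^ 2 * K, by positivity, ?_⟩
  filter_upwards [hstep.eventually_γ₂_le h₂.γ₀_pos, hstep.eventually_γ₂_le one_pos,
    hstep.eventually_α_le (by norm_num : (0 : ℝ) < 1 / 2)] with k hk hk1 hα ω
  have hγ := hstep.weak₂.pos k
  refine (h₂.norm_sq_add_le hγ hk hk1 (hstep.α_nonneg k) hα _ _).trans ?_
  gcongr ?_ + ?_
  · exact le_rfl
  · refine (mul_le_mul_of_nonneg_left (hd k ω) (by positivity)).trans_eq ?_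
    field_simp

/-- The second moments of the consensus error, the tracking error and the filtered noise. -/
lemma moment_bounds
    (h : TrackingSystem ℱ μ W₁ W₂ G L B γ₁ γ₂ α lam N₁ N₂ X Y)
    (hstep : StepsizeAssumption R C γ₁ γ₂ α lam) (hW₁ : ∀ x, W₁ (P₁ x) = W₁ x)
    (hP₂ : ∀ x, P₂ (W₂ x) = W₂ x)
    (h₁ : IsLyapunov W₁ P₁ S₁ c₁ g₁) (h₂ : IsLyapunov W₂ P₂ S₂ c₂ g₂) :
    ∃ M, (∀ k, ∫ ω, ‖S₁ (X k ω)‖ ^ 2 ∂μ ≤ M) ∧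
      (∀ k, ∫ ω, ‖S₂ (shiftedTracker G γ₁ γ₂ N₁ X Y k ω)‖ ^ 2 ∂μ ≤ M) ∧
      (∀ k, ∫ ω, ‖Y k ω‖ ^ 2 ∂μ ≤ M) ∧
      (∀ k, ∫ ω, ‖filteredNoise γ₁ γ₂ N₁ k ω‖ ^ 2 ∂μ ≤ M) ∧
      (Summable fun k => γ₁ k * ∫ ω, ‖S₁ (X k ω)‖ ^ 2 ∂μ) ∧
      (Summable fun k => γ₂ k * ∫ ω, ‖S₂ (shiftedTracker G γ₁ γ₂ N₁ X Y k ω)‖ ^ 2 ∂μ) ∧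
      (Summable fun k => α k * ∫ ω, ‖(1 - P₂) (Y k ω - G (X k ω))‖ ^ 2 ∂μ) ∧
      (Summable fun k => γ₂ k * ∫ ω, ‖filteredNoise γ₁ γ₂ N₁ k ω‖ ^ 2 ∂μ) := by
  set w := shiftedTracker G γ₁ γ₂ N₁ X Y with hwdef
  set q := filteredNoise γ₁ γ₂ N₁ with hqdef
  set J : E →L[ℝ] E := 1 - P₂ with hJdef
  have hJW : ∀ x, J (W₂ x) = 0 := fun x => by
    simp [hJdef, hP₂]
  have hγ₁ := hstep.weak₁.pos
  have hγ₂ := hstep.weak₂.pos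
  have hG : Measurable G := h.continuous_G.measurable
  have hXm := fun k => (h.measurable_and_memLp k).1.1
  have hX2 := fun k => (h.measurable_and_memLp k).1.2
  have hYm := fun k => (h.measurable_and_memLp k).2.1
  have hY2 := fun k => (h.measurable_and_memLp k).2.2
  have hwm := fun k => (h.shiftedTracker_measurable_and_memLp k).1
  have hw2 := fun k => (h.shiftedTracker_measurable_and_memLp k).2
  have hdm := fun k => (h.drift_measurable_and_memLp k).1
  have hd2 := fun k => (h.drift_measurable_and_memLp k).2
  have hqm := fun k => (h.filteredNoise_measurable_and_memLp k).1
  have hq2 := fun k => (h.filteredNoise_measurable_and_memLp k).2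
  -- The filtered noise and the mean tracking error are scalar contractions with rates `γ₂` and `α`;
  -- they decouple from the rest and are settled beforehand.
  obtain ⟨⟨Mq, hMq⟩, hqs⟩ := h.noise₁.summable_of_scalar_contraction h.sum₁ (p := q) (β := γ₂)
    hqm hq2 (fun k ω => rfl) (fun k => (hγ₂ k).le) (hstep.eventually_γ₂_le one_pos)
  have hs2 : ∀ k, MemLp (fun ω => J (Y k ω - G (X k ω))) 2 μ := fun k =>
    J.comp_memLp' ((hY2 k).sub (h.memLp_G (hX2 k).1))
  obtain ⟨⟨Ms, hMs⟩, hss⟩ := (h.noise₂.map J).summable_of_scalar_contraction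
    (h.noise₂.summable_map h.sum₂ J) (p := fun k ω => J (Y k ω - G (X k ω))) (β := α)
    (fun k => J.continuous.measurable.comp ((hYm k).sub (hG.comp (hXm k)))) hs2
    (h.sub_proj_succ hJW) hstep.α_nonneg (hstep.eventually_α_le one_pos)
  obtain ⟨K₁, hK₁, hc⟩ := exists_eventually_consensus_le hstep h₁
  obtain ⟨K₂, hK₂, ht⟩ := h.exists_eventually_tracker_le hstep hW₁ h₁ h₂
  obtain ⟨K₃, hK₃, hy⟩ := h.exists_norm_Y_sq_le h₂.lower
  have hc₁ := h₁.c_pos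
  have hc₂ := h₂.c_pos
  set xs : ℕ → ℝ := fun k => ∫ ω, ‖S₁ (X k ω)‖ ^ 2 ∂μ with hxs
  set ws : ℕ → ℝ := fun k => ∫ ω, ‖S₂ (w k ω)‖ ^ 2 ∂μ with hws
  set ys : ℕ → ℝ := fun k => ∫ ω, ‖Y k ω‖ ^ 2 ∂μ with hys
  set qs : ℕ → ℝ := fun k => ∫ ω, ‖q k ω‖ ^ 2 ∂μ with hqsdef
  have hxs0 : ∀ k, 0 ≤ xs k := fun k => integral_nonneg fun ω => sq_nonneg _
  have hws0 : ∀ k, 0 ≤ ws k := fun k => integral_nonneg fun ω => sq_nonneg _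
  have hqs0 : ∀ k, 0 ≤ qs k := fun k => integral_nonneg fun ω => sq_nonneg _
  have hMs0 : 0 ≤ Ms := (integral_nonneg fun ω => sq_nonneg _).trans (hMs 0)
  have iX : ∀ k, Integrable (fun ω => ‖S₁ (X k ω)‖ ^ 2) μ := fun k =>
    integrable_norm_sq (S₁.comp_memLp' (hX2 k))
  have iw : ∀ k, Integrable (fun ω => ‖S₂ (w k ω)‖ ^ 2) μ := fun k =>
    integrable_norm_sq (S₂.comp_memLp' (hw2 k))
  have iY : ∀ k, Integrable (fun ω => ‖Y k ω‖ ^ 2) μ := fun k => integrable_norm_sq (hY2 k)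
  have iq : ∀ k, Integrable (fun ω => ‖q k ω‖ ^ 2) μ := fun k => integrable_norm_sq (hq2 k)
  -- The second moment of `Y` is fed back into that of the shifted tracker, which closes the system
  -- of inequalities.
  have hysle : ∀ k, ys k ≤ K₃ * (ws k + Ms + 1) := fun k => by
    have h1 : ys k ≤ ∫ ω, K₃ * (‖S₂ (w k ω)‖ ^ 2 + ‖J (Y k ω - G (X k ω))‖ ^ 2 + 1) ∂μ :=
      integral_mono (iY k) (((iw k).add (integrable_norm_sq (hs2 k))).add
        (integrable_const _) |>.const_mul _) fun ω => hy k ω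
    rw [integral_const_mul, integral_add_add (iw k) (integrable_norm_sq (hs2 k))
      (integrable_const _)] at h1
    refine h1.trans (mul_le_mul_of_nonneg_left ?_ hK₃)
    simp only [integral_const, probReal_univ, one_smul]
    linarith [hMs k]
  have hxstep : ∀ᶠ k in atTop, xs (k + 1) ≤ (1 - c₁ * γ₁ k) * xs k
      + K₁ * (lam k ^ 2 / γ₁ k * ys k) + γ₁ k ^ 2 * ∫ ω, ‖S₁ (N₁ k ω)‖ ^ 2 ∂μ := by
    filter_upwards [hc] with k hk
    have hm : Measurable[ℱ k] fun ω => X k ω + γ₁ k • W₁ (X k ω) - lam k • Y k ω :=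
      ((hXm k).add ((W₁.continuous.measurable.comp (hXm k)).const_smul _)).sub
        ((hYm k).const_smul _)
    have h2 : MemLp (fun ω => X k ω + γ₁ k • W₁ (X k ω) - lam k • Y k ω) 2 μ :=
      ((hX2 k).add ((W₁.comp_memLp' (hX2 k)).const_smul _)).sub ((hY2 k).const_smul _)
    have e : xs (k + 1) = ∫ ω, ‖S₁ (X k ω + γ₁ k • W₁ (X k ω) - lam k • Y k ω)
        + γ₁ k • S₁ (N₁ k ω)‖ ^ 2 ∂μ := by
      simp only [hxs, h.X_succ, map_add, map_smul]
    rw [e, (h.noise₁.map S₁).integral_norm_add_smul_sq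
      (a := fun ω => S₁ (X k ω + γ₁ k • W₁ (X k ω) - lam k • Y k ω))
      (S₁.continuous.measurable.comp hm) (S₁.comp_memLp' h2)]
    gcongr
    refine (integral_mono (integrable_norm_sq (S₁.comp_memLp' h2))
      (((iX k).const_mul (1 - c₁ * γ₁ k)).add (((iY k).const_mul (lam k ^ 2 / γ₁ k)).const_mul K₁))
      fun ω => hk (X k ω) (Y k ω)).trans_eq ?_
    simp only [Pi.add_apply]
    rw [integral_add ((iX k).const_mul _) (((iY k).const_mul _).const_mul _), integral_const_mul,
      integral_const_mul, integral_const_mul]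
  have hwstep : ∀ᶠ k in atTop, ws (k + 1) ≤ (1 - c₂ * γ₂ k) * ws k
      + K₂ * (γ₁ k ^ 2 / γ₂ k * xs k + lam k ^ 2 / γ₂ k * ys k + γ₂ k * qs k + α k ^ 2 / γ₂ k)
      + γ₂ k ^ 2 * ∫ ω, ‖S₂ (N₂ k ω)‖ ^ 2 ∂μ := by
    filter_upwards [ht] with k hk
    have hm : Measurable[ℱ k] fun ω => (1 - α k) • w k ω + γ₂ k • W₂ (w k ω)
        + drift W₁ W₂ G γ₁ γ₂ α lam N₁ X Y k ω :=
      (((hwm k).const_smul _).add ((W₂.continuous.measurable.comp (hwm k)).const_smul _)).add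
        (hdm k)
    have h2 : MemLp (fun ω => (1 - α k) • w k ω + γ₂ k • W₂ (w k ω)
        + drift W₁ W₂ G γ₁ γ₂ α lam N₁ X Y k ω) 2 μ :=
      (((hw2 k).const_smul _).add ((W₂.comp_memLp' (hw2 k)).const_smul _)).add (hd2 k)
    have e : ws (k + 1) = ∫ ω, ‖S₂ ((1 - α k) • w k ω + γ₂ k • W₂ (w k ω)
        + drift W₁ W₂ G γ₁ γ₂ α lam N₁ X Y k ω) + γ₂ k • S₂ (N₂ k ω)‖ ^ 2 ∂μ := by
      simp only [hws, hwdef, h.shiftedTracker_succ, map_add, map_smul]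
    rw [e, (h.noise₂.map S₂).integral_norm_add_smul_sq
      (a := fun ω => S₂ ((1 - α k) • w k ω + γ₂ k • W₂ (w k ω)
        + drift W₁ W₂ G γ₁ γ₂ α lam N₁ X Y k ω))
      (S₂.continuous.measurable.comp hm) (S₂.comp_memLp' h2)]
    gcongr
    have j1 := (iX k).const_mul (γ₁ k ^ 2 / γ₂ k)
    have j2 := (iY k).const_mul (lam k ^ 2 / γ₂ k)
    have j3 := (iq k).const_mul (γ₂ k)
    have j4 : Integrable (fun _ : Ω => α k ^ 2 / γ₂ k) μ := integrable_const _
    refine (integral_mono (integrable_norm_sq (S₂.comp_memLp' h2))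
      (((iw k).const_mul (1 - c₂ * γ₂ k)).add ((((j1.add j2).add j3).add j4).const_mul K₂))
      fun ω => hk ω).trans_eq ?_
    have e2 := integral_add ((iw k).const_mul (1 - c₂ * γ₂ k))
      ((((j1.add j2).add j3).add j4).const_mul K₂)
    have e3 := integral_add_add (j1.add j2) j3 j4
    have e4 := integral_add j1 j2
    simp only [Pi.add_apply, integral_const_mul, integral_const, probReal_univ, one_smul]
      at e2 e3 e4 ⊢
    rw [e2, e3, e4]
  set c := min c₁ c₂ with hcdef
  have hcpos : 0 < c := lt_min hc₁ hc₂
  have hN₁s := h.noise₁.summable_map h.sum₁ S₁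
  have hN₂s := h.noise₂.summable_map h.sum₂ S₂
  set ρ : ℕ → ℝ := fun k => lam k ^ 2 / γ₁ k + lam k ^ 2 / γ₂ k with hρ
  have hρ0 : ∀ k, 0 ≤ ρ k := fun k =>
    add_nonneg (div_nonneg (sq_nonneg _) (hγ₁ k).le) (div_nonneg (sq_nonneg _) (hγ₂ k).le)
  have hτ0 : ∀ k, 0 ≤ γ₁ k ^ 2 / γ₂ k := fun k => div_nonneg (sq_nonneg _) (hγ₂ k).le
  have hρs : Summable ρ := hstep.weak₁.sum_ratio.add hstep.weak₂.sum_ratio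
  -- In the sum of both recursions the mutual couplings have summable coefficients and go into the
  -- growth factor; the contractions survive as the decrement.
  obtain ⟨⟨M, hM⟩, hD⟩ := bounded_and_summable_of_le (U := fun k => xs k + ws k)
    (D := fun k => c * (γ₁ k * xs k + γ₂ k * ws k))
    (a := fun k => (K₁ + K₂) * K₃ * ρ k + K₂ * (γ₁ k ^ 2 / γ₂ k))
    (b := fun k => (K₁ + K₂) * K₃ * (Ms + 1) * ρ k + K₂ * (γ₂ k * qs k + α k ^ 2 / γ₂ k)
      + (γ₁ k ^ 2 * ∫ ω, ‖S₁ (N₁ k ω)‖ ^ 2 ∂μ + γ₂ k ^ 2 * ∫ ω, ‖S₂ (N₂ k ω)‖ ^ 2 ∂μ))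
    (fun k => add_nonneg (hxs0 k) (hws0 k))
    (fun k => mul_nonneg hcpos.le (add_nonneg (mul_nonneg (hγ₁ k).le (hxs0 k))
      (mul_nonneg (hγ₂ k).le (hws0 k))))
    (fun k => add_nonneg (mul_nonneg (by positivity) (hρ0 k)) (mul_nonneg hK₂ (hτ0 k)))
    (fun k => add_nonneg (add_nonneg (mul_nonneg (by positivity) (hρ0 k))
      (mul_nonneg hK₂ (add_nonneg (mul_nonneg (hγ₂ k).le (hqs0 k))
        (div_nonneg (sq_nonneg _) (hγ₂ k).le))))
      (add_nonneg (mul_nonneg (sq_nonneg _) (integral_nonneg fun ω => sq_nonneg _))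
        (mul_nonneg (sq_nonneg _) (integral_nonneg fun ω => sq_nonneg _))))
    ((hρs.mul_left _).add (hstep.sum_γ₁_sq.mul_left _))
    (((hρs.mul_left _).add ((hqs.add hstep.sum_α_sq).mul_left _)).add (hN₁s.add hN₂s))
    (by
      filter_upwards [hxstep, hwstep] with k hx hw
      have hγ₁k := hγ₁ k
      have hγ₂k := hγ₂ k
      have hl1 : 0 ≤ lam k ^ 2 / γ₁ k := div_nonneg (sq_nonneg _) hγ₁k.le
      have hl2 : 0 ≤ lam k ^ 2 / γ₂ k := div_nonneg (sq_nonneg _) hγ₂k.le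
      have b1 : c * (γ₁ k * xs k) ≤ c₁ * (γ₁ k * xs k) :=
        mul_le_mul_of_nonneg_right (min_le_left _ _) (mul_nonneg hγ₁k.le (hxs0 k))
      have b2 : c * (γ₂ k * ws k) ≤ c₂ * (γ₂ k * ws k) :=
        mul_le_mul_of_nonneg_right (min_le_right _ _) (mul_nonneg hγ₂k.le (hws0 k))
      have hyk : ys k ≤ K₃ * (xs k + ws k + (Ms + 1)) :=
        (hysle k).trans (mul_le_mul_of_nonneg_left (by linarith [hxs0 k]) hK₃)
      have hV : 0 ≤ K₃ * (xs k + ws k + (Ms + 1)) :=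
        mul_nonneg hK₃ (by linarith [hxs0 k, hws0 k])
      have b3 : K₁ * (lam k ^ 2 / γ₁ k * ys k) + K₂ * (lam k ^ 2 / γ₂ k * ys k)
          ≤ (K₁ + K₂) * ρ k * (K₃ * (xs k + ws k + (Ms + 1))) := by
        calc K₁ * (lam k ^ 2 / γ₁ k * ys k) + K₂ * (lam k ^ 2 / γ₂ k * ys k)
            = (K₁ * (lam k ^ 2 / γ₁ k) + K₂ * (lam k ^ 2 / γ₂ k)) * ys k := by ring
          _ ≤ (K₁ * (lam k ^ 2 / γ₁ k) + K₂ * (lam k ^ 2 / γ₂ k))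
                * (K₃ * (xs k + ws k + (Ms + 1))) :=
              mul_le_mul_of_nonneg_left hyk
                (add_nonneg (mul_nonneg hK₁ hl1) (mul_nonneg hK₂ hl2))
          _ ≤ _ := by
              refine mul_le_mul_of_nonneg_right ?_ hV
              simp only [hρ]
              nlinarith [mul_nonneg hK₁ hl2, mul_nonneg hK₂ hl1]
      have b4 : K₂ * (γ₁ k ^ 2 / γ₂ k * xs k) ≤ K₂ * (γ₁ k ^ 2 / γ₂ k * (xs k + ws k)) :=
        mul_le_mul_of_nonneg_left (mul_le_mul_of_nonneg_left (by linarith [hws0 k]) (hτ0 k)) hK₂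
      have e1 : (1 + ((K₁ + K₂) * K₃ * ρ k + K₂ * (γ₁ k ^ 2 / γ₂ k))) * (xs k + ws k)
          - c * (γ₁ k * xs k + γ₂ k * ws k)
          + ((K₁ + K₂) * K₃ * (Ms + 1) * ρ k + K₂ * (γ₂ k * qs k + α k ^ 2 / γ₂ k)
          + (γ₁ k ^ 2 * ∫ ω, ‖S₁ (N₁ k ω)‖ ^ 2 ∂μ + γ₂ k ^ 2 * ∫ ω, ‖S₂ (N₂ k ω)‖ ^ 2 ∂μ))
          = xs k + ws k - c * (γ₁ k * xs k) - c * (γ₂ k * ws k)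
          + (K₁ + K₂) * ρ k * (K₃ * (xs k + ws k + (Ms + 1)))
          + K₂ * (γ₁ k ^ 2 / γ₂ k * (xs k + ws k)) + K₂ * (γ₂ k * qs k + α k ^ 2 / γ₂ k)
          + (γ₁ k ^ 2 * ∫ ω, ‖S₁ (N₁ k ω)‖ ^ 2 ∂μ + γ₂ k ^ 2 * ∫ ω, ‖S₂ (N₂ k ω)‖ ^ 2 ∂μ) := by
        ring
      rw [e1]
      linarith)
  have hMx : ∀ k, xs k ≤ M := fun k => by linarith [hM k, hws0 k]
  have hMw : ∀ k, ws k ≤ M := fun k => by linarith [hM k, hxs0 k]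
  have hD' : Summable fun k => γ₁ k * xs k + γ₂ k * ws k := by
    refine (hD.mul_left c⁻¹).congr fun k => ?_
    rw [inv_mul_cancel_left₀ hcpos.ne']
  refine ⟨max (max M Mq) (K₃ * (M + Ms + 1)),
    fun k => (hMx k).trans ((le_max_left _ _).trans (le_max_left _ _)),
    fun k => (hMw k).trans ((le_max_left _ _).trans (le_max_left _ _)),
    fun k => ((hysle k).trans (mul_le_mul_of_nonneg_left (by linarith [hMw k]) hK₃)).trans
      (le_max_right _ _),
    fun k => (hMq k).trans ((le_max_right _ _).trans (le_max_left _ _)), ?_, ?_, hss, hqs⟩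
  · exact hD'.of_nonneg_of_le (fun k => mul_nonneg (hγ₁ k).le (hxs0 k))
      fun k => le_add_of_nonneg_right (mul_nonneg (hγ₂ k).le (hws0 k))
  · exact hD'.of_nonneg_of_le (fun k => mul_nonneg (hγ₂ k).le (hws0 k))
      fun k => le_add_of_nonneg_left (mul_nonneg (hγ₁ k).le (hxs0 k))

end TrackingSystem

/-! ### From moment bounds to almost sure decay. -/

lemma summable_of_eventually_le_mul {a b : ℕ → ℝ} {K : ℝ} (ha : ∀ k, 0 ≤ a k)
    (h : ∀ᶠ k in atTop, a k ≤ K * b k) (hb : Summable b) : Summable a := by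
  refine Summable.of_norm_bounded_eventually_nat (hb.mul_left K) ?_
  filter_upwards [h] with k hk
  rwa [Real.norm_of_nonneg (ha k)]

lemma ae_summable_mul_norm_sq {Ω : Type*} {mΩ : MeasurableSpace Ω} {μ : Measure Ω}
    {F : Type*} [NormedAddCommGroup F] {β : ℕ → ℝ} (hβ : ∀ k, 0 ≤ β k) {p : ℕ → Ω → F}
    (hp : ∀ k, MemLp (p k) 2 μ) (h : Summable fun k => β k * ∫ ω, ‖p k ω‖ ^ 2 ∂μ) :
    ∀ᵐ ω ∂μ, Summable fun k => β k * ‖p k ω‖ ^ 2 :=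
  ae_summable_of_summable_integral (fun k => (integrable_norm_sq (hp k)).const_mul _)
    (fun k ω => mul_nonneg (hβ k) (sq_nonneg _)) (by simpa only [integral_const_mul] using h)

lemma ae_summable_mul_norm_sq_of_le {Ω : Type*} {mΩ : MeasurableSpace Ω} {μ : Measure Ω}
    {F : Type*} [NormedAddCommGroup F] {β : ℕ → ℝ} (hβ : ∀ k, 0 ≤ β k) {p : ℕ → Ω → F}
    (hp : ∀ k, MemLp (p k) 2 μ) {M : ℝ} (hM : ∀ k, ∫ ω, ‖p k ω‖ ^ 2 ∂μ ≤ M) (h : Summable β) :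
    ∀ᵐ ω ∂μ, Summable fun k => β k * ‖p k ω‖ ^ 2 :=
  ae_summable_mul_norm_sq hβ hp <| (h.mul_right M).of_nonneg_of_le
    (fun k => mul_nonneg (hβ k) (integral_nonneg fun _ => sq_nonneg _))
    fun k => mul_le_mul_of_nonneg_left (hM k) (hβ k)

namespace TrackingSystem

variable {Ω : Type*} {mΩ : MeasurableSpace Ω} {μ : Measure Ω}
  {E H₁ H₂ : Type*} [NormedAddCommGroup E] [InnerProductSpace ℝ E] [FiniteDimensional ℝ E]
  [MeasurableSpace E] [BorelSpace E]
  [NormedAddCommGroup H₁] [InnerProductSpace ℝ H₁] [FiniteDimensional ℝ H₁]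
  [MeasurableSpace H₁] [BorelSpace H₁]
  [NormedAddCommGroup H₂] [InnerProductSpace ℝ H₂] [FiniteDimensional ℝ H₂]
  [MeasurableSpace H₂] [BorelSpace H₂]
  {ℱ : Filtration ℕ mΩ} {W₁ W₂ : E →L[ℝ] E} {G : E → E} {L B : ℝ} {γ₁ γ₂ α lam : ℕ → ℝ}
  {N₁ N₂ X Y : ℕ → Ω → E} {P₁ P₂ : E →L[ℝ] E} {S₁ : E →L[ℝ] H₁} {S₂ : E →L[ℝ] H₂}
  {c₁ c₂ g₁ g₂ : ℝ} {m : ℕ} {R C : Matrix (Fin m) (Fin m) ℝ}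
  [IsProbabilityMeasure μ]

/-- Almost sure decay of the consensus error and of the tracking error. -/
theorem ae_decay (h : TrackingSystem ℱ μ W₁ W₂ G L B γ₁ γ₂ α lam N₁ N₂ X Y)
    (hstep : StepsizeAssumption R C γ₁ γ₂ α lam) (hW₁ : ∀ x, W₁ (P₁ x) = W₁ x)
    (hP₂ : ∀ x, P₂ (W₂ x) = W₂ x)
    (h₁ : IsLyapunov W₁ P₁ S₁ c₁ g₁) (h₂ : IsLyapunov W₂ P₂ S₂ c₂ g₂) :
    ∀ᵐ ω ∂μ, (Summable fun k => lam k * ‖P₁ (X k ω)‖ ^ 2) ∧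
      (Summable fun k => lam k * ‖P₂ (Y k ω)‖ ^ 2) ∧
      (Summable fun k => lam k * ‖(1 - P₂) (Y k ω - G (X k ω))‖ ^ 2) ∧
      (Summable fun k => lam k ^ 2 * ‖Y k ω‖ ^ 2) ∧
      Tendsto (fun k => P₁ (X k ω)) atTop (𝓝 0) ∧
      Tendsto (fun k => P₂ (Y k ω)) atTop (𝓝 0) := by
  obtain ⟨M, hMX, hMw, hMY, hMq, hsX, hsw, hss, hsq⟩ := h.moment_bounds hstep hW₁ hP₂ h₁ h₂
  have hγ₁ := hstep.weak₁.pos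
  have hγ₂ := hstep.weak₂.pos
  have hXm := fun k => (h.measurable_and_memLp k).1.1
  have hX2 := fun k => (h.measurable_and_memLp k).1.2
  have hYm := fun k => (h.measurable_and_memLp k).2.1
  have hY2 := fun k => (h.measurable_and_memLp k).2.2
  have hwm := fun k => (h.shiftedTracker_measurable_and_memLp k).1
  have hw2 := fun k => (h.shiftedTracker_measurable_and_memLp k).2
  have hdm := fun k => (h.drift_measurable_and_memLp k).1
  have hd2 := fun k => (h.drift_measurable_and_memLp k).2
  have hqm := fun k => (h.filteredNoise_measurable_and_memLp k).1
  have hq2 := fun k => (h.filteredNoise_measurable_and_memLp k).2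
  obtain ⟨K₁, hK₁, hc⟩ := exists_eventually_consensus_le hstep h₁
  obtain ⟨K₂, hK₂, ht⟩ := h.exists_eventually_tracker_le hstep hW₁ h₁ h₂
  have hc₁ := h₁.c_pos
  have hc₂ := h₂.c_pos
  have hs2 : ∀ k, MemLp (fun ω => (1 - P₂) (Y k ω - G (X k ω))) 2 μ := fun k =>
    (1 - P₂ : E →L[ℝ] E).comp_memLp' ((hY2 k).sub (h.memLp_G (hX2 k).1))
  have sX := ae_summable_mul_norm_sq (fun k => (hγ₁ k).le) (fun k => S₁.comp_memLp' (hX2 k)) hsX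
  have sw := ae_summable_mul_norm_sq (fun k => (hγ₂ k).le) (fun k => S₂.comp_memLp' (hw2 k)) hsw
  have ss := ae_summable_mul_norm_sq hstep.α_nonneg hs2 hss
  have sq := ae_summable_mul_norm_sq (fun k => (hγ₂ k).le) hq2 hsq
  have sY₁ := ae_summable_mul_norm_sq_of_le (fun k => div_nonneg (sq_nonneg _) (hγ₁ k).le) hY2 hMY
    hstep.weak₁.sum_ratio
  have sY₂ := ae_summable_mul_norm_sq_of_le (fun k => div_nonneg (sq_nonneg _) (hγ₂ k).le) hY2 hMY
    hstep.weak₂.sum_ratio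
  have sX₂ := ae_summable_mul_norm_sq_of_le (fun k => div_nonneg (sq_nonneg _) (hγ₂ k).le)
    (fun k => S₁.comp_memLp' (hX2 k)) hMX hstep.sum_γ₁_sq
  have tq : ∀ᵐ ω ∂μ, Tendsto (fun k => filteredNoise γ₁ γ₂ N₁ k ω) atTop (𝓝 0) := by
    refine h.noise₁.ae_tendsto_zero h.sum₁
      (a := fun k ω => (1 - γ₂ k) • filteredNoise γ₁ γ₂ N₁ k ω) (M := M)
      (fun k => (hqm k).const_smul _) (fun k => (hq2 k).const_smul _) (fun k => ?_)
      (fun k ω => rfl) (ae_of_all _ fun ω => ⟨0, summable_zero, ?_⟩) (fun k => (hγ₂ k).le)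
      hstep.weak₂.sum sq
    -- Centered noise can only increase the second moment, so the bound at time `k + 1` also bounds
    -- the predictable part at time `k`.
    · have e1 : ∫ ω, ‖filteredNoise γ₁ γ₂ N₁ (k + 1) ω‖ ^ 2 ∂μ = _ :=
        h.noise₁.integral_norm_add_smul_sq (k := k)
          (a := fun ω => (1 - γ₂ k) • filteredNoise γ₁ γ₂ N₁ k ω) ((hqm k).const_smul _)
          ((hq2 k).const_smul _) (γ₁ k)
      have h2 : 0 ≤ γ₁ k ^ 2 * ∫ ω, ‖N₁ k ω‖ ^ 2 ∂μ :=
        mul_nonneg (sq_nonneg _) (integral_nonneg fun ω => sq_nonneg _)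
      exact (by linarith : _ ≤ _).trans (hMq (k + 1))
    · filter_upwards [hstep.eventually_γ₂_le one_pos] with k hk
      rw [norm_smul, mul_pow, Real.norm_eq_abs, sq_abs, Pi.zero_apply, add_zero]
      exact mul_le_of_le_one_left (sq_nonneg _) (by nlinarith [hγ₂ k])
  have tX : ∀ᵐ ω ∂μ, Tendsto (fun k => S₁ (X k ω)) atTop (𝓝 0) := by
    have hm : ∀ k, Measurable[ℱ k] fun ω => X k ω + γ₁ k • W₁ (X k ω) - lam k • Y k ω := fun k =>
      ((hXm k).add ((W₁.continuous.measurable.comp (hXm k)).const_smul _)).sub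
        ((hYm k).const_smul _)
    have h2 : ∀ k, MemLp (fun ω => X k ω + γ₁ k • W₁ (X k ω) - lam k • Y k ω) 2 μ := fun k =>
      ((hX2 k).add ((W₁.comp_memLp' (hX2 k)).const_smul _)).sub ((hY2 k).const_smul _)
    have hsucc : ∀ k ω, S₁ (X (k + 1) ω)
        = S₁ (X k ω + γ₁ k • W₁ (X k ω) - lam k • Y k ω) + γ₁ k • S₁ (N₁ k ω) := fun k ω => by
      rw [h.X_succ, map_add, map_smul]
    refine (h.noise₁.map S₁).ae_tendsto_zero (h.noise₁.summable_map h.sum₁ S₁)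
      (a := fun k ω => S₁ (X k ω + γ₁ k • W₁ (X k ω) - lam k • Y k ω)) (M := M)
      (fun k => S₁.continuous.measurable.comp (hm k)) (fun k => S₁.comp_memLp' (h2 k))
      (fun k => ?_) hsucc ?_ (fun k => (hγ₁ k).le) hstep.weak₁.sum sX
    · have e1 := (h.noise₁.map S₁).integral_norm_add_smul_sq (k := k)
        (a := fun ω => S₁ (X k ω + γ₁ k • W₁ (X k ω) - lam k • Y k ω))
        (S₁.continuous.measurable.comp (hm k)) (S₁.comp_memLp' (h2 k)) (γ₁ k)
      simp_rw [← hsucc] at e1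
      have e2 : 0 ≤ γ₁ k ^ 2 * ∫ ω, ‖S₁ (N₁ k ω)‖ ^ 2 ∂μ :=
        mul_nonneg (sq_nonneg _) (integral_nonneg fun ω => sq_nonneg _)
      exact (by linarith : _ ≤ _).trans (hMX (k + 1))
    · filter_upwards [sY₁] with ω hω
      refine ⟨_, hω.mul_left K₁, ?_⟩
      filter_upwards [hc] with k hk
      refine (hk _ _).trans (add_le_add_left ?_ _)
      exact mul_le_of_le_one_left (sq_nonneg _) (by nlinarith [mul_pos hc₁ (hγ₁ k)])
  have tw : ∀ᵐ ω ∂μ, Tendsto (fun k => S₂ (shiftedTracker G γ₁ γ₂ N₁ X Y k ω)) atTop (𝓝 0) := by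
    have hm : ∀ k, Measurable[ℱ k] fun ω => (1 - α k) • shiftedTracker G γ₁ γ₂ N₁ X Y k ω
        + γ₂ k • W₂ (shiftedTracker G γ₁ γ₂ N₁ X Y k ω)
        + drift W₁ W₂ G γ₁ γ₂ α lam N₁ X Y k ω := fun k =>
      (((hwm k).const_smul _).add ((W₂.continuous.measurable.comp (hwm k)).const_smul _)).add
        (hdm k)
    have h2 : ∀ k, MemLp (fun ω => (1 - α k) • shiftedTracker G γ₁ γ₂ N₁ X Y k ω
        + γ₂ k • W₂ (shiftedTracker G γ₁ γ₂ N₁ X Y k ω)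
        + drift W₁ W₂ G γ₁ γ₂ α lam N₁ X Y k ω) 2 μ := fun k =>
      (((hw2 k).const_smul _).add ((W₂.comp_memLp' (hw2 k)).const_smul _)).add (hd2 k)
    have hsucc : ∀ k ω, S₂ (shiftedTracker G γ₁ γ₂ N₁ X Y (k + 1) ω)
        = S₂ ((1 - α k) • shiftedTracker G γ₁ γ₂ N₁ X Y k ω
          + γ₂ k • W₂ (shiftedTracker G γ₁ γ₂ N₁ X Y k ω)
          + drift W₁ W₂ G γ₁ γ₂ α lam N₁ X Y k ω) + γ₂ k • S₂ (N₂ k ω) := fun k ω => by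
      rw [h.shiftedTracker_succ, map_add, map_smul]
    refine (h.noise₂.map S₂).ae_tendsto_zero (h.noise₂.summable_map h.sum₂ S₂)
      (a := fun k ω => S₂ ((1 - α k) • shiftedTracker G γ₁ γ₂ N₁ X Y k ω
        + γ₂ k • W₂ (shiftedTracker G γ₁ γ₂ N₁ X Y k ω)
        + drift W₁ W₂ G γ₁ γ₂ α lam N₁ X Y k ω)) (M := M)
      (fun k => S₂.continuous.measurable.comp (hm k)) (fun k => S₂.comp_memLp' (h2 k))
      (fun k => ?_) hsucc ?_ (fun k => (hγ₂ k).le) hstep.weak₂.sum sw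
    · have e1 := (h.noise₂.map S₂).integral_norm_add_smul_sq (k := k)
        (a := fun ω => S₂ ((1 - α k) • shiftedTracker G γ₁ γ₂ N₁ X Y k ω
          + γ₂ k • W₂ (shiftedTracker G γ₁ γ₂ N₁ X Y k ω)
          + drift W₁ W₂ G γ₁ γ₂ α lam N₁ X Y k ω))
        (S₂.continuous.measurable.comp (hm k)) (S₂.comp_memLp' (h2 k)) (γ₂ k)
      simp_rw [← hsucc] at e1
      have e2 : 0 ≤ γ₂ k ^ 2 * ∫ ω, ‖S₂ (N₂ k ω)‖ ^ 2 ∂μ :=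
        mul_nonneg (sq_nonneg _) (integral_nonneg fun ω => sq_nonneg _)
      exact (by linarith : _ ≤ _).trans (hMw (k + 1))
    · filter_upwards [sX₂, sY₂, sq] with ω h1 h2 h3
      refine ⟨_, (((h1.add h2).add h3).add hstep.sum_α_sq).mul_left K₂, ?_⟩
      filter_upwards [ht] with k hk
      refine (hk _).trans (add_le_add_left ?_ _)
      exact mul_le_of_le_one_left (sq_nonneg _) (by nlinarith [mul_pos hc₂ (hγ₂ k)])
  -- Returning from the shifted tracker to `Y` costs a multiple of `‖q‖`, by the Lipschitz bound.
  have hP₂Y : ∀ k ω, ‖P₂ (Y k ω)‖ ≤ ‖S₂ (shiftedTracker G γ₁ γ₂ N₁ X Y k ω)‖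
      + ‖P₂‖ * L * ‖filteredNoise γ₁ γ₂ N₁ k ω‖ := fun k ω => by
    have e : P₂ (Y k ω) = P₂ (shiftedTracker G γ₁ γ₂ N₁ X Y k ω)
        + P₂ (G (X k ω) - G (X k ω - filteredNoise γ₁ γ₂ N₁ k ω)) := by
      rw [← map_add, shiftedTracker]; congr 1; abel
    rw [e]
    refine (norm_add_le _ _).trans (add_le_add (h₂.lower _) ((P₂.le_opNorm _).trans ?_))
    rw [mul_assoc]
    refine mul_le_mul_of_nonneg_left ((h.lipschitz _ _).trans_eq ?_) (norm_nonneg _)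
    simp
  obtain ⟨l, hl0, hl⟩ := hstep.exists_eventually_lam_le_α
  filter_upwards [sX, sw, ss, sq, sY₁, tq, tX, tw] with ω sX sw ss sq sY₁ tq tX tw
  refine ⟨?_, ?_, ?_, ?_, ?_, ?_⟩
  -- The natural weights are now replaced by `lam`, which is eventually at most `γ₁`, `γ₂` and a
  -- multiple of `α`.
  · refine summable_of_eventually_le_mul (K := 1)
      (fun k => mul_nonneg (hstep.lam_nonneg k) (sq_nonneg _)) ?_ sX
    filter_upwards [hstep.eventually_lam_le_γ₁] with k hk
    rw [one_mul]
    exact mul_le_mul hk (pow_le_pow_left₀ (norm_nonneg _) (h₁.lower _) 2) (sq_nonneg _)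
      (hγ₁ k).le
  · refine summable_of_eventually_le_mul (K := 2)
      (fun k => mul_nonneg (hstep.lam_nonneg k) (sq_nonneg _)) ?_
      (sw.add (sq.mul_left ((‖P₂‖ * L) ^ 2)))
    filter_upwards [hstep.eventually_lam_le_γ₂] with k hk
    have h3 := pow_le_pow_left₀ (norm_nonneg _) (hP₂Y k ω) 2
    have h4 : ‖P₂ (Y k ω)‖ ^ 2 ≤ 2 * (‖S₂ (shiftedTracker G γ₁ γ₂ N₁ X Y k ω)‖ ^ 2
        + (‖P₂‖ * L) ^ 2 * ‖filteredNoise γ₁ γ₂ N₁ k ω‖ ^ 2) := by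
      refine h3.trans ?_
      nlinarith [sq_nonneg (‖S₂ (shiftedTracker G γ₁ γ₂ N₁ X Y k ω)‖
        - ‖P₂‖ * L * ‖filteredNoise γ₁ γ₂ N₁ k ω‖)]
    refine (mul_le_mul hk h4 (sq_nonneg _) (hγ₂ k).le).trans_eq ?_
    simp only [Function.comp_apply]
    ring
  · refine summable_of_eventually_le_mul (K := l)
      (fun k => mul_nonneg (hstep.lam_nonneg k) (sq_nonneg _)) ?_ ss
    filter_upwards [hl] with k hk
    rw [← mul_assoc]
    exact mul_le_mul_of_nonneg_right hk (sq_nonneg _)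
  · refine summable_of_eventually_le_mul (K := 1)
      (fun k => mul_nonneg (sq_nonneg _) (sq_nonneg _)) ?_ sY₁
    filter_upwards [hstep.eventually_γ₁_le one_pos] with k hk
    rw [one_mul]
    refine mul_le_mul_of_nonneg_right ?_ (sq_nonneg _)
    rw [le_div_iff₀ (hγ₁ k)]
    exact mul_le_of_le_one_right (sq_nonneg _) hk
  · exact squeeze_zero_norm (fun k => h₁.lower _) (by simpa using tX.norm)
  · exact squeeze_zero_norm (fun k => hP₂Y k ω)
      (by simpa using tw.norm.add (tq.norm.const_mul (‖P₂‖ * L)))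

end TrackingSystem

/-! ### Perturbed gradient descent on smooth convex functions. -/

section Optimization

variable {V : Type*} [NormedAddCommGroup V] [InnerProductSpace ℝ V] [CompleteSpace V]
  {F : V → ℝ} {L : ℝ}

/-- The mean value inequality on the segment, applied relative to the derivative at `a`, yields the
constant `L`; the sharper `L / 2` is unnecessary. -/
lemma le_add_inner_add_of_lipschitz_gradient (hF : Differentiable ℝ F) (hL : 0 ≤ L)
    (hg : ∀ a b, ‖gradient F a - gradient F b‖ ≤ L * ‖a - b‖) (a v : V) :
    F (a + v) ≤ F a + inner ℝ (gradient F a) v + L * ‖v‖ ^ 2 := by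
  have h1 := (convex_segment (𝕜 := ℝ) a (a + v)).norm_image_sub_le_of_norm_fderiv_le'
    (f := F) (φ := fderiv ℝ F a) (C := L * ‖v‖) (fun z _ => hF z) (fun z hz => by
      rw [← toDual_gradient, ← toDual_gradient, ← map_sub, LinearIsometryEquiv.norm_map]
      refine (hg z a).trans (mul_le_mul_of_nonneg_left ?_ hL)
      have := norm_sub_le_of_mem_segment hz
      simpa using this) (left_mem_segment ℝ a (a + v)) (right_mem_segment ℝ a (a + v))
  rw [add_sub_cancel_left, ← inner_gradient_left] at h1
  have h2 := (le_abs_self _).trans (Real.norm_eq_abs _ ▸ h1)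
  nlinarith

/-- On the line through `a` and `b`, the slope at `0` is at most the secant slope over `[0, 1]`. -/
lemma _root_.ConvexOn.inner_gradient_le_sub (hF : ConvexOn ℝ Set.univ F)
    (hd : Differentiable ℝ F) (a b : V) : inner ℝ (gradient F a) (b - a) ≤ F b - F a := by
  have h1 : ConvexOn ℝ Set.univ (F ∘ AffineMap.lineMap (k := ℝ) a b) := by
    simpa using hF.comp_affineMap (AffineMap.lineMap (k := ℝ) a b)
  have h2 : HasDerivAt (F ∘ AffineMap.lineMap (k := ℝ) a b) (fderiv ℝ F a (b - a)) 0 := by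
    have h3 : HasDerivAt (AffineMap.lineMap (k := ℝ) a b) (b - a) (0 : ℝ) :=
      AffineMap.hasDerivAt_lineMap
    have h4 : HasFDerivAt F (fderiv ℝ F a) (AffineMap.lineMap (k := ℝ) a b 0) := by
      simpa using (hd a).hasFDerivAt
    exact h4.comp_hasDerivAt 0 h3
  have h5 := h1.le_slope_of_hasDerivAt (Set.mem_univ 0) (Set.mem_univ 1) one_pos h2
  rw [inner_gradient_left]
  simpa [slope_def_field] using h5

/-- Convergence of the objective along a perturbed gradient recursion. -/
lemma exists_tendsto_of_perturbed_gradient (hF : Differentiable ℝ F) (hL : 0 ≤ L)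
    (hg : ∀ a b, ‖gradient F a - gradient F b‖ ≤ L * ‖a - b‖) {b : ℝ} (hb : ∀ a, b ≤ F a)
    {x n p r : ℕ → V} {lam : ℕ → ℝ} (hlam : ∀ k, 0 ≤ lam k) {κ : ℝ} (hκ : 0 < κ)
    (hx : ∀ k, x (k + 1) = x k + (n k - lam k • p k))
    (hp : ∀ k, p k = κ • gradient F (x k) + r k)
    (hr : Summable fun k => lam k * ‖r k‖ ^ 2) (hps : Summable fun k => lam k ^ 2 * ‖p k‖ ^ 2)
    (hn : Summable fun k => ‖n k‖ ^ 2) {s : ℝ}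
    (hs : Tendsto (fun K => ∑ k ∈ Finset.range K, inner ℝ (gradient F (x k)) (n k)) atTop (𝓝 s)) :
    (∃ l, Tendsto (fun k => F (x k)) atTop (𝓝 l)) ∧
      Summable fun k => lam k * ‖gradient F (x k)‖ ^ 2 := by
  obtain ⟨h1, h2⟩ := exists_tendsto_of_le_sub_add (t := fun k => F (x k))
    (D := fun k => κ / 2 * (lam k * ‖gradient F (x k)‖ ^ 2))
    (e := fun k => inner ℝ (gradient F (x k)) (n k)
      + (1 / (2 * κ) * (lam k * ‖r k‖ ^ 2) + 2 * L * (‖n k‖ ^ 2 + lam k ^ 2 * ‖p k‖ ^ 2)))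
    (fun k => hb _)
    (fun k => mul_nonneg (by positivity) (mul_nonneg (hlam k) (sq_nonneg _)))
    (by
      simp_rw [Finset.sum_add_distrib (f := fun k => inner ℝ (gradient F (x k)) (n k))]
      exact hs.add ((hr.mul_left _).add ((hn.add hps).mul_left _)).hasSum.tendsto_sum_nat)
    (Eventually.of_forall fun k => by
      have e1 := le_add_inner_add_of_lipschitz_gradient hF hL hg (x k) (n k - lam k • p k)
      rw [← hx] at e1
      set g := gradient F (x k)
      have e2 : inner ℝ g (n k - lam k • p k)
          = inner ℝ g (n k) - lam k * (κ * ‖g‖ ^ 2 + inner ℝ g (r k)) := by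
        rw [inner_sub_right, inner_smul_right, hp, inner_add_right, inner_smul_right,
          real_inner_self_eq_norm_sq]
      -- Young's inequality with weight `κ` sacrifices half of the descent `κ ‖g‖²`.
      have e3 : -inner ℝ g (r k) ≤ κ / 2 * ‖g‖ ^ 2 + 1 / (2 * κ) * ‖r k‖ ^ 2 := by
        have i1 := neg_le_of_abs_le (abs_real_inner_le_norm g (r k))
        have i2 : 0 ≤ (κ * ‖g‖ - ‖r k‖) ^ 2 / (2 * κ) := by positivity
        have i3 : (κ * ‖g‖ - ‖r k‖) ^ 2 / (2 * κ)
            = κ / 2 * ‖g‖ ^ 2 - ‖g‖ * ‖r k‖ + 1 / (2 * κ) * ‖r k‖ ^ 2 := by field_simp; ring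
        linarith
      have e4 := mul_le_mul_of_nonneg_left e3 (hlam k)
      have e5 : ‖n k - lam k • p k‖ ^ 2 ≤ 2 * (‖n k‖ ^ 2 + lam k ^ 2 * ‖p k‖ ^ 2) := by
        have i1 := pow_le_pow_left₀ (norm_nonneg _) (norm_sub_le (n k) (lam k • p k)) 2
        rw [norm_smul, Real.norm_of_nonneg (hlam k)] at i1
        nlinarith [sq_nonneg (‖n k‖ - lam k * ‖p k‖)]
      have e6 := mul_le_mul_of_nonneg_left e5 hL
      rw [e2] at e1
      linarith)
  refine ⟨h1, (h2.mul_left (κ / 2)⁻¹).congr fun k => ?_⟩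
  rw [inv_mul_cancel_left₀ (by positivity)]

/-- Extended norms put the liminf in a complete lattice, so no boundedness of the sequence has to be
supplied. -/
lemma liminf_enorm_eq_zero {g : ℕ → V} {lam : ℕ → ℝ} (hlam : ∀ k, 0 ≤ lam k)
    (hdiv : DivergentSeries lam) (h : Summable fun k => lam k * ‖g k‖ ^ 2) :
    liminf (fun k => ‖g k‖ₑ) atTop = 0 := by
  refine le_antisymm (ENNReal.le_of_forall_pos_le_add fun ε hε _ => ?_) bot_le
  rw [zero_add]
  refine liminf_le_of_frequently_le' ?_
  have hε' : (0 : ℝ) < ε := hε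
  refine (frequently_lt_of_summable_mul hlam hdiv h (pow_pos hε' 2)).mono fun k hk => ?_
  have h1 : ‖g k‖ < ε := lt_of_pow_lt_pow_left₀ 2 hε'.le hk
  rw [← ofReal_norm]
  exact ENNReal.ofReal_le_of_le_toReal (by simpa using h1.le)

/-- A bounded sequence along which a convex objective converges, with gradients tending to zero
along a subsequence, minimizes the objective. -/
lemma tendsto_min_of_convexOn (hF : ConvexOn ℝ Set.univ F) (hd : Differentiable ℝ F)
    {θ : V} (hθ : IsMinOn F Set.univ θ) {x : ℕ → V}
    (hx : Bornology.IsBounded (Set.range x)) {lam : ℕ → ℝ} (hlam : ∀ k, 0 ≤ lam k)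
    (hdiv : DivergentSeries lam) (h : Summable fun k => lam k * ‖gradient F (x k)‖ ^ 2)
    {l : ℝ} (hl : Tendsto (fun k => F (x k)) atTop (𝓝 l)) : l = F θ := by
  have hmin : ∀ y, F θ ≤ F y := fun y => hθ (Set.mem_univ y)
  obtain ⟨M, hMpos, hM⟩ := hx.exists_pos_norm_le
  refine le_antisymm ?_ (ge_of_tendsto' hl fun k => hmin _)
  by_contra! hlt
  set D := M + ‖θ‖ with hD
  have hDpos : 0 < D := add_pos_of_pos_of_nonneg hMpos (norm_nonneg _)
  -- A gradient below `η` at distance at most `D` from `θ` forces `F (x k) - F θ ≤ (l - F θ) / 2`,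
  -- although `F (x k)` eventually exceeds the midpoint of `F θ` and `l`.
  set η := (l - F θ) / (2 * D) with hη
  have hηpos : 0 < η := div_pos (sub_pos.2 hlt) (by positivity)
  have h1 := frequently_lt_of_summable_mul hlam hdiv h (pow_pos hηpos 2)
  have h2 : ∀ᶠ k in atTop, (l + F θ) / 2 < F (x k) := hl.eventually_const_lt (by linarith)
  obtain ⟨k, hk1, hk2⟩ := (h1.and_eventually h2).exists
  have h3 : ‖gradient F (x k)‖ < η := lt_of_pow_lt_pow_left₀ 2 hηpos.le hk1
  have h4 := hF.inner_gradient_le_sub hd (x k) θ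
  have h5 := neg_le_of_abs_le (abs_real_inner_le_norm (gradient F (x k)) (θ - x k))
  have h6 : ‖θ - x k‖ ≤ D := (norm_sub_le _ _).trans (by linarith [hM (x k) ⟨k, rfl⟩])
  have h7 : ‖gradient F (x k)‖ * ‖θ - x k‖ ≤ η * D :=
    mul_le_mul h3.le h6 (norm_nonneg _) hηpos.le
  have h8 : η * D = (l - F θ) / 2 := by rw [hη]; field_simp
  linarith

lemma abs_sub_le_of_norm_gradient_le (hF : ConvexOn ℝ Set.univ F) (hd : Differentiable ℝ F)
    {B : ℝ} (hB : ∀ a, ‖gradient F a‖ ≤ B) (a b : V) : |F a - F b| ≤ B * ‖a - b‖ := by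
  have key : ∀ a b, F a - F b ≤ B * ‖a - b‖ := fun a b => by
    have h1 := hF.inner_gradient_le_sub hd a b
    have h2 := neg_le_of_abs_le (abs_real_inner_le_norm (gradient F a) (b - a))
    have h3 := mul_le_mul_of_nonneg_right (hB a) (norm_nonneg (b - a))
    rw [norm_sub_rev a b]
    linarith
  rw [abs_sub_le_iff]
  exact ⟨key a b, norm_sub_rev a b ▸ key b a⟩

end Optimization

/-! ### The gradient of the averaged objective. -/

section Objective

variable {m d : ℕ} {f : Fin m → Vec d → ℝ}

lemma hasGradientAt_objective (hf : ∀ i, Differentiable ℝ (f i)) (θ : Vec d) :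
    HasGradientAt (objective f) ((1 / (m : ℝ)) • ∑ i, gradient (f i) θ) θ := by
  rw [hasGradientAt_iff_hasFDerivAt, map_smul, map_sum]
  simp_rw [toDual_gradient]
  exact (HasFDerivAt.fun_sum fun i _ => (hf i θ).hasFDerivAt).const_mul (1 / (m : ℝ))

lemma norm_le_of_sum_abs_le {a : Vec d} {B : ℝ} (h : ∑ l, |a l| ≤ B) : ‖a‖ ≤ B := by
  refine le_trans ?_ h
  have := PiLp.norm_eq_of_L2 a
  rw [this]
  refine Real.sqrt_le_iff.2 ⟨Finset.sum_nonneg fun _ _ => abs_nonneg _, ?_⟩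
  simp_rw [Real.norm_eq_abs]
  exact Finset.sum_sq_le_sq_sum_of_nonneg fun _ _ => abs_nonneg _

lemma norm_inv_smul_sum_le (hm : 0 < m) {v : Fin m → Vec d} {K : ℝ} (h : ∀ i, ‖v i‖ ≤ K) :
    ‖(1 / (m : ℝ)) • ∑ i, v i‖ ≤ K := by
  have hm' : (0 : ℝ) < m := by exact_mod_cast hm
  rw [norm_smul, Real.norm_of_nonneg (by positivity), one_div, inv_mul_le_iff₀ hm']
  refine (norm_sum_le _ _).trans ((Finset.sum_le_sum fun i _ => h i).trans_eq ?_)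
  simp

end Objective

/-! ### Matrices acting blockwise on stacked states. -/

section StackedVec

variable {m : ℕ} {V : Type*} [NormedAddCommGroup V] [InnerProductSpace ℝ V]
  [FiniteDimensional ℝ V]

/-- Endomorphisms of a finite-dimensional space as continuous linear maps. -/
noncomputable def endToContinuousLinearMap (E : Type*) [NormedAddCommGroup E] [NormedSpace ℝ E]
    [FiniteDimensional ℝ E] : Module.End ℝ E →ₐ[ℝ] (E →L[ℝ] E) :=
  (Module.End.toContinuousLinearMap (𝕜 := ℝ) E).toAlgHom

/-- The stacked states of all agents, with the Euclidean norm. -/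
abbrev StackedVec (m : ℕ) (V : Type*) : Type _ := PiLp 2 (fun _ : Fin m => V)

/-- The blockwise action of a matrix on stacked states, as a linear map. -/
noncomputable def blockLinearMap (M : Matrix (Fin m) (Fin m) ℝ) :
    StackedVec m V →ₗ[ℝ] StackedVec m V where
  toFun x := WithLp.toLp 2 fun i => ∑ j, M i j • x j
  map_add' x y := by ext i : 1; simp [Finset.sum_add_distrib]
  map_smul' c x := by
    ext i : 1
    simp only [PiLp.smul_apply, RingHom.id_apply, Finset.smul_sum]
    exact Finset.sum_congr rfl fun j _ => smul_comm _ _ _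

lemma blockLinearMap_apply (M : Matrix (Fin m) (Fin m) ℝ) (x : StackedVec m V) (i : Fin m) :
    blockLinearMap M x i = ∑ j, M i j • x j := rfl

/-- The blockwise action of matrices on stacked states, as endomorphisms. -/
noncomputable def blockEnd (m : ℕ) (V : Type*) [NormedAddCommGroup V]
    [InnerProductSpace ℝ V] [FiniteDimensional ℝ V] :
    Matrix (Fin m) (Fin m) ℝ →ₐ[ℝ] Module.End ℝ (StackedVec m V) :=
  AlgHom.ofLinearMap (A := Matrix (Fin m) (Fin m) ℝ) (B := Module.End ℝ (StackedVec m V))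
    { toFun := fun M => blockLinearMap M
      map_add' := fun M N => LinearMap.ext fun x => PiLp.ext fun i => by
        simp only [LinearMap.add_apply, PiLp.add_apply, blockLinearMap_apply, Matrix.add_apply,
          add_smul, Finset.sum_add_distrib]
      map_smul' := fun c M => LinearMap.ext fun x => PiLp.ext fun i => by
        simp only [LinearMap.smul_apply, PiLp.smul_apply, blockLinearMap_apply, Matrix.smul_apply,
          smul_eq_mul, mul_smul, Finset.smul_sum, RingHom.id_apply] }
    (LinearMap.ext fun x => PiLp.ext fun i => by
      simp [blockLinearMap_apply, Matrix.one_apply])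
    (fun M N => LinearMap.ext fun x => PiLp.ext fun i => by
      simp only [LinearMap.coe_mk, AddHom.coe_mk, Module.End.mul_apply, blockLinearMap_apply,
        Matrix.mul_apply, Finset.sum_smul, Finset.smul_sum, mul_smul]
      rw [Finset.sum_comm])

/-- The blockwise action of matrices on stacked states. -/
noncomputable def blockAction (m : ℕ) (V : Type*) [NormedAddCommGroup V]
    [InnerProductSpace ℝ V] [FiniteDimensional ℝ V] :
    Matrix (Fin m) (Fin m) ℝ →ₐ[ℝ] (StackedVec m V →L[ℝ] StackedVec m V) :=
  (endToContinuousLinearMap (StackedVec m V)).comp (blockEnd m V)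

lemma blockAction_apply (M : Matrix (Fin m) (Fin m) ℝ) (x : StackedVec m V) (i : Fin m) :
    blockAction m V M x i = ∑ j, M i j • x j := rfl

/-- The block action is linear on a finite-dimensional space, hence continuous, so entrywise
smallness of `(1 + ε • W) ^ N * P` brings the operator norm below the required `1 / 2`. -/
lemma exists_isLyapunov_blockAction (V : Type*) [NormedAddCommGroup V]
    [InnerProductSpace ℝ V] [FiniteDimensional ℝ V] {W P : Matrix (Fin m) (Fin m) ℝ}
    (hWP : W * P = W)
    (hPW : P * W = W) (hPP : P * P = P) {ε : ℝ} (hε : 0 < ε)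
    (h : ∀ η : ℝ, 0 < η → ∃ N, 0 < N ∧ ∀ i j, |((1 + ε • W) ^ N * P) i j| ≤ η) :
    ∃ N c γ₀, IsLyapunov (blockAction m V W) (blockAction m V P)
      (orbitMap (1 + ε • blockAction m V W) (blockAction m V P) N) c γ₀ := by
  choose N hN0 hN using fun k : ℕ => h (1 / (k + 1)) (by positivity)
  have h1 : Tendsto (fun k => (1 + ε • W) ^ N k * P) atTop (𝓝 0) := by
    refine tendsto_pi_nhds.2 fun i => tendsto_pi_nhds.2 fun j => ?_
    exact squeeze_zero_norm (fun k => hN k i j) tendsto_one_div_add_atTop_nhds_zero_nat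
  have h2 : Continuous (blockAction m V) :=
    (blockAction m V).toLinearMap.continuous_of_finiteDimensional
  have h3 : Tendsto (fun k => ‖blockAction m V ((1 + ε • W) ^ N k * P)‖) atTop (𝓝 0) := by
    have h4 : Continuous fun M => ‖blockAction m V M‖ :=
      (continuous_norm (E := StackedVec m V →L[ℝ] StackedVec m V)).comp h2
    have h5 : ‖blockAction m V 0‖ = 0 := by
      rw [map_zero]
      exact norm_zero (E := StackedVec m V →L[ℝ] StackedVec m V)
    have h6 := h4.tendsto 0
    simp only [h5] at h6
    exact h6.comp h1
  obtain ⟨k, hk⟩ := (h3.eventually_le_const (by norm_num : (0 : ℝ) < 1 / 2)).exists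
  have hmul : ∀ A B : Matrix (Fin m) (Fin m) ℝ,
      (blockAction m V A) ∘L (blockAction m V B) = blockAction m V (A * B) := fun A B =>
    (map_mul (blockAction m V) A B).symm
  refine ⟨N k, isLyapunov_orbitMap (by rw [hmul, hWP]) (by rw [hmul, hPW]) (by rw [hmul, hPP]) hε
    (hN0 k) ?_⟩
  have e : (1 + ε • blockAction m V W) ^ N k = blockAction m V ((1 + ε • W) ^ N k) := by
    simp
  rw [e, hmul]
  exact hk

end StackedVec

/-! ### Independence of the past from the present noise. -/

section Independence

variable {Ω : Type*} {mΩ : MeasurableSpace Ω} {μ : Measure Ω}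

/-- The sets `a ∩ p` form a π-system generating `A ⊔ P`. On it the product formula follows by
splitting off `a` from `p ∩ n`, then `p` from `n`. -/
lemma indep_sup_left {A P N : MeasurableSpace Ω} [IsProbabilityMeasure μ] (hA : A ≤ mΩ)
    (hP : P ≤ mΩ) (hN : N ≤ mΩ) (h₁ : Indep A (P ⊔ N) μ) (h₂ : Indep P N μ) :
    Indep (A ⊔ P) N μ := by
  set π : Set (Set Ω) := {s | ∃ a p, MeasurableSet[A] a ∧ MeasurableSet[P] p ∧ s = a ∩ p} with hπ
  have hpi : IsPiSystem π := by
    rintro _ ⟨a, p, ha, hp, rfl⟩ _ ⟨a', p', ha', hp', rfl⟩ -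
    exact ⟨a ∩ a', p ∩ p', MeasurableSet.inter ha ha', MeasurableSet.inter hp hp',
      Set.inter_inter_inter_comm _ _ _ _⟩
  have hgen : A ⊔ P = MeasurableSpace.generateFrom π := by
    refine le_antisymm (sup_le (fun s hs => ?_) fun s hs => ?_)
      (MeasurableSpace.generateFrom_le ?_)
    · exact MeasurableSpace.measurableSet_generateFrom
        ⟨s, Set.univ, hs, MeasurableSet.univ, (Set.inter_univ s).symm⟩
    · exact MeasurableSpace.measurableSet_generateFrom
        ⟨Set.univ, s, MeasurableSet.univ, hs, (Set.univ_inter s).symm⟩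
    · rintro _ ⟨a, p, ha, hp, rfl⟩
      exact MeasurableSet.inter ((le_sup_left : A ≤ A ⊔ P) _ ha) ((le_sup_right : P ≤ A ⊔ P) _ hp)
  refine IndepSets.indep (sup_le hA hP) hN hpi (@MeasurableSpace.isPiSystem_measurableSet Ω N) hgen
    (@MeasurableSpace.generateFrom_measurableSet Ω N).symm ?_
  rw [IndepSets_iff]
  rintro _ n ⟨a, p, ha, hp, rfl⟩ hn
  rw [Indep_iff] at h₁ h₂
  have hpn : MeasurableSet[P ⊔ N] (p ∩ n) :=
    MeasurableSet.inter ((le_sup_left : P ≤ P ⊔ N) _ hp) ((le_sup_right : N ≤ P ⊔ N) _ hn)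
  rw [Set.inter_assoc, h₁ a _ ha hpn, h₂ p n hp hn,
    h₁ a p ha ((le_sup_left : P ≤ P ⊔ N) _ hp), mul_assoc]

variable {ι β β' : Type*} [MeasurableSpace β] [MeasurableSpace β']

/-- The information of an initial value and of all noise variables of time less than `k`. -/
def pastFiltration {X₀ : Ω → β'} (hX₀ : Measurable X₀) {n : ι → Ω → β}
    (hn : ∀ p, Measurable (n p)) (time : ι → ℕ) : Filtration ℕ mΩ where
  seq k := MeasurableSpace.comap X₀ inferInstance ⊔
    ⨆ p ∈ {p | time p < k}, MeasurableSpace.comap (n p) inferInstance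
  mono' _ _ hij := sup_le_sup_left
    (biSup_mono fun _ hp => lt_of_lt_of_le hp hij) _
  le' _ := sup_le hX₀.comap_le (iSup₂_le fun p _ => (hn p).comap_le)

variable [IsProbabilityMeasure μ] {X₀ : Ω → β'} (hX₀ : Measurable X₀) {n : ι → Ω → β}
  (hn : ∀ p, Measurable (n p)) (time : ι → ℕ)

lemma measurable_initial_pastFiltration (k : ℕ) :
    Measurable[pastFiltration hX₀ hn time k] X₀ :=
  Measurable.of_comap_le le_sup_left

lemma measurable_noise_pastFiltration {k : ℕ} {p : ι} (hp : time p < k) :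
    Measurable[pastFiltration hX₀ hn time k] (n p) :=
  Measurable.of_comap_le <| le_sup_of_le_right <|
    le_biSup (fun p => MeasurableSpace.comap (n p) inferInstance) hp

/-- Noise before time `k` and noise at time `k` have disjoint index sets; the initial value,
independent of all noise jointly, is then adjoined to the past. -/
lemma indep_pastFiltration (hi : iIndepFun n μ) (h₀ : IndepFun X₀ (fun ω p => n p ω) μ) (k : ℕ) :
    Indep (pastFiltration hX₀ hn time k)
      (⨆ p ∈ {p | time p = k}, MeasurableSpace.comap (n p) inferInstance) μ := by
  have hpi : MeasurableSpace.comap (fun ω p => n p ω) MeasurableSpace.pi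
      = ⨆ p, MeasurableSpace.comap (n p) inferInstance := by
    simp only [MeasurableSpace.pi, MeasurableSpace.comap_iSup, MeasurableSpace.comap_comp]
    rfl
  rw [IndepFun_iff_Indep, hpi] at h₀
  refine indep_sup_left hX₀.comap_le (iSup₂_le fun p _ => (hn p).comap_le)
    (iSup₂_le fun p _ => (hn p).comap_le) ?_ ?_
  · exact indep_of_indep_of_le_right h₀ (sup_le (iSup₂_le fun p _ => le_iSup
      (fun p => MeasurableSpace.comap (n p) inferInstance) p) (iSup₂_le fun p _ => le_iSup
      (fun p => MeasurableSpace.comap (n p) inferInstance) p))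
  · refine indep_iSup_of_disjoint (fun p => (hn p).comap_le) hi ?_
    exact Set.disjoint_left.2 fun p hp hp' => (ne_of_lt hp) hp'

end Independence

/-! ### Disagreement projections. -/

section Averaging

variable {m : ℕ} {W : Matrix (Fin m) (Fin m) ℝ}

/-- The off-diagonal part of a matrix. -/
def offDiag (W : Matrix (Fin m) (Fin m) ℝ) : Matrix (Fin m) (Fin m) ℝ :=
  W - Matrix.diagonal fun i => W i i

/-- Off-diagonal entries that are not positive vanish, so sums over neighbours lose nothing. -/
lemma sum_inNbr_smul {M : Type*} [AddCommGroup M] [Module ℝ M]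
    (hoff : ∀ i j, i ≠ j → 0 ≤ W i j) (i : Fin m) (z : Fin m → M) :
    ∑ j ∈ inNbr W i, W i j • z j = ∑ j, offDiag W i j • z j := by
  rw [inNbr, Finset.sum_filter]
  refine Finset.sum_congr rfl fun j _ => ?_
  by_cases h : j = i
  · simp [h, offDiag]
  · rcases (hoff i j (Ne.symm h)).eq_or_lt with h0 | h0
    · simp [offDiag, ← h0, Ne.symm h]
    · simp [h, h0, offDiag, Ne.symm h]

lemma sum_row_eq_zero (hoff : ∀ i j, i ≠ j → 0 ≤ W i j)
    (hdiag : ∀ i, W i i = -∑ j ∈ inNbr W i, W i j) (i : Fin m) : ∑ j, W i j = 0 := by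
  have h1 := sum_inNbr_smul hoff i (fun _ => (1 : ℝ))
  simp only [smul_eq_mul, mul_one] at h1
  have h2 := hdiag i
  rw [h1] at h2
  simp only [offDiag, Matrix.sub_apply, Finset.sum_sub_distrib, Matrix.diagonal_apply,
    Finset.sum_ite_eq, Finset.mem_univ, if_true] at h2
  linarith

/-- The projection along the constant vectors onto the vectors with `u`-average zero. -/
noncomputable def averagingProj (u : Fin m → ℝ) : Matrix (Fin m) (Fin m) ℝ :=
  1 - (1 / (m : ℝ)) • Matrix.vecMulVec 1 u

lemma mul_averagingProj {M : Matrix (Fin m) (Fin m) ℝ} (u : Fin m → ℝ) :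
    M * averagingProj u = M - (1 / (m : ℝ)) • Matrix.vecMulVec (M *ᵥ 1) u := by
  rw [averagingProj, mul_sub, mul_one, Matrix.mul_smul, Matrix.mul_vecMulVec]

lemma averagingProj_mul {M : Matrix (Fin m) (Fin m) ℝ} (u : Fin m → ℝ) :
    averagingProj u * M = M - (1 / (m : ℝ)) • Matrix.vecMulVec 1 (u ᵥ* M) := by
  rw [averagingProj, sub_mul, one_mul, Matrix.smul_mul, Matrix.vecMulVec_mul]

lemma mulVec_one_eq_zero (hrow : ∀ i, ∑ j, W i j = 0) : W *ᵥ 1 = 0 := by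
  ext i
  simp [Matrix.mulVec, dotProduct, hrow]

lemma mul_averagingProj_eq_self (hrow : ∀ i, ∑ j, W i j = 0) (u : Fin m → ℝ) :
    W * averagingProj u = W := by
  simp [mul_averagingProj, mulVec_one_eq_zero hrow]

lemma averagingProj_mul_eq_self {u : Fin m → ℝ} (hu : u ᵥ* W = 0) : averagingProj u * W = W := by
  simp [averagingProj_mul, hu]

lemma averagingProj_mulVec_one (hm : 0 < m) {u : Fin m → ℝ} (hu : ∑ i, u i = m) :
    averagingProj u *ᵥ 1 = 0 := by
  have hm' : (m : ℝ) ≠ 0 := by exact_mod_cast hm.ne'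
  ext i
  simp [averagingProj, Matrix.mulVec, dotProduct, Finset.sum_sub_distrib, Matrix.one_apply,
    ← Finset.mul_sum, hu, hm']

lemma averagingProj_mul_self (hm : 0 < m) {u : Fin m → ℝ} (hu : ∑ i, u i = m) :
    averagingProj u * averagingProj u = averagingProj u := by
  simp [mul_averagingProj, averagingProj_mulVec_one hm hu]

lemma one_add_smul_pow_mulVec_one (hrow : ∀ i, ∑ j, W i j = 0) (ε : ℝ) (N : ℕ) :
    (1 + ε • W) ^ N *ᵥ (1 : Fin m → ℝ) = 1 := by
  induction N with
  | zero => simp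
  | succ N ih =>
    rw [pow_succ, ← Matrix.mulVec_mulVec, Matrix.add_mulVec, Matrix.one_mulVec,
      Matrix.smul_mulVec, mulVec_one_eq_zero hrow, smul_zero, add_zero, ih]

lemma one_add_smul_pow_mul_averagingProj (hrow : ∀ i, ∑ j, W i j = 0) (u : Fin m → ℝ) (ε : ℝ)
    (N : ℕ) (i j : Fin m) :
    ((1 + ε • W) ^ N * averagingProj u) i j
      = ((1 + ε • W : Matrix (Fin m) (Fin m) ℝ) ^ N) i j - u j / m := by
  rw [mul_averagingProj, one_add_smul_pow_mulVec_one hrow]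
  simp [div_eq_inv_mul]

lemma averagingProj_mul_one_add_smul_pow {u : Fin m → ℝ} (hu : u ᵥ* W = 0) (ε : ℝ)
    (N : ℕ) (i j : Fin m) :
    (averagingProj u * (1 + ε • W) ^ N) i j
      = ((1 + ε • W : Matrix (Fin m) (Fin m) ℝ) ^ N) i j - u j / m := by
  rw [averagingProj_mul, vecMul_one_add_smul_pow hu]
  simp [div_eq_inv_mul]

variable {V : Type*} [NormedAddCommGroup V] [InnerProductSpace ℝ V] [FiniteDimensional ℝ V]

lemma blockAction_averagingProj (u : Fin m → ℝ) (x : StackedVec m V) (i : Fin m) :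
    blockAction m V (averagingProj u) x i = x i - (1 / (m : ℝ)) • ∑ j, u j • x j := by
  rw [blockAction_apply]
  simp [averagingProj, sub_smul, Finset.sum_sub_distrib, Matrix.one_apply, mul_smul,
    Finset.smul_sum]

lemma blockAction_averagingProj_transpose (v : Fin m → ℝ) (x : StackedVec m V) (i : Fin m) :
    blockAction m V (averagingProj v)ᵀ x i = x i - v i • (1 / (m : ℝ)) • ∑ j, x j := by
  rw [blockAction_apply]
  simp only [averagingProj, Matrix.transpose_apply, Matrix.sub_apply, Matrix.smul_apply,
    Matrix.one_apply, Matrix.vecMulVec_apply, Pi.one_apply, one_mul, smul_eq_mul, sub_smul,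
    Finset.sum_sub_distrib, ite_smul, one_smul, zero_smul, Finset.sum_ite_eq', Finset.mem_univ,
    if_true, Finset.smul_sum, smul_smul]
  congr 1
  exact Finset.sum_congr rfl fun j _ => by rw [mul_comm]

end Averaging

lemma measurable_toLp_stacked {Ω : Type*} {mΩ : MeasurableSpace Ω} {m d : ℕ} {z : Fin m → Ω → Vec d}
    (h : ∀ i, Measurable (z i)) :
    Measurable fun ω => (WithLp.toLp 2 fun i => z i ω : StackedVec m (Vec d)) :=
  (WithLp.measurable_toLp 2 _).comp (measurable_pi_lambda _ h)

/-! ### The noise of all agents as one centered vector. -/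

section StackedNoise

variable {Ω : Type*} {mΩ : MeasurableSpace Ω} {μ : Measure Ω} {m d : ℕ}

lemma stackedVec_norm_le_sum (x : StackedVec m (Vec d)) : ‖x‖ ≤ ∑ i, ‖x i‖ := by
  rw [PiLp.norm_eq_of_L2]
  refine Real.sqrt_le_iff.2 ⟨Finset.sum_nonneg fun _ _ => norm_nonneg _, ?_⟩
  exact Finset.sum_sq_le_sq_sum_of_nonneg fun _ _ => norm_nonneg _

variable [IsProbabilityMeasure μ] {γ₁ γ₂ : ℕ → ℝ} {x₀ : Fin m → Ω → Vec d}
  {ζ ξ : ℕ → Fin m → Ω → Vec d}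

lemma isCenteredNoise_stacked {ι β' : Type*} [MeasurableSpace β'] {X₀ : Ω → β'}
    (hX₀ : Measurable X₀) {n : ι → Ω → Vec d} (hn : ∀ p, Measurable (n p)) (time : ι → ℕ)
    (hi : iIndepFun n μ) (h₀ : IndepFun X₀ (fun ω p => n p ω) μ)
    (hL : ∀ p, MemLp (n p) 2 μ) (h0 : ∀ p, ∫ ω, n p ω ∂μ = 0) (idx : ℕ → Fin m → ι)
    (hidx : ∀ k i, time (idx k i) = k) :
    IsCenteredNoise (pastFiltration hX₀ hn time) μ
      (fun k ω => (WithLp.toLp 2 fun i => n (idx k i) ω : StackedVec m (Vec d))) where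
  measurable k := by
    refine measurable_toLp_stacked fun i => ?_
    exact measurable_noise_pastFiltration hX₀ hn time ((hidx k i).trans_lt k.lt_succ_self)
  memLp k := MemLp.of_eval_piLp fun i => hL _
  mean k := by
    ext i : 1
    rw [eval_integral_piLp fun i => (hL (idx k i)).integrable one_le_two]
    simp [h0]
  indep k := by
    refine indep_of_indep_of_le_right (indep_pastFiltration hX₀ hn time hi h₀ k) ?_
    rw [← measurable_iff_comap_le]
    refine measurable_toLp_stacked (mΩ := _) fun i => ?_
    exact Measurable.of_comap_le <|
      le_biSup (fun p => MeasurableSpace.comap (n p) inferInstance)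
        (show idx k i ∈ {p | time p = k} from hidx k i)

lemma summable_stacked {γ : ℕ → ℝ} {n : ℕ → Fin m → Ω → Vec d} (hn : ∀ k i, MemLp (n k i) 2 μ)
    (hs : Summable fun k => γ k ^ 2 * ⨆ i : Fin m, ∫ ω, ‖n k i ω‖ ^ 2 ∂μ) :
    Summable fun k => γ k ^ 2 *
      ∫ ω, ‖(WithLp.toLp 2 fun i => n k i ω : StackedVec m (Vec d))‖ ^ 2 ∂μ := by
  refine (hs.mul_left (m : ℝ)).of_nonneg_of_le (fun k => mul_nonneg (sq_nonneg _)
    (integral_nonneg fun ω => sq_nonneg _)) fun k => ?_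
  rw [mul_left_comm]
  refine mul_le_mul_of_nonneg_left ?_ (sq_nonneg _)
  have e : ∀ ω, ‖(WithLp.toLp 2 fun i => n k i ω : StackedVec m (Vec d))‖ ^ 2
      = ∑ i, ‖n k i ω‖ ^ 2 := fun ω => PiLp.norm_sq_eq_of_L2 _ _
  simp_rw [e]
  rw [integral_finsetSum _ fun i _ => integrable_norm_sq (hn k i)]
  refine (Finset.sum_le_sum fun i _ =>
    le_ciSup (f := fun i => ∫ ω, ‖n k i ω‖ ^ 2 ∂μ) (Set.finite_range _).bddAbove i).trans_eq ?_
  simp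

end StackedNoise

/-! ### Regularity of the stacked gradient. -/

section Gradients

variable {m d : ℕ} {f : Fin m → Vec d → ℝ}

/-- The stacked local gradients. -/
noncomputable def stackedGradient (f : Fin m → Vec d → ℝ) (x : StackedVec m (Vec d)) :
    StackedVec m (Vec d) :=
  WithLp.toLp 2 fun i => gradient (f i) (x i)

lemma norm_stackedGradient_sub_le {L : ℝ} (hL : 0 ≤ L)
    (h : ∀ i (a b : Vec d), ‖gradient (f i) a - gradient (f i) b‖ ≤ L * ‖a - b‖)
    (a b : StackedVec m (Vec d)) :
    ‖stackedGradient f a - stackedGradient f b‖ ≤ L * ‖a - b‖ := by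
  refine le_of_sq_le_sq ?_ (by positivity)
  rw [mul_pow, PiLp.norm_sq_eq_of_L2, PiLp.norm_sq_eq_of_L2, Finset.mul_sum]
  refine Finset.sum_le_sum fun i _ => ?_
  rw [← mul_pow]
  exact pow_le_pow_left₀ (norm_nonneg _) (h i (a i) (b i)) 2

lemma norm_stackedGradient_le {B : ℝ} (h : ∀ i a, ‖gradient (f i) a‖ ≤ B)
    (a : StackedVec m (Vec d)) : ‖stackedGradient f a‖ ≤ m * B := by
  refine (stackedVec_norm_le_sum _).trans ((Finset.sum_le_sum fun i _ => h i (a i)).trans_eq ?_)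
  simp

end Gradients

/-! ### The algorithm as a tracking system. -/

section Assembly

variable {m d : ℕ} {f : Fin m → Vec d → ℝ} {R C : Matrix (Fin m) (Fin m) ℝ}

lemma isLyapunov_of_row (V : Type*) [NormedAddCommGroup V] [InnerProductSpace ℝ V]
    [FiniteDimensional ℝ V] {W : Matrix (Fin m) (Fin m) ℝ}
    (hoff : ∀ i j, i ≠ j → 0 ≤ W i j) (hrow : ∀ i, ∑ j, W i j = 0) {ε : ℝ} (hε : 0 < ε)
    (hdiag : ∀ i, 0 < 1 + ε * W i i) {r : Fin m} (hr : IsSpanningTreeRoot W r)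
    {u : Fin m → ℝ} (hu : ∀ i, 0 ≤ u i) (hum : ∑ i, u i = m) (huW : u ᵥ* W = 0) :
    ∃ N c γ₀, IsLyapunov (blockAction m V W) (blockAction m V (averagingProj u))
      (orbitMap (1 + ε • blockAction m V W) (blockAction m V (averagingProj u)) N) c γ₀ := by
  refine exists_isLyapunov_blockAction V (mul_averagingProj_eq_self hrow u)
    (averagingProj_mul_eq_self huW) (averagingProj_mul_self r.pos hum) hε fun η hη => ?_
  obtain ⟨N, hN0, hN⟩ := exists_pow_close hoff hrow hε hdiag hr hu hum huW hη
  exact ⟨N, hN0, fun i j => by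
    rw [one_add_smul_pow_mul_averagingProj hrow]; exact hN i j⟩

/-- This is the row case transposed: the projection becomes `1 - (1/m) v 1ᵀ`, and `(1 + ε • W) ^ N`
times it is the transpose of the matrix already estimated for `Wᵀ`. -/
lemma isLyapunov_of_column (V : Type*) [NormedAddCommGroup V] [InnerProductSpace ℝ V]
    [FiniteDimensional ℝ V] {W : Matrix (Fin m) (Fin m) ℝ}
    (hoff : ∀ i j, i ≠ j → 0 ≤ Wᵀ i j) (hrow : ∀ i, ∑ j, Wᵀ i j = 0) {ε : ℝ} (hε : 0 < ε)
    (hdiag : ∀ i, 0 < 1 + ε * Wᵀ i i) {r : Fin m} (hr : IsSpanningTreeRoot Wᵀ r)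
    {v : Fin m → ℝ} (hv : ∀ i, 0 ≤ v i) (hvm : ∑ i, v i = m) (hvW : v ᵥ* Wᵀ = 0) :
    ∃ N c γ₀, IsLyapunov (blockAction m V W) (blockAction m V (averagingProj v)ᵀ)
      (orbitMap (1 + ε • blockAction m V W) (blockAction m V (averagingProj v)ᵀ) N) c γ₀ := by
  refine exists_isLyapunov_blockAction V ?_ ?_ ?_ hε fun η hη => ?_
  · rw [← Matrix.transpose_inj, Matrix.transpose_mul, Matrix.transpose_transpose,
      averagingProj_mul_eq_self hvW]
  · rw [← Matrix.transpose_inj, Matrix.transpose_mul, Matrix.transpose_transpose,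
      mul_averagingProj_eq_self hrow]
  · rw [← Matrix.transpose_mul, averagingProj_mul_self r.pos hvm]
  · obtain ⟨N, hN0, hN⟩ := exists_pow_close hoff hrow hε hdiag hr hv hvm hvW hη
    refine ⟨N, hN0, fun i j => ?_⟩
    have e : (1 + ε • W) ^ N * (averagingProj v)ᵀ
        = (averagingProj v * (1 + ε • Wᵀ) ^ N)ᵀ := by
      simp [Matrix.transpose_mul, Matrix.transpose_pow]
    rw [e, Matrix.transpose_apply, averagingProj_mul_one_add_smul_pow hvW]
    exact hN j i

lemma xUpdate_eq (hoff : ∀ i j, i ≠ j → 0 ≤ R i j) (g lam : ℝ) (x y ζ : Fin m → Vec d)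
    (i : Fin m) : xUpdate R g lam x y ζ i = x i + g • ∑ j, R i j • x j - lam • y i
      + g • ∑ j, offDiag R i j • ζ j := by
  have h1 : ∑ j, R i j • x j = ∑ j, offDiag R i j • x j + R i i • x i := by
    simp [offDiag, sub_smul, Finset.sum_sub_distrib, Matrix.diagonal_apply]
  rw [xUpdate, sum_inNbr_smul hoff, h1]
  simp only [smul_add, Finset.sum_add_distrib]
  module

lemma yUpdate_eq (hoff : ∀ i j, i ≠ j → 0 ≤ C i j) (g a : ℝ) (x x' y ξ : Fin m → Vec d)
    (i : Fin m) : yUpdate f C g a x x' y ξ i = (1 - a) • y i + g • ∑ j, C i j • y j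
      + g • ∑ j, offDiag C i j • ξ j + gradient (f i) (x' i) - (1 - a) • gradient (f i) (x i) := by
  have h1 : ∑ j, C i j • y j = ∑ j, offDiag C i j • y j + C i i • y i := by
    simp [offDiag, sub_smul, Finset.sum_sub_distrib, Matrix.diagonal_apply]
  rw [yUpdate, sum_inNbr_smul hoff, h1]
  simp only [smul_add, Finset.sum_add_distrib]
  module

/-- The weighted average of the stacked states. -/
noncomputable def stackedAvg (u : Fin m → ℝ) : StackedVec m (Vec d) →L[ℝ] Vec d :=
  (1 / (m : ℝ)) • ∑ i, u i • PiLp.proj 2 (fun _ : Fin m => Vec d) i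

lemma stackedAvg_apply (u : Fin m → ℝ) (x : StackedVec m (Vec d)) :
    stackedAvg u x = (1 / (m : ℝ)) • ∑ i, u i • x i := by
  simp [stackedAvg]

lemma stackedAvg_blockAction {W : Matrix (Fin m) (Fin m) ℝ} {u : Fin m → ℝ} (hu : u ᵥ* W = 0)
    (x : StackedVec m (Vec d)) : stackedAvg u (blockAction m (Vec d) W x) = 0 := by
  rw [stackedAvg_apply]
  simp only [blockAction_apply, Finset.smul_sum, smul_smul]
  rw [Finset.sum_comm]
  refine Finset.sum_eq_zero fun j _ => ?_
  rw [← Finset.sum_smul]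
  have h1 : ∑ i, u i * W i j = 0 := congrFun hu j
  have h2 : ∑ i, 1 / (m : ℝ) * (u i * W i j) = 0 := by rw [← Finset.mul_sum, h1, mul_zero]
  rw [h2, zero_smul]

/-- The average descent direction is a multiple of the gradient up to the consensus error and the
tracking error. -/
lemma exists_norm_stackedAvg_sub_gradient_sq_le (hm : 0 < m)
    (hf : ∀ i, Differentiable ℝ (f i)) {L : ℝ} (hL : 0 ≤ L)
    (h : ∀ i (a b : Vec d), ‖gradient (f i) a - gradient (f i) b‖ ≤ L * ‖a - b‖)
    (u v : Fin m → ℝ) :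
    ∃ K : ℝ, ∀ x y : StackedVec m (Vec d),
      ‖stackedAvg u y - (1 / (m : ℝ) * ∑ i, u i * v i)
          • gradient (objective f) (stackedAvg u x)‖ ^ 2 ≤
        K * (‖blockAction m (Vec d) (averagingProj u) x‖ ^ 2
          + ‖blockAction m (Vec d) (averagingProj v)ᵀ y‖ ^ 2
          + ‖(1 - blockAction m (Vec d) (averagingProj v)ᵀ) (y - stackedGradient f x)‖ ^ 2) := by
  set T : StackedVec m (Vec d) →L[ℝ] Vec d := stackedAvg u with hT
  set P₁ := blockAction m (Vec d) (averagingProj u) with hP₁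
  set P₂ := blockAction m (Vec d) (averagingProj v)ᵀ with hP₂
  set κ := 1 / (m : ℝ) * ∑ i, u i * v i with hκ
  refine ⟨3 * (‖T‖ + |κ| * L) ^ 2, fun x y => ?_⟩
  -- Each block of `(1 - P₂) z` is `v i` times the mean of `z`, so the `u`-average produces the
  -- factor `κ`.
  have hcomp : ∀ z : StackedVec m (Vec d), T ((1 - P₂) z) = κ • (1 / (m : ℝ)) • ∑ j, z j := by
    intro z
    have h1 : ∀ i, ((1 - P₂) z) i = v i • (1 / (m : ℝ)) • ∑ j, z j := fun i => by
      rw [sub_apply, PiLp.sub_apply, blockAction_averagingProj_transpose]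
      simp
    rw [hT, stackedAvg_apply]
    simp only [h1, smul_smul]
    rw [← Finset.sum_smul, smul_smul, hκ]
    congr 1
    rw [Finset.mul_sum, Finset.mul_sum, Finset.sum_mul]
    exact Finset.sum_congr rfl fun i _ => by ring
  -- Three errors: disagreement of `y`, mean tracking error, and gradients taken at the local states
  -- instead of their average.
  have e : T y - κ • gradient (objective f) (T x) = T (P₂ y)
      + T ((1 - P₂) (y - stackedGradient f x))
      + κ • (1 / (m : ℝ)) • ∑ j, (gradient (f j) (x j) - gradient (f j) (T x)) := by
    have e1 : T y = T (P₂ y) + T ((1 - P₂) (y - stackedGradient f x))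
        + T ((1 - P₂) (stackedGradient f x)) := by
      rw [← map_add, ← map_add]
      congr 1
      simp only [sub_apply, one_apply_eq_self, map_sub]
      abel
    rw [e1, hcomp (stackedGradient f x), (hasGradientAt_objective hf (T x)).gradient,
      Finset.sum_sub_distrib, smul_sub, smul_sub]
    simp only [stackedGradient]
    abel
  have b1 : ‖T (P₂ y)‖ ≤ (‖T‖ + |κ| * L) * ‖P₂ y‖ :=
    (T.le_opNorm _).trans (mul_le_mul_of_nonneg_right
      (le_add_of_nonneg_right (by positivity)) (norm_nonneg _))
  have b2 : ‖T ((1 - P₂) (y - stackedGradient f x))‖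
      ≤ (‖T‖ + |κ| * L) * ‖(1 - P₂) (y - stackedGradient f x)‖ :=
    (T.le_opNorm _).trans (mul_le_mul_of_nonneg_right
      (le_add_of_nonneg_right (by positivity)) (norm_nonneg _))
  have b3 : ‖κ • (1 / (m : ℝ)) • ∑ j, (gradient (f j) (x j) - gradient (f j) (T x))‖
      ≤ (‖T‖ + |κ| * L) * ‖P₁ x‖ := by
    have h1 : ‖(1 / (m : ℝ)) • ∑ j, (gradient (f j) (x j) - gradient (f j) (T x))‖
        ≤ L * ‖P₁ x‖ := by
      refine norm_inv_smul_sum_le hm fun j => (h j _ _).trans (mul_le_mul_of_nonneg_left ?_ hL)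
      have := PiLp.norm_apply_le (P₁ x) j
      rwa [blockAction_averagingProj, ← stackedAvg_apply] at this
    rw [norm_smul, Real.norm_eq_abs]
    calc |κ| * _ ≤ |κ| * (L * ‖P₁ x‖) := mul_le_mul_of_nonneg_left h1 (abs_nonneg _)
      _ = |κ| * L * ‖P₁ x‖ := by ring
      _ ≤ _ := mul_le_mul_of_nonneg_right (le_add_of_nonneg_left (norm_nonneg _)) (norm_nonneg _)
  have b4 : ‖T y - κ • gradient (objective f) (T x)‖
      ≤ (‖T‖ + |κ| * L) * (‖P₁ x‖ + ‖P₂ y‖ + ‖(1 - P₂) (y - stackedGradient f x)‖) := by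
    rw [e]
    refine (norm_add₃_le).trans ?_
    linarith
  refine (pow_le_pow_left₀ (norm_nonneg _) b4 2).trans ?_
  rw [mul_pow, mul_comm 3, mul_assoc]
  refine mul_le_mul_of_nonneg_left ?_ (sq_nonneg _)
  set a := ‖P₁ x‖
  set b := ‖P₂ y‖
  set c := ‖(1 - P₂) (y - stackedGradient f x)‖
  nlinarith [sq_nonneg (a - b), sq_nonneg (a - c), sq_nonneg (b - c)]

variable {Ω : Type*} {mΩ : MeasurableSpace Ω} {μ : Measure Ω} [IsProbabilityMeasure μ]
  {γ₁ γ₂ α lam : ℕ → ℝ} {x₀ : Fin m → Ω → Vec d} {ζ ξ : ℕ → Fin m → Ω → Vec d}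
  {x y : ℕ → Fin m → Ω → Vec d}

/-- The iterates form a tracking system for the filtration generated by the initial points and the
noise. -/
lemma exists_trackingSystem
    (hx : ∀ k i ω, x k i ω = (states f R C γ₁ γ₂ α lam (fun j => x₀ j ω)
      (fun l j => ζ l j ω) (fun l j => ξ l j ω) k).1 i)
    (hy : ∀ k i ω, y k i ω = (states f R C γ₁ γ₂ α lam (fun j => x₀ j ω)
      (fun l j => ζ l j ω) (fun l j => ξ l j ω) k).2 i)
    (htop : TopologyAssumption R C) (hnoise : NoiseAssumption μ γ₁ γ₂ x₀ ζ ξ)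
    {L B : ℝ} (hL : 0 ≤ L)
    (hLip : ∀ i (a b : Vec d), ‖gradient (f i) a - gradient (f i) b‖ ≤ L * ‖a - b‖)
    (hB : ∀ i a, ‖gradient (f i) a‖ ≤ B) :
    ∃ (ℱ : Filtration ℕ mΩ) (N₁ N₂ : ℕ → Ω → StackedVec m (Vec d)),
      TrackingSystem ℱ μ (blockAction m (Vec d) R) (blockAction m (Vec d) C) (stackedGradient f)
        L (m * B) γ₁ γ₂ α lam N₁ N₂ (fun k ω => WithLp.toLp 2 fun i => x k i ω)
        (fun k ω => WithLp.toLp 2 fun i => y k i ω) := by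
  have hX₀ : Measurable fun ω (i : Fin m) => x₀ i ω := measurable_pi_lambda _ hnoise.measurable_x₀
  set n : (ℕ × Fin m) ⊕ (ℕ × Fin m) → Ω → Vec d :=
    Sum.elim (fun p => ζ p.1 p.2) (fun p => ξ p.1 p.2) with hn
  have hnm : ∀ p, Measurable (n p) := by
    rintro (p | p)
    exacts [hnoise.measurable_ζ _ _, hnoise.measurable_ξ _ _]
  have hnL : ∀ p, MemLp (n p) 2 μ := by
    rintro (p | p)
    exacts [hnoise.memLp_ζ _ _, hnoise.memLp_ξ _ _]
  have hn0 : ∀ p, ∫ ω, n p ω ∂μ = 0 := by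
    rintro (p | p)
    exacts [hnoise.mean_ζ _ _, hnoise.mean_ξ _ _]
  have hind : IndepFun (fun ω (i : Fin m) => x₀ i ω) (fun ω p => n p ω) μ := by
    convert hnoise.indep_initial using 3 with ω p
    rcases p with p | p <;> rfl
  set time : (ℕ × Fin m) ⊕ (ℕ × Fin m) → ℕ := Sum.elim Prod.fst Prod.fst with htime
  -- Only received messages are noisy, so the noise passes through the off-diagonal parts.
  set A₁ := blockAction m (Vec d) (offDiag R)
  set A₂ := blockAction m (Vec d) (offDiag C)
  have n₁ := isCenteredNoise_stacked hX₀ hnm time hnoise.indep_noise hind hnL hn0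
    (fun k i => Sum.inl (k, i)) (fun k i => rfl)
  have n₂ := isCenteredNoise_stacked hX₀ hnm time hnoise.indep_noise hind hnL hn0
    (fun k i => Sum.inr (k, i)) (fun k i => rfl)
  have hxs : ∀ k ω, (states f R C γ₁ γ₂ α lam (fun j => x₀ j ω)
      (fun l j => ζ l j ω) (fun l j => ξ l j ω) k).1 = fun i => x k i ω := fun k ω =>
    funext fun i => (hx k i ω).symm
  have hys : ∀ k ω, (states f R C γ₁ γ₂ α lam (fun j => x₀ j ω)
      (fun l j => ζ l j ω) (fun l j => ξ l j ω) k).2 = fun i => y k i ω := fun k ω =>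
    funext fun i => (hy k i ω).symm
  have hxsucc : ∀ k i ω, x (k + 1) i ω = xUpdate R (γ₁ k) (lam k) (fun i => x k i ω)
      (fun i => y k i ω) (fun i => ζ k i ω) i := fun k i ω => by
    rw [hx, ← hxs, ← hys]; rfl
  have hysucc : ∀ k i ω, y (k + 1) i ω = yUpdate f C (γ₂ k) (α k) (fun i => x k i ω)
      (fun i => x (k + 1) i ω) (fun i => y k i ω) (fun i => ξ k i ω) i := fun k i ω => by
    rw [hy, ← hxs, ← hys, ← hxs]; rfl
  have hx0 : ∀ i ω, x 0 i ω = x₀ i ω := fun i ω => hx 0 i ω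
  refine ⟨pastFiltration hX₀ hnm time,
    fun k ω => A₁ (WithLp.toLp 2 fun i => ζ k i ω),
    fun k ω => A₂ (WithLp.toLp 2 fun i => ξ k i ω),
    { L_nonneg := hL
      lipschitz := norm_stackedGradient_sub_le hL hLip
      bounded := norm_stackedGradient_le hB
      noise₁ := n₁.map A₁
      noise₂ := n₂.map A₂
      sum₁ := n₁.summable_map (summable_stacked hnoise.memLp_ζ hnoise.summable_ζ) A₁
      sum₂ := n₂.summable_map (summable_stacked hnoise.memLp_ξ hnoise.summable_ξ) A₂
      measurable_X_zero := ?_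
      memLp_X_zero := MemLp.of_eval_piLp fun i => ?_
      Y_zero := fun ω => ?_
      X_succ := fun k ω => PiLp.ext fun i => ?_
      Y_succ := fun k ω => PiLp.ext fun i => ?_ }⟩
  · simp only [hx0]
    refine measurable_toLp_stacked (mΩ := _) fun i => ?_
    exact (measurable_pi_apply i).comp (measurable_initial_pastFiltration hX₀ hnm time 0)
  · simp only [hx0]
    exact hnoise.memLp_x₀ i
  · refine PiLp.ext fun i => ?_
    simp only [stackedGradient, hx0]
    rw [hy]
    rfl
  · simp only [PiLp.add_apply, PiLp.sub_apply, PiLp.smul_apply]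
    rw [hxsucc, xUpdate_eq htop.R_nonneg]
    rfl
  · simp only [PiLp.add_apply, PiLp.sub_apply, PiLp.smul_apply]
    rw [hysucc, yUpdate_eq htop.C_nonneg]
    rfl

end Assembly

/-! ### Almost sure convergence of the stacked iterates. -/

section Conclusion

variable {m d : ℕ} {f : Fin m → Vec d → ℝ} {R C : Matrix (Fin m) (Fin m) ℝ}

lemma isNormalizedLeftEigenvector_iff {γ : ℝ} (hγ : γ ≠ 0) (w : Fin m → ℝ) :
    IsNormalizedLeftEigenvector (1 + γ • R) 1 w ↔
      (∀ i, 0 ≤ w i) ∧ ∑ i, w i = m ∧ w ᵥ* R = 0 := by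
  simp [IsNormalizedLeftEigenvector, Matrix.vecMul_add, Matrix.vecMul_smul, hγ]

lemma isNormalizedRightEigenvector_iff {γ : ℝ} (hγ : γ ≠ 0) (a : ℝ) (w : Fin m → ℝ) :
    IsNormalizedRightEigenvector (a • (1 : Matrix (Fin m) (Fin m) ℝ) + γ • C) a w ↔
      (∀ i, 0 ≤ w i) ∧ ∑ i, w i = m ∧ w ᵥ* Cᵀ = 0 := by
  simp [IsNormalizedRightEigenvector, Matrix.add_mulVec, Matrix.smul_mulVec, hγ,
    Matrix.vecMul_transpose]

lemma gradient_objective (hf : ∀ i, Differentiable ℝ (f i)) (θ : Vec d) :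
    gradient (objective f) θ = (1 / (m : ℝ)) • ∑ i, gradient (f i) θ :=
  (hasGradientAt_objective hf θ).gradient

lemma differentiable_objective (hf : ∀ i, Differentiable ℝ (f i)) :
    Differentiable ℝ (objective f) :=
  fun θ => (hasGradientAt_objective hf θ).differentiableAt

lemma norm_gradient_objective_sub_le (hm : 0 < m) (hf : ∀ i, Differentiable ℝ (f i)) {L : ℝ}
    (h : ∀ i (a b : Vec d), ‖gradient (f i) a - gradient (f i) b‖ ≤ L * ‖a - b‖) (a b : Vec d) :
    ‖gradient (objective f) a - gradient (objective f) b‖ ≤ L * ‖a - b‖ := by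
  rw [gradient_objective hf, gradient_objective hf, ← smul_sub, ← Finset.sum_sub_distrib]
  exact norm_inv_smul_sum_le hm fun i => h i a b

lemma norm_gradient_objective_le (hm : 0 < m) (hf : ∀ i, Differentiable ℝ (f i)) {B : ℝ}
    (h : ∀ i a, ‖gradient (f i) a‖ ≤ B) (a : Vec d) : ‖gradient (objective f) a‖ ≤ B := by
  rw [gradient_objective hf]
  exact norm_inv_smul_sum_le hm fun i => h i a

variable {Ω : Type*} {mΩ : MeasurableSpace Ω} {μ : Measure Ω} [IsProbabilityMeasure μ]
  {ℱ : Filtration ℕ mΩ} {γ₁ γ₂ α lam : ℕ → ℝ} {N₁ N₂ X Y : ℕ → Ω → StackedVec m (Vec d)}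
  {G : StackedVec m (Vec d) → StackedVec m (Vec d)} {L B : ℝ}

/-- Along the averaged state the noise is asymptotically negligible for the objective. -/
lemma TrackingSystem.ae_exists_tendsto_sum_inner_gradient
    {W₁ W₂ : StackedVec m (Vec d) →L[ℝ] StackedVec m (Vec d)}
    (h : TrackingSystem ℱ μ W₁ W₂ G L B γ₁ γ₂ α lam N₁ N₂ X Y)
    {F : Vec d → ℝ} {L' B' : ℝ} (hg : ∀ a b, ‖gradient F a - gradient F b‖ ≤ L' * ‖a - b‖)
    (hB : ∀ a, ‖gradient F a‖ ≤ B') (T : StackedVec m (Vec d) →L[ℝ] Vec d) :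
    ∀ᵐ ω ∂μ, (∃ s, Tendsto (fun K => ∑ k ∈ Finset.range K,
        inner ℝ (gradient F (T (X k ω))) (γ₁ k • T (N₁ k ω))) atTop (𝓝 s)) ∧
      Summable fun k => ‖γ₁ k • T (N₁ k ω)‖ ^ 2 := by
  have hs := h.noise₁.summable_map h.sum₁ T
  have hc : Continuous (gradient F) :=
    (LipschitzWith.of_dist_le' fun a b => by
      simpa only [dist_eq_norm] using hg a b).continuous
  have hm : ∀ k, Measurable[ℱ k] fun ω => gradient F (T (X k ω)) := fun k =>
    (hc.comp T.continuous).measurable.comp (h.measurable_and_memLp k).1.1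
  have hL2 : ∀ k, MemLp (fun ω => gradient F (T (X k ω))) 2 μ := fun k =>
    MemLp.of_bound ((hm k).mono (ℱ.le k) le_rfl).aestronglyMeasurable B'
      (Eventually.of_forall fun ω => hB _)
  have hM : ∀ k, ∫ ω, ‖gradient F (T (X k ω))‖ ^ 2 ∂μ ≤ B' ^ 2 := fun k => by
    refine (integral_mono (integrable_norm_sq (hL2 k)) (integrable_const (B' ^ 2)) fun ω =>
      pow_le_pow_left₀ (norm_nonneg _) (hB _) 2).trans_eq ?_
    simp
  filter_upwards [(h.noise₁.map T).ae_exists_tendsto_sum_inner hs hm hL2 hM,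
    ae_summable_mul_norm_sq (fun k => sq_nonneg (γ₁ k)) (h.noise₁.map T).memLp hs] with ω h1 h2
  constructor
  · simpa only [inner_smul_right] using h1
  · simpa only [norm_smul, mul_pow, Real.norm_eq_abs, sq_abs] using h2

/-- Almost sure behaviour of the stacked iterates. -/
theorem TrackingSystem.ae_convergence
    (h : TrackingSystem ℱ μ (blockAction m (Vec d) R) (blockAction m (Vec d) C)
      (stackedGradient f) L B γ₁ γ₂ α lam N₁ N₂ X Y)
    (hstep : StepsizeAssumption R C γ₁ γ₂ α lam) (htop : TopologyAssumption R C)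
    {r : Fin m} (hrR : IsSpanningTreeRoot R r) (hrC : IsSpanningTreeRoot Cᵀ r)
    {u v : Fin m → ℝ} (hu : ∀ i, 0 ≤ u i) (hum : ∑ i, u i = m) (huR : u ᵥ* R = 0)
    (hv : ∀ i, 0 ≤ v i) (hvm : ∑ i, v i = m) (hvC : v ᵥ* Cᵀ = 0)
    (hf : ∀ i, Differentiable ℝ (f i)) {L' B' b : ℝ} (hL' : 0 ≤ L')
    (hLip : ∀ i (a b : Vec d), ‖gradient (f i) a - gradient (f i) b‖ ≤ L' * ‖a - b‖)
    (hB : ∀ i a, ‖gradient (f i) a‖ ≤ B') (hb : ∀ θ, b ≤ objective f θ) :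
    ∀ᵐ ω ∂μ, Tendsto (fun k => blockAction m (Vec d) (averagingProj u) (X k ω)) atTop (𝓝 0) ∧
      Tendsto (fun k => blockAction m (Vec d) (averagingProj v)ᵀ (Y k ω)) atTop (𝓝 0) ∧
      (∃ l, Tendsto (fun k => objective f (stackedAvg u (X k ω))) atTop (𝓝 l)) ∧
      Summable fun k => lam k * ‖gradient (objective f) (stackedAvg u (X k ω))‖ ^ 2 := by
  have hm := r.pos
  have hrowR := sum_row_eq_zero htop.R_nonneg htop.R_diag
  have hCoff : ∀ i j, i ≠ j → 0 ≤ Cᵀ i j := fun i j hij => htop.C_nonneg j i hij.symm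
  -- `outNbr C` unfolds to `inNbr Cᵀ`, so the column condition on `C` is the row condition on `Cᵀ`.
  have hrowC : ∀ i, ∑ j, Cᵀ i j = 0 := sum_row_eq_zero hCoff htop.C_diag
  -- The form is built with `ε = γ₁ 0`, an admissible positive step; it then serves all small `γ₁
  -- k`.
  obtain ⟨n₁, c₁, g₁, h₁⟩ := isLyapunov_of_row (Vec d) htop.R_nonneg hrowR (hstep.weak₁.pos 0)
    (hstep.weak₁.diag 0) hrR hu hum huR
  obtain ⟨n₂, c₂, g₂, h₂⟩ := isLyapunov_of_column (Vec d) hCoff hrowC (hstep.weak₂.pos 0)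
    (hstep.weak₂.diag 0) hrC hv hvm hvC
  have hW₁ : ∀ x, blockAction m (Vec d) R (blockAction m (Vec d) (averagingProj u) x)
      = blockAction m (Vec d) R x := fun x => by
    rw [← mul_apply_eq_comp, ← map_mul, mul_averagingProj_eq_self hrowR]
  have hP₂ : ∀ x, blockAction m (Vec d) (averagingProj v)ᵀ (blockAction m (Vec d) C x)
      = blockAction m (Vec d) C x := fun x => by
    rw [← mul_apply_eq_comp, ← map_mul, ← Matrix.transpose_transpose C,
      ← Matrix.transpose_mul, mul_averagingProj_eq_self hrowC]
  -- The summand of the common root `r` is positive; without it the averaged step could vanish.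
  have hκ : 0 < 1 / (m : ℝ) * ∑ i, u i * v i := by
    refine mul_pos (one_div_pos.2 (by exact_mod_cast hm)) <|
      Finset.sum_pos' (fun i _ => mul_nonneg (hu i) (hv i)) ⟨r, Finset.mem_univ r, mul_pos ?_ ?_⟩
    · exact root_pos_of_vecMul_eq_zero htop.R_nonneg hrowR (hstep.weak₁.pos 0)
        (hstep.weak₁.diag 0) hrR hu hum huR
    · exact root_pos_of_vecMul_eq_zero hCoff hrowC (hstep.weak₂.pos 0)
        (hstep.weak₂.diag 0) hrC hv hvm hvC
  have hg := norm_gradient_objective_sub_le hm hf hLip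
  obtain ⟨K, hK⟩ := exists_norm_stackedAvg_sub_gradient_sq_le hm hf hL' hLip u v
  filter_upwards [h.ae_decay hstep hW₁ hP₂ h₁ h₂,
    h.ae_exists_tendsto_sum_inner_gradient hg (norm_gradient_objective_le hm hf hB)
      (stackedAvg u)] with ω ⟨s₁, s₂, s₃, s₄, t₁, t₂⟩ ⟨⟨s, hs⟩, hn⟩
  refine ⟨t₁, t₂, exists_tendsto_of_perturbed_gradient (differentiable_objective hf) hL' hg hb
    hstep.lam_nonneg hκ (n := fun k => γ₁ k • stackedAvg u (N₁ k ω))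
    (p := fun k => stackedAvg u (Y k ω))
    (r := fun k => stackedAvg u (Y k ω) - (1 / (m : ℝ) * ∑ i, u i * v i) •
      gradient (objective f) (stackedAvg u (X k ω)))
    (fun k => ?_) (fun k => (add_sub_cancel _ _).symm) ?_ ?_ hn hs⟩
  · rw [h.X_succ]
    simp only [map_add, map_sub, map_smul, stackedAvg_blockAction huR, smul_zero, add_zero]
    abel
  -- The gradient error is bounded by exactly the three quantities whose squares are summable with
  -- weights `lam`.
  · refine (((s₁.add s₂).add s₃).mul_left K).of_nonneg_of_le
      (fun k => mul_nonneg (hstep.lam_nonneg k) (sq_nonneg _)) fun k => ?_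
    refine (mul_le_mul_of_nonneg_left (hK (X k ω) (Y k ω)) (hstep.lam_nonneg k)).trans_eq ?_
    ring
  · refine (s₄.mul_left (‖stackedAvg (d := d) u‖ ^ 2)).of_nonneg_of_le
      (fun k => mul_nonneg (sq_nonneg _) (sq_nonneg _)) fun k => ?_
    rw [mul_left_comm, ← mul_pow ‖stackedAvg u‖]
    exact mul_le_mul_of_nonneg_left
      (pow_le_pow_left₀ (norm_nonneg _) ((stackedAvg u).le_opNorm _) 2) (sq_nonneg _)

end Conclusion

end DPTracking

/-! ### The convergence theorem. -/

theorem theorem3 {m d : ℕ} {Ω : Type*} [MeasurableSpace Ω] (μ : Measure Ω)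
    [IsProbabilityMeasure μ]
    (f : Fin m → DPTracking.Vec d → ℝ) (R C : Matrix (Fin m) (Fin m) ℝ)
    (γ₁ γ₂ α lam : ℕ → ℝ)
    (x₀ : Fin m → Ω → DPTracking.Vec d) (ζ ξ : ℕ → Fin m → Ω → DPTracking.Vec d)
    (x y : ℕ → Fin m → Ω → DPTracking.Vec d)
    (hx : ∀ k i ω, x k i ω = (DPTracking.states f R C γ₁ γ₂ α lam (fun j => x₀ j ω)
      (fun l j => ζ l j ω) (fun l j => ξ l j ω) k).1 i)
    (hy : ∀ k i ω, y k i ω = (DPTracking.states f R C γ₁ γ₂ α lam (fun j => x₀ j ω)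
      (fun l j => ζ l j ω) (fun l j => ξ l j ω) k).2 i)
    (hobj : DPTracking.ObjectiveAssumption f)
    (htop : DPTracking.TopologyAssumption R C)
    (hnoise : DPTracking.NoiseAssumption μ γ₁ γ₂ x₀ ζ ξ)
    (hgrad : DPTracking.BoundedGradients f)
    (hstep : DPTracking.StepsizeAssumption R C γ₁ γ₂ α lam) :
    ∃ u v : Fin m → ℝ,
      -- `u` and `v` are, for every `k`, the unique normalized nonnegative eigenvectors
      (∀ k w, DPTracking.IsNormalizedLeftEigenvector (1 + γ₁ k • R) 1 w ↔ w = u) ∧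
      (∀ k w, DPTracking.IsNormalizedRightEigenvector
        ((1 - α k) • (1 : Matrix (Fin m) (Fin m) ℝ) + γ₂ k • C) (1 - α k) w ↔ w = v) ∧
      ∀ (xbar ybar : ℕ → Ω → DPTracking.Vec d),
        (∀ k ω, xbar k ω = DPTracking.weightedAvg u (fun i => x k i ω)) →
        (∀ k ω, ybar k ω = DPTracking.weightedAvg 1 (fun i => y k i ω)) →
        -- (a)
        (∀ᵐ ω ∂μ, ∃ l : ℝ,
          Tendsto (fun k => DPTracking.objective f (xbar k ω)) atTop (𝓝 l)) ∧
        (∀ᵐ ω ∂μ, ∀ i, Tendsto (fun k => ‖x k i ω - xbar k ω‖) atTop (𝓝 0) ∧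
          Tendsto (fun k => ‖y k i ω - v i • ybar k ω‖) atTop (𝓝 0)) ∧
        -- (b)
        (∀ᵐ ω ∂μ,
          liminf (fun k => ‖gradient (DPTracking.objective f) (xbar k ω)‖ₑ) atTop = 0) ∧
        (DPTracking.BoundedLevelSets (DPTracking.objective f) →
          ∀ᵐ ω ∂μ,
            Bornology.IsBounded (Set.range fun k => xbar k ω) ∧
            (∀ z, MapClusterPt z atTop (fun k => xbar k ω) →
              IsMinOn (DPTracking.objective f) Set.univ z) ∧
            ∀ i, Tendsto (fun k => DPTracking.objective f (x k i ω)) atTop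
              (𝓝 (⨅ θ, DPTracking.objective f θ))) := by
  obtain ⟨r, hrR, hrC⟩ := htop.common_root
  have hm := r.pos
  obtain ⟨θ, hθ⟩ := hobj.exists_optimal
  obtain ⟨L, hL, hLip⟩ := hobj.lipschitz
  obtain ⟨B, hB'⟩ := hgrad
  have hB := fun i a => DPTracking.norm_le_of_sum_abs_le (hB' i a)
  have hf := hobj.differentiable
  have hmin : ∀ a, DPTracking.objective f θ ≤ DPTracking.objective f a :=
    fun a => hθ (Set.mem_univ a)
  have hrowR := DPTracking.sum_row_eq_zero htop.R_nonneg htop.R_diag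
  have hCoff : ∀ i j, i ≠ j → 0 ≤ Cᵀ i j := fun i j hij => htop.C_nonneg j i hij.symm
  have hrowC : ∀ i, ∑ j, Cᵀ i j = 0 := DPTracking.sum_row_eq_zero hCoff htop.C_diag
  obtain ⟨u, hu, hum, huR⟩ := DPTracking.exists_nonneg_vecMul_eq_zero hm htop.R_nonneg hrowR
    (hstep.weak₁.pos 0) (hstep.weak₁.diag 0)
  obtain ⟨v, hv, hvm, hvC⟩ := DPTracking.exists_nonneg_vecMul_eq_zero hm hCoff hrowC
    (hstep.weak₂.pos 0) (hstep.weak₂.diag 0)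
  obtain ⟨ℱ, N₁, N₂, hsys⟩ :=
    DPTracking.exists_trackingSystem hx hy htop hnoise hL.le hLip hB
  have hae := hsys.ae_convergence hstep htop hrR hrC hu hum huR hv hvm hvC hf hL.le hLip hB hmin
  refine ⟨u, v, fun k w => ?_, fun k w => ?_, fun xbar ybar hxbar hybar => ?_⟩
  -- As `γ₁ k ≠ 0`, the eigenvector equation reduces to `w ᵥ* R = 0`, which does not depend on `k`.
  -- The same happens for `C`, where the `α k` terms cancel.
  · rw [DPTracking.isNormalizedLeftEigenvector_iff (hstep.weak₁.pos k).ne']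
    refine ⟨fun hw => ?_, fun hw => hw ▸ ⟨hu, hum, huR⟩⟩
    exact DPTracking.eq_of_vecMul_eq_zero htop.R_nonneg hrowR (hstep.weak₁.pos 0)
      (hstep.weak₁.diag 0) hrR hu hum huR hw.2.1 hw.2.2
  · rw [DPTracking.isNormalizedRightEigenvector_iff (hstep.weak₂.pos k).ne']
    refine ⟨fun hw => ?_, fun hw => hw ▸ ⟨hv, hvm, hvC⟩⟩
    exact DPTracking.eq_of_vecMul_eq_zero hCoff hrowC (hstep.weak₂.pos 0)
      (hstep.weak₂.diag 0) hrC hv hvm hvC hw.2.1 hw.2.2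
  have hxavg : ∀ k ω, DPTracking.stackedAvg u (WithLp.toLp 2 fun i => x k i ω) = xbar k ω :=
    fun k ω => by rw [DPTracking.stackedAvg_apply, hxbar]; rfl
  simp only [hxavg] at hae
  have hcons : ∀ᵐ ω ∂μ, ∀ i, Tendsto (fun k => ‖x k i ω - xbar k ω‖) atTop (𝓝 0) ∧
      Tendsto (fun k => ‖y k i ω - v i • ybar k ω‖) atTop (𝓝 0) := by
    filter_upwards [hae] with ω ⟨t₁, t₂, _⟩ i
    refine ⟨squeeze_zero (fun _ => norm_nonneg _) (fun k => ?_) (by simpa using t₁.norm),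
      squeeze_zero (fun _ => norm_nonneg _) (fun k => ?_) (by simpa using t₂.norm)⟩
    · have := PiLp.norm_apply_le (DPTracking.blockAction m (DPTracking.Vec d)
        (DPTracking.averagingProj u) (WithLp.toLp 2 fun i => x k i ω)) i
      rwa [DPTracking.blockAction_averagingProj, ← DPTracking.stackedAvg_apply, hxavg] at this
    · have := PiLp.norm_apply_le (DPTracking.blockAction m (DPTracking.Vec d)
        (DPTracking.averagingProj v)ᵀ (WithLp.toLp 2 fun i => y k i ω)) i
      rw [DPTracking.blockAction_averagingProj_transpose] at this
      simpa [hybar, DPTracking.weightedAvg] using this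
  have hd := DPTracking.differentiable_objective hf
  refine ⟨hae.mono fun ω h => h.2.2.1, hcons,
    hae.mono fun ω h => DPTracking.liminf_enorm_eq_zero hstep.lam_nonneg hstep.sum_lam h.2.2.2,
    fun hlev => ?_⟩
  filter_upwards [hae, hcons] with ω ⟨_, _, ⟨l, hl⟩, hs⟩ hc
  -- Convergent values are bounded above, so the averaged path stays in one sublevel set.
  obtain ⟨c, hbd⟩ := hl.bddAbove_range
  have hbdd : Bornology.IsBounded (Set.range fun k => xbar k ω) :=
    (hlev c).subset (by rintro _ ⟨k, rfl⟩; exact hbd ⟨k, rfl⟩)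
  obtain rfl := DPTracking.tendsto_min_of_convexOn hobj.convex hd hθ hbdd hstep.lam_nonneg
    hstep.sum_lam hs hl
  refine ⟨hbdd, fun z hz => ?_, fun i => ?_⟩
  · have hFz : DPTracking.objective f z = DPTracking.objective f θ := by
      have h1 : MapClusterPt (DPTracking.objective f z) atTop
          (DPTracking.objective f ∘ fun k => xbar k ω) :=
        hz.continuousAt_comp hd.continuous.continuousAt
      exact eq_of_nhds_neBot (NeBot.mono h1 (inf_le_inf_left _ hl))
    exact fun a ha => hFz ▸ hθ ha
  · have hinf : ⨅ a, DPTracking.objective f a = DPTracking.objective f θ :=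
      le_antisymm (ciInf_le ⟨_, by rintro _ ⟨a, rfl⟩; exact hmin a⟩ θ) (le_ciInf hmin)
    rw [hinf]
    -- Bounded gradients make `F` Lipschitz, so consensus carries the limit from the average to each
    -- agent.
    have h1 : Tendsto (fun k => DPTracking.objective f (x k i ω)
        - DPTracking.objective f (xbar k ω)) atTop (𝓝 0) := by
      refine squeeze_zero_norm (fun k => DPTracking.abs_sub_le_of_norm_gradient_le hobj.convex hd
        (DPTracking.norm_gradient_objective_le hm hf hB) _ _) ?_
      simpa using (hc i).1.const_mul B
    simpa using h1.add hl
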